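/- **Setting.** Logarithms are to base $2$. Let $\beta,c>0$ and $r>\max(1/\beta,1/c)$ be constants, and for $n\ge 2$ put $\lambda=\lambda(n)=\lceil(\log n)^r\rceil$ and $\ell=\lceil\log n\rceil$. For every security parameter $\lambda$ let $g=\lambda$ (lattice dimension), $q=q(\lambda)\ge 2$ (modulus), $\sigma=\sigma(\lambda)>0$ (noise) and $h=h(\lambda)$ be given, with $2(g+1)\lceil\log q\rceil\le h=O(g\log q)$ for $\lambda\ge1$. Let $1\le N=N(n)\le\mathrm{poly}(n)$ and assume $nN<q(\lambda(n))\le\mathrm{poly}(n)$ for all $n\ge2$. Let $\chi_\sigma$ be the discrete Gaussian on $\mathbb Z$, with weights $\exp(-\pi x^2/\sigma^2)$. Two distributions on bit strings are $(T,\varepsilon)$-indistinguishable if every Boolean circuit with at most $T$ gates distinguishes them with advantage at most $\varepsilon$; elements of $\mathbb Z_q$ are written with $\lceil\log q\rceil$ bits. *Subexponential LWE assumption:* for all sufficiently large $\lambda$, the distributions $(A, sA+e \bmod q)$ and $(A,u)$, with $A\in\mathbb Z_q^{g\times h}$, $s\in\mathbb Z_q^{1\times g}$, $u\in\mathbb Z_q^{1\times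 h}$ uniform and $e\leftarrow\chi_\sigma^h$, are $(2^{\lambda^\beta},2^{-\lambda^c})$-indistinguishable. *GSW.* $\mathsf{sk}=(-\bar s,1)$ with $\bar s\in\mathbb Z_q^g$ uniform; $\mathsf{pk}=\mathbf A\in\mathbb Z_q^{(g+1)\times h}$ consists of a uniform $\bar{\mathbf A}\in\mathbb Z_q^{g\times h}$ and the last row $\bar s\bar{\mathbf A}+e$, $e\leftarrow\chi_\sigma^h$; $\mathsf{Enc}(\mathsf{pk},\mu)=\mathbf A\mathbf R+\mu\mathbf G$ with $\mathbf R\in\{0,1\}^{h\times h}$ uniform and $\mathbf G$ the gadget matrix (powers of two, padded by zero columns). $\mathsf{Eval}$ evaluates a circuit gate by gate through the multilinear polynomials of the gates, where $1$ becomes $\mathbf G$ and the product of $X$ and $Y$ becomes $X\cdot\mathbf G^{-1}(Y)$, with $\mathbf G^{-1}$ the bit decomposition; it is deterministic. For $0\le i<n$ let $C_i$ be the circuit that tests the $\ell$ input bits one after the other for equality with the bits of $i$. *The algorithm $\mathsf{StreamAlg}$.* Let $1\le k\le n$ and let $\mathsf{StreamAlg}_0$ be any deterministic streaming algorithm for relaxed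 $k$-sparse recovery: on every stream of updates $(i_t,\Delta_t)$ which keeps the accumulated vector $x$ in $\{-N,\dots,N\}^n$ it reports a vector $x'\in\{-N,\dots,N\}^n$, as a list of its nonzero coordinates, with $x'=x$ if $\|x\|_0\le k$. $\mathsf{Setup}$ runs $\mathsf{StreamAlg}_0.\mathsf{Setup}$, draws uniform $\tilde{\mathsf{pk}},\tilde{\mathsf{ct}}_1,\dots,\tilde{\mathsf{ct}}_\ell\in\mathbb Z_q^{(g+1)\times h}$ and sets $sketch=0$. With $\hat{\mathsf{ct}}_i=\mathsf{Eval}(\tilde{\mathsf{pk}},C_i,\tilde{\mathsf{ct}}_1,\dots,\tilde{\mathsf{ct}}_\ell)$, $\mathsf{Update}(i,\Delta)$ runs $\mathsf{StreamAlg}_0.\mathsf{Update}(i,\Delta)$ and adds $\Delta\cdot\hat{\mathsf{ct}}_i$ to $sketch$. $\mathsf{Report}$ obtains $x'$ from $\mathsf{StreamAlg}_0.\mathsf{Report}$, outputs $\bot$ if $\|x'\|_0>k$, and otherwise outputs $x'$ if $\sum_i x'_i\hat{\mathsf{ct}}_i=sketch$ and $\bot$ if not. Running times $\mathcal R$ are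 those of fixed programs (not depending on $n$) on a random access machine with logarithmic cost that call the operations of $\mathsf{StreamAlg}_0$ as subroutines; $\tilde O(f)$ means $f\cdot\mathrm{poly}(\log n)$, with constants that do not depend on $n$, $k$, $\mathsf{StreamAlg}_0$, the stream or the random choices. **Proposition.** Under the subexponential LWE assumption the following hold. (a) *GSW is pseudorandom.* For all large $\lambda$, $\mathsf{pk}$ is $(2^{\lambda^\beta},2^{-\lambda^c})$-indistinguishable from a uniform matrix. There are constants $\beta',c'>1/r$ such that for all large $n$ and $\mu\in\{0,1\}$, with $\lambda=\lambda(n)$, the pair $(\mathsf{pk},\mathsf{Enc}(\mathsf{pk},\mu))$ is $(2^{\lambda^{\beta'}},2^{-\lambda^{c'}})$-indistinguishable from a pair of independent uniform matrices in $\mathbb Z_q^{(g+1)\times h}$. (b) *GSW is $\mathbb Z$-linearly homomorphic.* With $\lambda=\lambda(n)$, every matrix in $\mathbb Z_q^{(g+1)\times h}$ takes $\mathrm{poly}(\lambda)$ bits, and there is a $\mathrm{poly}(\lambda)$-time algorithm $\mathsf{LinearDec}$ such that for all large $n$, with probability at least $1-2^{-\lambda}$ over $(\mathsf{pk},\mathsf{sk})$,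 the following holds: for all ciphertexts $\mathsf{ct}_1,\dots,\mathsf{ct}_K$ of bits $\mu_1,\dots,\mu_K$ under $\mathsf{pk}$ (each a fresh encryption or the evaluation of a $C_i$ on fresh encryptions) and all $x_1,\dots,x_K\in\mathbb Z$ with $8\,K\max_j|x_j|\cdot\ell h^2(\sigma\lambda+1)\le q$, $\mathsf{LinearDec}(\mathsf{pk},\mathsf{sk},\sum_j x_j\mathsf{ct}_j)=\sum_j x_j\mu_j$. (c) *Complexity of $\mathsf{StreamAlg}$,* with $\lambda=\lambda(n)$, at every time of every stream that keeps $x$ in $\{-N,\dots,N\}^n$: 1. $(\tilde{\mathsf{pk}},\tilde{\mathsf{ct}}_1,\dots,\tilde{\mathsf{ct}}_\ell)$ and $sketch$ can be stored using $\tilde O(1)$ bits in total; 2. $\mathcal R(\mathsf{StreamAlg}.\mathsf{Update})\le\tilde O(1)+\mathcal R(\mathsf{StreamAlg}_0.\mathsf{Update})$; 3. $\mathcal R(\mathsf{StreamAlg}.\mathsf{Report})\le\tilde O(k)+\mathcal R(\mathsf{StreamAlg}_0.\mathsf{Report})$. -/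

import Mathlib

open Filter

noncomputable section

namespace GSWStream

/-! ### Boolean circuits -/

/-- A gate of fan-in two: an arbitrary binary Boolean operation applied to two earlier wires. -/
structure Gate where
  op : Bool → Bool → Bool
  fst : ℕ
  snd : ℕ

/-- A circuit is a straight-line sequence of gates. The inputs are the first wires, every gate
appends one wire, and the last wire is the output. The size is the number of gates. -/
abbrev Circuit := List Gate

/-- Evaluation of a circuit on wires of an arbitrary type `W`, given the interpretation `φ` of
the binary Boolean operations (`d` is the value of a wire that does not exist). -/
def Circuit.run {W : Type} (d : W) (φ : (Bool → Bool → Bool) → W → W → W)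
    (C : Circuit) (inputs : List W) : W :=
  (C.foldl (fun w γ => w ++ [φ γ.op (w.getD γ.fst d) (w.getD γ.snd d)]) inputs).getLastD d

/-- The Boolean value of a circuit. -/
def Circuit.eval (C : Circuit) (x : List Bool) : Bool :=
  Circuit.run false (fun op a b => op a b) C x

/-- The circuit on `l` inputs that tests whether the inputs are the bits of `i` (least significant
bit first). Wire `l` is the constant `1`, wire `l + j + 1` says that the bits `0, …, j` agree. -/
def pointCircuit (l i : ℕ) : Circuit :=
  ⟨fun _ _ => true, 0, 0⟩ ::
    (List.range l).map fun j => ⟨fun a b => (a == i.testBit j) && b, j, l + j⟩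

/-! ### Distributions, advantage of distinguishers -/

/-- `m` independent samples. -/
def iid {α : Type} (p : PMF α) : (m : ℕ) → PMF (Fin m → α)
  | 0 => PMF.pure Fin.elim0
  | m + 1 => p.bind fun a => (iid p m).map (Fin.cons (α := fun _ => α) a)

/-- No circuit with at most `T` gates tells the two distributions on bit strings apart with
advantage more than `ε`. -/
def Indist (T ε : ℝ) (D D' : PMF (List Bool)) : Prop :=
  ∀ C : Circuit, (C.length : ℝ) ≤ T →
    |((D.map C.eval) true).toReal - ((D'.map C.eval) true).toReal| ≤ ε

/-- The Gaussian weight `exp (-π x² / σ²)` on the integers. -/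
def gaussWeight (σ : ℝ) (x : ℤ) : ENNReal :=
  ENNReal.ofReal (Real.exp (-Real.pi * (x : ℝ) ^ 2 / σ ^ 2))

theorem gaussWeight_tsum_ne_zero (σ : ℝ) : ∑' x, gaussWeight σ x ≠ 0 := by
  intro h
  have h0 := ENNReal.tsum_eq_zero.1 h 0
  simp [gaussWeight] at h0

theorem gaussWeight_tsum_ne_top {σ : ℝ} (hσ : 0 < σ) : ∑' x, gaussWeight σ x ≠ ⊤ := by
  have hs : Summable fun x : ℤ => Real.exp (-Real.pi * (x : ℝ) ^ 2 / σ ^ 2) := by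
    have h := summable_pow_mul_jacobiTheta₂_term_bound 0 (T := 1 / σ ^ 2) (by positivity) 0
    refine h.congr fun x => ?_
    simp only [pow_zero, one_mul, Int.cast_abs]
    congr 1
    ring
  exact hs.tsum_ofReal_ne_top

/-- The discrete Gaussian distribution on `ℤ` with parameter `σ`. -/
def discreteGaussian (σ : ℝ) (hσ : 0 < σ) : PMF ℤ :=
  PMF.normalize (gaussWeight σ) (gaussWeight_tsum_ne_zero σ) (gaussWeight_tsum_ne_top hσ)

/-! ### Learning with errors and the GSW scheme -/

/-- Lattice dimension `g`, number of samples `h`, modulus `q`, noise parameter `σ`. -/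
structure Params where
  g : ℕ
  h : ℕ
  q : ℕ
  σ : ℝ
  two_le_q : 2 ≤ q
  σ_pos : 0 < σ

instance (P : Params) : NeZero P.q := ⟨by have := P.two_le_q; omega⟩

/-- The number `⌈log₂ q⌉` of bits of an element of `ℤ_q`. -/
def Params.len (P : Params) : ℕ := Nat.clog 2 P.q

/-- Public keys and ciphertexts are matrices in `ℤ_q^{(g+1) × h}`. -/
abbrev Ct (P : Params) : Type := Matrix (Fin (P.g + 1)) (Fin P.h) (ZMod P.q)

/-- Binary representation (`⌈log₂ q⌉` bits) of an element of `ℤ_q`. -/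
def bitsElt (P : Params) (x : ZMod P.q) : List Bool :=
  (List.range P.len).map fun t => x.val.testBit t

def bitsVec (P : Params) {m : ℕ} (v : Fin m → ZMod P.q) : List Bool :=
  (List.ofFn fun j => bitsElt P (v j)).flatten

/-- Row by row representation of a matrix over `ℤ_q`. -/
def bitsMat (P : Params) {l m : ℕ} (A : Matrix (Fin l) (Fin m) (ZMod P.q)) : List Bool :=
  (List.ofFn fun i => bitsVec P (A i)).flatten

/-- Noise vector: `h` coordinates of the discrete Gaussian, that is, the discrete Gaussian
on `ℤ^h`. -/
def noise (P : Params) : PMF (Fin P.h → ℤ) := iid (discreteGaussian P.σ P.σ_pos) P.h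

/-- LWE samples `(A, s A + e mod q)`. -/
def lweSample (P : Params) :
    PMF (Matrix (Fin P.g) (Fin P.h) (ZMod P.q) × (Fin P.h → ZMod P.q)) :=
  (PMF.uniformOfFintype (Matrix (Fin P.g) (Fin P.h) (ZMod P.q))).bind fun A =>
  (PMF.uniformOfFintype (Fin P.g → ZMod P.q)).bind fun s =>
  (noise P).map fun e => (A, Matrix.vecMul s A + fun j => (e j : ZMod P.q))

/-- `(T, ε)`-hardness of decision LWE for the parameters `P`. -/
def LWEHard (P : Params) (T ε : ℝ) : Prop :=
  Indist T ε
    ((lweSample P).map fun x => bitsMat P x.1 ++ bitsVec P x.2)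
    ((PMF.uniformOfFintype
        (Matrix (Fin P.g) (Fin P.h) (ZMod P.q) × (Fin P.h → ZMod P.q))).map
      fun x => bitsMat P x.1 ++ bitsVec P x.2)

/-- Subexponential hardness: for all large security parameters `m`, circuits of size `2^(m^β)`
have advantage at most `2^(-m^c)`. -/
def SubexpLWE (params : ℕ → Params) (β c : ℝ) : Prop :=
  ∃ m₀ : ℕ, ∀ m > m₀, LWEHard (params m) (2 ^ ((m : ℝ) ^ β)) (2 ^ (-(m : ℝ) ^ c))

/-- Key generation: `pk` is `Ā` with the additional last row `s̄ Ā + e`, and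
`sk = (-s̄, 1)`. -/
def keyGen (P : Params) : PMF (Ct P × (Fin (P.g + 1) → ZMod P.q)) :=
  (PMF.uniformOfFintype (Fin P.g → ZMod P.q)).bind fun s =>
  (PMF.uniformOfFintype (Matrix (Fin P.g) (Fin P.h) (ZMod P.q))).bind fun A =>
  (noise P).map fun e =>
    (Fin.snoc (α := fun _ => Fin P.h → ZMod P.q) A
        (Matrix.vecMul s A + fun j => (e j : ZMod P.q)),
      Fin.snoc (α := fun _ => ZMod P.q) (-s) 1)

/-- The gadget matrix: row `i` carries `1, 2, 4, …, 2^(⌈log q⌉ - 1)` in the `i`-th block of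
`⌈log q⌉` columns; the columns behind the last block are zero. -/
def gadget (P : Params) : Ct P :=
  Matrix.of fun i j => if (j : ℕ) / P.len = i then 2 ^ ((j : ℕ) % P.len) else 0

/-- The bit decomposition `G⁻¹`: column `j` lists the bits of the entries of column `j`. -/
def gadgetInv (P : Params) (M : Ct P) : Matrix (Fin P.h) (Fin P.h) (ZMod P.q) :=
  Matrix.of fun t j =>
    if ht : (t : ℕ) / P.len < P.g + 1 then
      if (M ⟨(t : ℕ) / P.len, ht⟩ j).val.testBit ((t : ℕ) % P.len) then 1 else 0
    else 0

/-- Encryption `A R + μ G` with the randomness `R ∈ {0,1}^{h × h}` explicit. -/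
def enc (P : Params) (pk : Ct P) (μ : Bool) (R : Matrix (Fin P.h) (Fin P.h) Bool) : Ct P :=
  pk * R.map (fun b => if b then (1 : ZMod P.q) else 0) + if μ then gadget P else 0

/-- Homomorphic evaluation of a binary gate: the multilinear polynomial of the gate, with `1`
replaced by `G` and the product of ciphertexts by `X · G⁻¹(Y)`. -/
def gateEval (P : Params) (op : Bool → Bool → Bool) (X Y : Ct P) : Ct P :=
  let v : Bool → Bool → ℤ := fun a b => if op a b then 1 else 0
  v false false • gadget P + (v true false - v false false) • X
    + (v false true - v false false) • Y
    + (v true true - v true false - v false true + v false false) • (X * gadgetInv P Y)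

/-- GSW evaluation (deterministic; the public key is not needed). -/
def evalCt (P : Params) (_pk : Ct P) (C : Circuit) {l : ℕ} (cts : Fin l → Ct P) : Ct P :=
  Circuit.run 0 (gateEval P) C (List.ofFn cts)

/-- The pair `(pk, Enc(pk, μ))` as a bit string. -/
def realKeyCt (P : Params) (μ : Bool) : PMF (List Bool) :=
  (keyGen P).bind fun κ =>
    (PMF.uniformOfFintype (Matrix (Fin P.h) (Fin P.h) Bool)).map fun R =>
      bitsMat P κ.1 ++ bitsMat P (enc P κ.1 μ R)

/-- A pair of uniform matrices as a bit string. -/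
def uniformKeyCt (P : Params) : PMF (List Bool) :=
  (PMF.uniformOfFintype (Ct P × Ct P)).map fun x => bitsMat P x.1 ++ bitsMat P x.2

/-- `ct` is a ciphertext of `μ` under `pk`: a fresh encryption, or the result of evaluating one
of the circuits `C_i`, `i < n`, on fresh encryptions. -/
def IsCiphertext (P : Params) (n : ℕ) (pk : Ct P) (μ : Bool) (ct : Ct P) : Prop :=
  (∃ R, ct = enc P pk μ R) ∨
  ∃ (i : Fin n) (b : Fin (Nat.clog 2 n) → Bool)
    (R : Fin (Nat.clog 2 n) → Matrix (Fin P.h) (Fin P.h) Bool),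
    μ = (pointCircuit (Nat.clog 2 n) i).eval (List.ofFn b) ∧
    ct = evalCt P pk (pointCircuit (Nat.clog 2 n) i) fun j => enc P pk (b j) (R j)

/-! ### A random access machine with logarithmic cost

Memory consists of integer arrays. Every operation is charged for the bits of its operands
(quadratically for products and divisions), every memory access for the bits of the address and
of the content. Loops are bounded: the number of rounds is computed before the loop is entered.
A program may call one subroutine; a call costs one step more than the subroutine. -/

/-- `M a i` is the content of cell `i` of array `a`. -/
abbrev Mem : Type := ℕ → ℕ → ℤ

inductive BinOp
  | add | sub | mul | div | mod | le | eq

def BinOp.eval : BinOp → ℤ → ℤ → ℤ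
  | add, x, y => x + y
  | sub, x, y => x - y
  | mul, x, y => x * y
  | div, x, y => x / y
  | mod, x, y => x % y
  | le, x, y => if x ≤ y then 1 else 0
  | eq, x, y => if x = y then 1 else 0

/-- One more than the number of bits of `|x|`. -/
def bitCost (x : ℤ) : ℕ := x.natAbs.size + 1

def BinOp.cost : BinOp → ℤ → ℤ → ℕ
  | mul, x, y => bitCost x * bitCost y
  | div, x, y => bitCost x * bitCost y
  | mod, x, y => bitCost x * bitCost y
  | _, x, y => bitCost x + bitCost y

inductive Expr
  | lit (z : ℤ)
  | read (a : ℕ) (i : Expr)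
  | bin (o : BinOp) (e f : Expr)

def Expr.eval (M : Mem) : Expr → ℤ
  | lit z => z
  | read a i => M a (i.eval M).toNat
  | bin o e f => o.eval (e.eval M) (f.eval M)

def Expr.cost (M : Mem) : Expr → ℕ
  | lit z => bitCost z
  | read a i => i.cost M + bitCost (i.eval M) + bitCost (M a (i.eval M).toNat)
  | bin o e f => e.cost M + f.cost M + o.cost (e.eval M) (f.eval M)

inductive Cmd
  | skip
  | write (a : ℕ) (i e : Expr)
  | seq (c d : Cmd)
  | ite (e : Expr) (c d : Cmd)
  | loop (e : Expr) (c : Cmd)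
  | call

/-- Store `z` in cell `i` of array `a`. -/
def Mem.store (M : Mem) (a i : ℕ) (z : ℤ) : Mem :=
  Function.update M a (Function.update (M a) i z)

/-- Execution of a program: resulting memory, resulting private state (of type `S`) of the
subroutine, and running time. -/
def Cmd.run {S : Type} (sub : Mem × S → (Mem × S) × ℕ) : Cmd → Mem × S → (Mem × S) × ℕ
  | skip, s => (s, 1)
  | write a i e, s =>
      ((s.1.store a (i.eval s.1).toNat (e.eval s.1), s.2),
        i.cost s.1 + e.cost s.1 + bitCost (i.eval s.1) + bitCost (e.eval s.1))
  | seq c d, s => ((d.run sub (c.run sub s).1).1, (c.run sub s).2 + (d.run sub (c.run sub s).1).2)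
  | ite e c d, s =>
      if e.eval s.1 ≠ 0 then ((c.run sub s).1, e.cost s.1 + 1 + (c.run sub s).2)
      else ((d.run sub s).1, e.cost s.1 + 1 + (d.run sub s).2)
  | loop e c, s =>
      (fun p : (Mem × S) × ℕ => ((c.run sub p.1).1, p.2 + 1 + (c.run sub p.1).2))^[
        (e.eval s.1).toNat] (s, e.cost s.1 + 1)
  | call, s => ((sub s).1, (sub s).2 + 1)

/-- The subroutine of a program that has none. -/
def noSub (s : Mem × Unit) : (Mem × Unit) × ℕ := (s, 0)

/-! ### Streams and streaming algorithms -/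

/-- The vector that a stream of updates `(i_t, Δ_t)` accumulates. -/
def accumulate {n : ℕ} (u : List (Fin n × ℤ)) (i : Fin n) : ℤ :=
  (u.map fun p => if p.1 = i then p.2 else 0).sum

/-- Throughout the stream the vector stays in `{-N, …, N}^n`. -/
def BoundedStream {n : ℕ} (N : ℕ) (u : List (Fin n × ℤ)) : Prop :=
  ∀ v, v <+: u → ∀ i, |accumulate v i| ≤ (N : ℤ)

/-- The list contains exactly the nonzero coordinates of `x`, each once, in any order. -/
def IsSparseList {n : ℕ} (l : List (Fin n × ℤ)) (x : Fin n → ℤ) : Prop :=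
  (l.map Prod.fst).Nodup ∧ ∀ i v, (i, v) ∈ l ↔ x i = v ∧ v ≠ 0

/-- A deterministic streaming algorithm that reports a vector in `ℤ^n`, written as the list of its
nonzero coordinates, together with the running times of its operations. -/
structure RecoveryAlg (n : ℕ) where
  State : Type
  setup : State
  update : State → Fin n → ℤ → State
  report : State → Fin n → ℤ
  reportList : State → List (Fin n × ℤ)
  reportList_spec : ∀ s, IsSparseList (reportList s) (report s)
  updateTime : State → Fin n → ℤ → ℕ
  reportTime : State → ℕ

def RecoveryAlg.after {n : ℕ} (A : RecoveryAlg n) (u : List (Fin n × ℤ)) : A.State :=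
  u.foldl (fun s p => A.update s p.1 p.2) A.setup

/-- The algorithm solves relaxed `k`-sparse recovery on streams bounded by `N`: it reports the
vector if that is `k`-sparse, and some vector in `{-N, …, N}^n` otherwise. -/
def RecoveryAlg.SolvesRelaxed {n : ℕ} (A : RecoveryAlg n) (k N : ℕ) : Prop :=
  ∀ u, BoundedStream N u →
    (hammingNorm (accumulate u) ≤ k → A.report (A.after u) = accumulate u) ∧
    ∀ i, |A.report (A.after u) i| ≤ (N : ℤ)

/-! ### The streaming algorithm built from a recovery algorithm and GSW -/

/-- What is stored in addition to the state of the recovery algorithm. -/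
structure Stored (P : Params) (l : ℕ) where
  pk : Ct P
  cts : Fin l → Ct P
  sketch : Ct P

/-- The stored data as a bit string. -/
def Stored.bits {P : Params} {l : ℕ} (D : Stored P l) : List Bool :=
  bitsMat P D.pk ++ (List.ofFn fun j => bitsMat P (D.cts j)).flatten ++ bitsMat P D.sketch

structure StreamState {n : ℕ} (A : RecoveryAlg n) (P : Params) where
  inner : A.State
  data : Stored P (Nat.clog 2 n)

/-- The evaluated ciphertext for coordinate `i`. -/
def Stored.point {P : Params} {n : ℕ} (D : Stored P (Nat.clog 2 n)) (i : Fin n) : Ct P :=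
  evalCt P D.pk (pointCircuit (Nat.clog 2 n) i) D.cts

/-- Setup: uniform pseudo-key and pseudo-ciphertexts, sketch zero. -/
def streamSetup {n : ℕ} (A : RecoveryAlg n) (P : Params) : PMF (StreamState A P) :=
  (PMF.uniformOfFintype (Ct P)).bind fun pk =>
    (PMF.uniformOfFintype (Fin (Nat.clog 2 n) → Ct P)).map fun cts =>
      ⟨A.setup, ⟨pk, cts, 0⟩⟩

def streamUpdate {n : ℕ} {A : RecoveryAlg n} {P : Params} (s : StreamState A P) (i : Fin n)
    (Δ : ℤ) : StreamState A P :=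
  ⟨A.update s.inner i Δ,
    { s.data with sketch := s.data.sketch + Δ • s.data.point i }⟩

open Classical in
/-- The report; `none` stands for `⊥`. -/
def streamReport {n : ℕ} {A : RecoveryAlg n} {P : Params} (k : ℕ) (s : StreamState A P) :
    Option (Fin n → ℤ) :=
  if k < hammingNorm (A.report s.inner) then none
  else if ∑ i, A.report s.inner i • s.data.point i = s.data.sketch then some (A.report s.inner)
  else none

def streamAfter {n : ℕ} {A : RecoveryAlg n} {P : Params} (s₀ : StreamState A P)
    (u : List (Fin n × ℤ)) : StreamState A P :=
  u.foldl (fun s p => streamUpdate s p.1 p.2) s₀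

/-! ### Memory layout -/

/-- The matrix `X` is stored row by row in array `a` from cell `o` on. -/
def HoldsMat {P : Params} (M : Mem) (a o : ℕ) (X : Ct P) : Prop :=
  ∀ (i : Fin (P.g + 1)) (j : Fin P.h), M a (o + (i : ℕ) * P.h + (j : ℕ)) = ((X i j).val : ℤ)

/-- Array `0` contains the parameters. -/
def HoldsParams (M : Mem) (n k : ℕ) (P : Params) : Prop :=
  M 0 0 = n ∧ M 0 1 = k ∧ M 0 2 = P.g ∧ M 0 3 = P.h ∧ M 0 4 = P.q ∧ M 0 5 = P.len ∧
    M 0 6 = Nat.clog 2 n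

/-- Arrays `0` to `3` contain the parameters, the key, the ciphertexts and the sketch. -/
def HoldsStored (M : Mem) (n k : ℕ) {P : Params} (D : Stored P (Nat.clog 2 n)) : Prop :=
  HoldsParams M n k P ∧ HoldsMat M 1 0 D.pk ∧
    (∀ j : Fin (Nat.clog 2 n), HoldsMat M 2 ((j : ℕ) * ((P.g + 1) * P.h)) (D.cts j)) ∧ HoldsMat M 3 0 D.sketch

/-- A list of (index, value) pairs: its length in array `5`, the indices in array `6`, the values
in array `7`. -/
def HoldsList {n : ℕ} (M : Mem) (l : List (Fin n × ℤ)) : Prop :=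
  M 5 0 = l.length ∧
    ∀ t : Fin l.length, M 6 t = ((l.get t).1 : ℕ) ∧ M 7 t = (l.get t).2

/-- Cell `0` of array `8` says whether the output is a vector (`1`) or `⊥` (`0`); the vector is
given as the list of its nonzero coordinates. -/
def HoldsOutput {n : ℕ} (M : Mem) : Option (Fin n → ℤ) → Prop
  | none => M 8 0 = 0
  | some x => M 8 0 = 1 ∧ ∃ l, IsSparseList l x ∧ HoldsList M l

/-- The update operation of the recovery algorithm as a subroutine: the update `(i, Δ)` is taken
from the first two cells of array `4`. -/
def updateSub {n : ℕ} (A : RecoveryAlg n) (s : Mem × A.State) : (Mem × A.State) × ℕ :=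
  if hi : (s.1 4 0).toNat < n then
    ((s.1, A.update s.2 ⟨(s.1 4 0).toNat, hi⟩ (s.1 4 1)),
      A.updateTime s.2 ⟨(s.1 4 0).toNat, hi⟩ (s.1 4 1))
  else (s, 0)

/-- The report operation of the recovery algorithm as a subroutine: it writes the list of nonzero
coordinates to the arrays `5`, `6`, `7`. -/
def reportSub {n : ℕ} (A : RecoveryAlg n) (s : Mem × A.State) : (Mem × A.State) × ℕ :=
  let l := A.reportList s.2
  ((fun a t =>
      if a = 5 ∧ t = 0 then (l.length : ℤ)
      else if ht : t < l.length then
        if a = 6 then (((l.get ⟨t, ht⟩).1 : ℕ) : ℤ)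
        else if a = 7 then (l.get ⟨t, ht⟩).2
        else s.1 a t
      else s.1 a t, s.2), A.reportTime s.2)

/-- Input of the decoder: parameters, public key, secret key, ciphertext matrix. -/
def HoldsDecInput (M : Mem) (n k : ℕ) {P : Params} (κ : Ct P × (Fin (P.g + 1) → ZMod P.q))
    (X : Ct P) : Prop :=
  HoldsParams M n k P ∧ HoldsMat M 1 0 κ.1 ∧ (∀ i : Fin (P.g + 1), M 2 (i : ℕ) = ((κ.2 i).val : ℤ)) ∧
    HoldsMat M 3 0 X

/-! ### The claims -/

/-- The security parameter `⌈(log₂ n)^r⌉`. -/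
def secParam (r : ℝ) (n : ℕ) : ℕ := ⌈Real.logb 2 n ^ r⌉₊

/-- Pseudorandomness: public keys are indistinguishable from uniform matrices with the security
`(2^(m^β), 2^(-m^c))` of LWE, and pairs of a public key and an encryption of any bit are
indistinguishable from pairs of uniform matrices with security `(2^(m^β'), 2^(-m^c'))`, where
`m = secParam r n`, for constants `β', c' > 1/r`. -/
def PseudorandomKeysAndCiphertexts (params : ℕ → Params) (β c r : ℝ) : Prop :=
  (∃ m₀ : ℕ, ∀ m > m₀, Indist (2 ^ ((m : ℝ) ^ β)) (2 ^ (-(m : ℝ) ^ c))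
    ((keyGen (params m)).map fun κ => bitsMat (params m) κ.1)
    ((PMF.uniformOfFintype (Ct (params m))).map (bitsMat (params m)))) ∧
  ∃ β' c' : ℝ, 1 / r < β' ∧ 1 / r < c' ∧ ∃ n₀ : ℕ, ∀ n > n₀, ∀ μ : Bool,
    Indist (2 ^ ((secParam r n : ℝ) ^ β')) (2 ^ (-(secParam r n : ℝ) ^ c'))
      (realKeyCt (params (secParam r n)) μ) (uniformKeyCt (params (secParam r n)))

/-- Linear homomorphism over `ℤ`: ciphertext matrices have size polynomial in the security
parameter, and there is a polynomial time decoder which, with overwhelming probability over the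
keys, decodes every combination `∑ x_i ct_i` of `K` ciphertexts with `K · max |x_i|` small compared
with `q` to `∑ x_i μ_i`. -/
def LinearHomomorphism (params : ℕ → Params) (r : ℝ) : Prop :=
  ∃ (dec : Cmd) (B d : ℕ),
    (∀ n ≥ 2, ∀ (k : ℕ) (κ : Ct (params (secParam r n)) × (Fin _ → ZMod _))
      (X : Ct (params (secParam r n))),
      k ≤ n →
      (bitsMat _ X).length ≤ B * secParam r n ^ d ∧
      ∀ M, HoldsDecInput M n k κ X → (dec.run noSub (M, ())).2 ≤ B * secParam r n ^ d) ∧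
    ∃ n₀ : ℕ, ∀ n > n₀,
      ENNReal.ofReal (1 - 2 ^ (-(secParam r n : ℝ))) ≤
        (keyGen (params (secParam r n))).toOuterMeasure
          {κ | ∀ (K Xmax : ℕ) (x : Fin K → ℤ) (μ : Fin K → Bool)
              (ct : Fin K → Ct (params (secParam r n))),
            (∀ i, IsCiphertext _ n κ.1 (μ i) (ct i)) →
            (∀ i, |x i| ≤ (Xmax : ℤ)) →
            8 * ((K : ℝ) * Xmax) * Nat.clog 2 n * (params (secParam r n)).h ^ 2 *
                ((params (secParam r n)).σ * secParam r n + 1) ≤ (params (secParam r n)).q →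
            ∀ (k : ℕ) (M : Mem), HoldsDecInput M n k κ (∑ i, x i • ct i) →
              (dec.run noSub (M, ())).1.1 8 0 = ∑ i, x i * if μ i then 1 else 0}

/-- Complexity: with `m = secParam r n`, the stored data are written injectively with
polylogarithmically many bits, and there are fixed programs, running the operations of the recovery
algorithm as subroutines, which carry out the update and the report in time polylogarithmic
(times `k` for the report) plus the time of the subroutine. -/
def StreamComplexity (params : ℕ → Params) (N : ℕ → ℕ) (r : ℝ) : Prop :=
  ∃ (upd rep : Cmd) (B : ℝ) (d : ℕ), ∀ n ≥ 2,
    (Function.Injective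
        (Stored.bits : Stored (params (secParam r n)) (Nat.clog 2 n) → List Bool) ∧
      ∀ D : Stored (params (secParam r n)) (Nat.clog 2 n),
        (D.bits.length : ℝ) ≤ B * Real.logb 2 n ^ d) ∧
    ∀ (k : ℕ) (A : RecoveryAlg n), 1 ≤ k → k ≤ n → A.SolvesRelaxed k (N n) →
      ∀ s₀ ∈ (streamSetup A (params (secParam r n))).support, ∀ u : List (Fin n × ℤ),
        BoundedStream (N n) u →
        ∀ M : Mem, HoldsStored M n k (streamAfter s₀ u).data →
          (∀ (i : Fin n) (Δ : ℤ), BoundedStream (N n) (u ++ [(i, Δ)]) →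
            M 4 0 = (i : ℕ) → M 4 1 = Δ →
            let s := streamAfter s₀ u
            let out := upd.run (updateSub A) (M, s.inner)
            HoldsStored out.1.1 n k (streamUpdate s i Δ).data ∧
            out.1.2 = (streamUpdate s i Δ).inner ∧
            (out.2 : ℝ) ≤ B * Real.logb 2 n ^ d + A.updateTime s.inner i Δ) ∧
          (let s := streamAfter s₀ u
            let out := rep.run (reportSub A) (M, s.inner)
            HoldsOutput out.1.1 (streamReport k s) ∧
            HoldsStored out.1.1 n k s.data ∧
            out.1.2 = s.inner ∧
            (out.2 : ℝ) ≤ B * k * Real.logb 2 n ^ d + A.reportTime s.inner)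

end GSWStream

end

/-! The three claims have separate proofs, joined by the fact that `secParam r n` and `log n` are
polynomially related, so that "polynomial in one" and "polynomial in the other" mean the same
(`Regime.exists_polyBdd_le`).

Pseudorandomness. A public key is, bit for bit, an LWE sample, and this settles the claim about
keys. For pairs there are two hybrid steps. With the encryption randomness `R` fixed, encryption
only adds subsets of the entries of the key and constants. A circuit of size `encSize` does this
(`exists_encCircuit`), so a distinguisher for pairs yields one for keys. It builds arithmetic modulo
`q` from truth tables and costs `2 ^ O(log n)` gates; this fits below `2 ^ (m ^ b)` for every `b > 1
/ r`, as `m ^ b` is at least `(log n) ^ (r b)`. Once the key is uniform, the leftover hash lemma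
(`abs_expect_hash_le`) replaces `A R` by a uniform matrix. Its error is exponentially small in about
`m log n / 2`, hence below `2 ^ (-m ^ b)` for every `b < 1 + 1 / r`. Thus the new exponents can be
chosen above `1 / r`.

Linear homomorphism. A ciphertext `X` of `μ` satisfies `s X = μ s G + v` with small `v`. In `X *
G⁻¹(Y)` the noise of `X` is multiplied by a 0/1 matrix, while that of `Y` enters at most once. The
circuits `C_i` always have a fresh ciphertext on the left, so their noise grows only linearly in the
number of input bits (`Encrypts.pointGen`). An integer combination `∑ x_i ct_i` then satisfies the
same equation with `y = ∑ x_i μ_i` in place of `μ`. The last gadget block gives `2 ^ t y + e_t`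
modulo `q` for all `t`; doubling approximations recover `y` over the integers (`decApprox_round`).
The key noise is at most `σ m` up to a probability below `2 ^ (-m)`, by a Gaussian tail bound from
Poisson summation (`discreteGaussian_tail`).

Complexity. The programs are written out. Every program has a time bound `Cmd.bnd L`, polynomial in
`L` by recursion on the program, valid as long as the cells read have at most `L` bits and loops at
most `L` rounds. It then suffices to prove functional correctness together with these size
conditions (`Cmd.Safe`). The word length `L` is polylogarithmic in `n`. Only the loop over the
reported list can be longer; it has at most `k` rounds, and this is the factor `k` of the report. -/

namespace GSWStream

/-! ### Polynomially bounded functions -/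

/-- `f L ≤ C L^d` for all `L ≥ 1`. -/
def PolyBdd (f : ℕ → ℕ) : Prop := ∃ C d : ℕ, ∀ L ≥ 1, f L ≤ C * L ^ d

theorem PolyBdd.const (a : ℕ) : PolyBdd fun _ => a := ⟨a, 0, fun L _ => by simp⟩

theorem PolyBdd.id : PolyBdd fun L => L := ⟨1, 1, fun L _ => by simp⟩

theorem PolyBdd.add {f g : ℕ → ℕ} (hf : PolyBdd f) (hg : PolyBdd g) :
    PolyBdd fun L => f L + g L := by
  obtain ⟨C, d, h⟩ := hf
  obtain ⟨C', d', h'⟩ := hg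
  refine ⟨C + C', d + d', fun L hL => ?_⟩
  have h1 : L ^ d ≤ L ^ (d + d') := Nat.pow_le_pow_right hL (by omega)
  have h2 : L ^ d' ≤ L ^ (d + d') := Nat.pow_le_pow_right hL (by omega)
  calc f L + g L ≤ C * L ^ d + C' * L ^ d' := add_le_add (h L hL) (h' L hL)
    _ ≤ C * L ^ (d + d') + C' * L ^ (d + d') := by gcongr
    _ = _ := by ring

theorem PolyBdd.mul {f g : ℕ → ℕ} (hf : PolyBdd f) (hg : PolyBdd g) :
    PolyBdd fun L => f L * g L := by
  obtain ⟨C, d, h⟩ := hf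
  obtain ⟨C', d', h'⟩ := hg
  refine ⟨C * C', d + d', fun L hL => ?_⟩
  calc f L * g L ≤ (C * L ^ d) * (C' * L ^ d') := Nat.mul_le_mul (h L hL) (h' L hL)
    _ = _ := by ring

/-! ### Cost of expressions -/

theorem bitCost_le {x : ℤ} {s : ℕ} (h : |x| ≤ 2 ^ s) : bitCost x ≤ s + 2 := by
  have h1 : x.natAbs ≤ 2 ^ s := by
    zify
    exact h
  have h2 : x.natAbs.size ≤ s + 1 := by
    rw [Nat.size_le, pow_succ]
    have : 0 < 2 ^ s := by positivity
    omega
  unfold bitCost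
  omega

theorem one_le_bitCost (x : ℤ) : 1 ≤ bitCost x := by
  unfold bitCost
  omega

theorem abs_le_two_pow_bitCost (x : ℤ) : |x| ≤ 2 ^ bitCost x := by
  have h : x.natAbs < 2 ^ x.natAbs.size := Nat.lt_size_self _
  have h1 : x.natAbs ≤ 2 ^ bitCost x :=
    h.le.trans (Nat.pow_le_pow_right (by norm_num) (by unfold bitCost; omega))
  zify at h1
  exact h1

namespace Expr

/-- The value of `e` is at most `2^(L · weight e)` if all cells read have at most `L` bits. -/
def weight : Expr → ℕ
  | lit z => bitCost z
  | read _ _ => 1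
  | bin _ e f => e.weight + f.weight

/-- A bound for the cost of `e` if all cells read have at most `L` bits. -/
def bnd (L : ℕ) : Expr → ℕ
  | lit z => bitCost z
  | read _ i => i.bnd L + (L * i.weight + 2) + (L + 2)
  | bin _ e f => e.bnd L + f.bnd L + (L * e.weight + 2) * (L * f.weight + 2)

/-- All cells that the evaluation of `e` reads are bounded by `2^L`. -/
def Safe (L : ℕ) (M : Mem) : Expr → Prop
  | lit _ => True
  | read a i => i.Safe L M ∧ |M a (i.eval M).toNat| ≤ 2 ^ L
  | bin _ e f => e.Safe L M ∧ f.Safe L M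

theorem one_le_weight (e : Expr) : 1 ≤ e.weight := by
  induction e with
  | lit z => exact one_le_bitCost z
  | read a i _ => exact le_rfl
  | bin o e f he hf => simp only [weight]; omega

/-- For factors at least 2 a product dominates a sum, so one multiplicative bound serves all
operations, and bit lengths simply add up along an expression. -/
theorem abs_binOp_le (o : BinOp) {x y X Y : ℤ} (hx : |x| ≤ X) (hy : |y| ≤ Y) (hX : 2 ≤ X)
    (hY : 2 ≤ Y) : |o.eval x y| ≤ X * Y := by
  have hXY : X + Y ≤ X * Y := by nlinarith
  have hX1 : X ≤ X * Y := by nlinarith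
  have hY1 : Y ≤ X * Y := by nlinarith
  cases o with
  | add => exact (abs_add_le x y).trans (by linarith)
  | sub => exact (abs_sub x y).trans (by linarith)
  | mul =>
    simp only [BinOp.eval, abs_mul]
    exact mul_le_mul hx hy (abs_nonneg y) (by linarith)
  | div =>
    simp only [BinOp.eval]
    have h := Int.natAbs_ediv_le_natAbs x y
    zify at h
    linarith
  | mod =>
    simp only [BinOp.eval]
    rcases eq_or_ne y 0 with rfl | h0
    · simp only [Int.emod_zero]
      linarith
    · rw [abs_of_nonneg (Int.emod_nonneg x h0)]
      linarith [Int.emod_lt_abs x h0]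
  | le =>
    simp only [BinOp.eval]
    split_ifs <;> simp <;> nlinarith
  | eq =>
    simp only [BinOp.eval]
    split_ifs <;> simp <;> nlinarith

theorem abs_eval_le {L : ℕ} (hL : 1 ≤ L) {M : Mem} {e : Expr} (h : e.Safe L M) :
    |e.eval M| ≤ 2 ^ (L * e.weight) := by
  induction e with
  | lit z =>
    refine (abs_le_two_pow_bitCost z).trans (pow_le_pow_right₀ (by norm_num) ?_)
    exact Nat.le_mul_of_pos_left _ hL
  | read a i _ => simpa [weight, eval] using h.2
  | bin o e f he hf =>
    -- The multiplicative bound needs both factors to be at least 2; this is why weights are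
    -- positive.
    have two_le : ∀ e : Expr, (2 : ℤ) ≤ 2 ^ (L * e.weight) := fun e =>
      le_self_pow₀ (by norm_num) (Nat.mul_pos hL e.one_le_weight).ne'
    simp only [weight, eval, mul_add, pow_add]
    exact abs_binOp_le o (he h.1) (hf h.2) (two_le e) (two_le f)

theorem cost_le {L : ℕ} (hL : 1 ≤ L) {M : Mem} {e : Expr} (h : e.Safe L M) :
    e.cost M ≤ e.bnd L := by
  induction e with
  | lit z => exact le_rfl
  | read a i hi =>
    have h1 := hi h.1
    have h2 := bitCost_le (abs_eval_le hL h.1)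
    have h3 := bitCost_le h.2
    simp only [cost, bnd]
    omega
  | bin o e f he hf =>
    have h1 := he h.1
    have h2 := hf h.2
    have h3 := bitCost_le (abs_eval_le hL h.1)
    have h4 := bitCost_le (abs_eval_le hL h.2)
    have h5 : o.cost (e.eval M) (f.eval M) ≤ (L * e.weight + 2) * (L * f.weight + 2) := by
      have hm := Nat.mul_le_mul h3 h4
      have ha : bitCost (e.eval M) + bitCost (f.eval M) ≤
          (L * e.weight + 2) * (L * f.weight + 2) := by
        refine (add_le_add h3 h4).trans ?_
        generalize L * e.weight = a
        generalize L * f.weight = b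
        nlinarith
      cases o <;> assumption
    simp only [cost, bnd]
    omega

theorem polyBdd_bnd (e : Expr) : PolyBdd fun L => e.bnd L := by
  have hw : ∀ w : ℕ, PolyBdd fun L => L * w + 2 := fun w =>
    (PolyBdd.id.mul (.const w)).add (.const 2)
  induction e with
  | lit z => exact .const _
  | read a i hi => exact (hi.add (hw _)).add (PolyBdd.id.add (.const 2))
  | bin o e f he hf => exact (he.add hf).add ((hw _).mul (hw _))

end Expr

/-! ### Partial specifications of programs with running time -/

namespace Cmd

/-- A bound for the running time of `c` if all cells read have at most `L` bits and all loops have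
at most `L` rounds. -/
def bnd (L : ℕ) : Cmd → ℕ
  | skip => 1
  | write _ i e => i.bnd L + e.bnd L + (L * i.weight + 2) + (L * e.weight + 2)
  | seq c d => c.bnd L + d.bnd L
  -- The sum of both branches instead of the maximum, so that the bound is visibly polynomial.
  | ite e c d => e.bnd L + 1 + (c.bnd L + d.bnd L)
  | loop e c => e.bnd L + 1 + L * (1 + c.bnd L)
  -- The value plays no role: the programs to which this bound is applied contain no call.
  | call => 0

theorem polyBdd_bnd (c : Cmd) : PolyBdd fun L => c.bnd L := by
  have hw : ∀ w : ℕ, PolyBdd fun L => L * w + 2 := fun w =>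
    (PolyBdd.id.mul (.const w)).add (.const 2)
  induction c with
  | skip => exact .const _
  | write a i e => exact ((i.polyBdd_bnd.add e.polyBdd_bnd).add (hw _)).add (hw _)
  | seq c d hc hd => exact hc.add hd
  | ite e c d hc hd => exact (e.polyBdd_bnd.add (.const 1)).add (hc.add hd)
  | loop e c hc =>
    exact (e.polyBdd_bnd.add (.const 1)).add (PolyBdd.id.mul ((PolyBdd.const 1).add hc))
  | call => exact .const _

/-- Run on memory `M`, the program `c` reaches a memory with property `Q` within time `T`, whatever
the subroutine, and does not call it. -/
def Reaches (c : Cmd) (T : ℕ) (M : Mem) (Q : Mem → Prop) : Prop :=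
  ∀ (S : Type) (sub : Mem × S → (Mem × S) × ℕ) (σ : S),
    Q (c.run sub (M, σ)).1.1 ∧ (c.run sub (M, σ)).1.2 = σ ∧ (c.run sub (M, σ)).2 ≤ T

variable {c d : Cmd} {e : Expr} {T T' L m : ℕ} {M : Mem} {Q Q' : Mem → Prop}

theorem Reaches.mono (h : c.Reaches T M Q) (hT : T ≤ T') (hQ : ∀ M', Q M' → Q' M') :
    c.Reaches T' M Q' := fun S sub σ =>
  ⟨hQ _ (h S sub σ).1, (h S sub σ).2.1, (h S sub σ).2.2.trans hT⟩

theorem Reaches.seq (h : c.Reaches T M fun M' => d.Reaches T' M' Q) :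
    (Cmd.seq c d).Reaches (T + T') M Q := by
  intro S sub σ
  obtain ⟨h1, h2, h3⟩ := h S sub σ
  obtain ⟨h4, h5, h6⟩ := h1 S sub σ
  have hs : (c.run sub (M, σ)).1 = ((c.run sub (M, σ)).1.1, σ) := Prod.ext rfl h2
  simp only [Cmd.run]
  rw [hs]
  exact ⟨h4, h5, add_le_add h3 h6⟩

theorem Reaches.ite (hL : 1 ≤ L) (he : e.Safe L M) (h₁ : e.eval M ≠ 0 → c.Reaches T M Q)
    (h₂ : e.eval M = 0 → d.Reaches T' M Q) :
    (Cmd.ite e c d).Reaches (e.bnd L + 1 + (T + T')) M Q := by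
  intro S sub σ
  have hc := Expr.cost_le hL he
  by_cases h0 : e.eval M = 0
  · obtain ⟨h4, h5, h6⟩ := h₂ h0 S sub σ
    simp only [Cmd.run, h0, ne_eq, not_true_eq_false, if_false]
    exact ⟨h4, h5, by omega⟩
  · obtain ⟨h4, h5, h6⟩ := h₁ h0 S sub σ
    simp only [Cmd.run, h0, ne_eq, not_false_eq_true, if_true]
    exact ⟨h4, h5, by omega⟩

theorem Reaches.loop (hL : 1 ≤ L) (he : e.Safe L M) (hm : (e.eval M).toNat = m)
    (I : ℕ → Mem → Prop) (h0 : I 0 M)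
    (hstep : ∀ j < m, ∀ M', I j M' → c.Reaches T M' (I (j + 1)))
    (hQ : ∀ M', I m M' → Q M') :
    (Cmd.loop e c).Reaches (e.bnd L + 1 + m * (1 + T)) M Q := by
  intro S sub σ
  have hc := Expr.cost_le hL he
  have key : ∀ j ≤ m, ∀ p : (Mem × S) × ℕ,
      p = (fun p : (Mem × S) × ℕ => ((c.run sub p.1).1, p.2 + 1 + (c.run sub p.1).2))^[j]
        ((M, σ), e.cost M + 1) →
      I j p.1.1 ∧ p.1.2 = σ ∧ p.2 ≤ e.bnd L + 1 + j * (1 + T) := by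
    intro j
    induction j with
    | zero =>
      rintro - p rfl
      exact ⟨h0, rfl, by simpa using hc⟩
    | succ j ih =>
      rintro hj p rfl
      rw [Function.iterate_succ_apply']
      obtain ⟨h1, h2, h3⟩ := ih (by omega) _ rfl
      generalize (fun p : (Mem × S) × ℕ =>
        ((c.run sub p.1).1, p.2 + 1 + (c.run sub p.1).2))^[j] ((M, σ), e.cost M + 1) = p at *
      obtain ⟨⟨M', σ'⟩, t⟩ := p
      obtain rfl : σ' = σ := h2
      obtain ⟨h4, h5, h6⟩ := hstep j (by omega) M' h1 S sub σ'
      refine ⟨h4, h5, ?_⟩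
      simp only at h3 ⊢
      rw [add_mul]
      omega
  obtain ⟨h1, h2, h3⟩ := key m le_rfl _ rfl
  simp only [Cmd.run, hm]
  exact ⟨hQ _ h1, h2, h3⟩

/-- `c` reaches `Q` within its standard time bound. -/
abbrev Safe (c : Cmd) (L : ℕ) (M : Mem) (Q : Mem → Prop) : Prop := c.Reaches (c.bnd L) M Q

theorem Safe.mono (h : c.Safe L M Q) (hQ : ∀ M', Q M' → Q' M') : c.Safe L M Q' :=
  Reaches.mono h le_rfl hQ

theorem Safe.write {a : ℕ} {i : Expr} (hL : 1 ≤ L) (hi : i.Safe L M) (he : e.Safe L M)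
    (h : Q (M.store a (i.eval M).toNat (e.eval M))) : (Cmd.write a i e).Safe L M Q := by
  intro S sub σ
  refine ⟨h, rfl, ?_⟩
  have h1 := Expr.cost_le hL hi
  have h2 := Expr.cost_le hL he
  have h3 := bitCost_le (Expr.abs_eval_le hL hi)
  have h4 := bitCost_le (Expr.abs_eval_le hL he)
  simp only [Cmd.run, bnd]
  omega

theorem Safe.seq (h : c.Safe L M fun M' => d.Safe L M' Q) : (Cmd.seq c d).Safe L M Q :=
  Reaches.seq h

end Cmd

/-! ### Scalar variables, counting loops, sums, tables -/

@[simp] theorem Mem.store_same (M : Mem) (a i : ℕ) (z : ℤ) : M.store a i z a i = z := by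
  simp [Mem.store]

theorem Mem.store_of_ne (M : Mem) {a b : ℕ} (i : ℕ) (z : ℤ) (h : b ≠ a) :
    M.store a i z b = M b := by
  simp [Mem.store, h]

theorem Mem.store_cell (M : Mem) (a i j : ℕ) (z : ℤ) :
    M.store a i z a j = if j = i then z else M a j := by
  by_cases h : j = i
  · simp [h]
  · simp [Mem.store, h]

/-- `M'` differs from `M` only in the arrays of the list `l`. -/
def SameOff (l : List ℕ) (M M' : Mem) : Prop := ∀ a, a ∉ l → M' a = M a

theorem SameOff.refl (l : List ℕ) (M : Mem) : SameOff l M M := fun _ _ => rfl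

theorem SameOff.trans {l : List ℕ} {M M' M'' : Mem} (h : SameOff l M M') (h' : SameOff l M' M'') :
    SameOff l M M'' := fun a ha => (h' a ha).trans (h a ha)

theorem SameOff.mono {l l' : List ℕ} {M M' : Mem} (h : SameOff l M M') (hl : l ⊆ l') :
    SameOff l' M M' := fun a ha => h a fun h' => ha (hl h')

theorem SameOff.store {l : List ℕ} {M M' : Mem} (h : SameOff l M M') {a i : ℕ} {z : ℤ}
    (ha : a ∈ l) : SameOff l M (M'.store a i z) := fun b hb => by
  have hab : b ≠ a := fun hab => hb (hab ▸ ha)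
  exact (Mem.store_of_ne _ _ _ hab).trans (h b hb)

/-- The scalar variable `v`: cell `0` of array `v`. -/
abbrev Expr.var (v : ℕ) : Expr := .read v (.lit 0)

namespace Cmd

/-- Assignment to a scalar variable. -/
abbrev assign (v : ℕ) (e : Expr) : Cmd := .write v (.lit 0) e

/-- `for v = 0, …, e - 1 do c`. -/
def forLoop (v : ℕ) (e : Expr) (c : Cmd) : Cmd :=
  .seq (assign v (.lit 0)) (.loop e (.seq c (assign v (.bin .add (.var v) (.lit 1)))))

/-- `acc = ∑ v < e, f`. -/
def sumLoop (acc v : ℕ) (e f : Expr) : Cmd :=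
  .seq (assign acc (.lit 0)) (forLoop v e (assign acc (.bin .add (.var acc) f)))

variable {c d : Cmd} {e f : Expr} {T T' L m : ℕ} {M : Mem} {Q Q' : Mem → Prop}

theorem Safe.assign {v : ℕ} (hL : 1 ≤ L) (he : e.Safe L M)
    (h : Q (M.store v 0 (e.eval M))) : (Cmd.assign v e).Safe L M Q :=
  Safe.write hL trivial he (by simpa [Expr.eval] using h)

/-- The counter only has to fit into a word, and the number of rounds stays explicit in the time
bound. This form is needed for the loop over the reported list, whose length need not be below `L`.
-/
theorem Reaches.forLoop {v : ℕ} (hL : 1 ≤ L) (hmL : (m : ℤ) ≤ 2 ^ L)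
    (he : e.Safe L (M.store v 0 0))
    (hm : e.eval (M.store v 0 0) = m) (I : ℕ → Mem → Prop) (h0 : I 0 (M.store v 0 0))
    (hstep : ∀ j < m, ∀ M' : Mem, M' v 0 = (j : ℤ) → I j M' →
      c.Reaches T M' fun M'' => M'' v 0 = j ∧ I (j + 1) (M''.store v 0 ((j + 1 : ℕ) : ℤ)))
    (hQ : ∀ M', I m M' → Q M') :
    (Cmd.forLoop v e c).Reaches ((Cmd.assign v (.lit 0)).bnd L + (e.bnd L + 1 + m * (1 + (T +
      (Cmd.assign v (.bin .add (.var v) (.lit 1))).bnd L)))) M Q := by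
  refine Reaches.seq (Safe.assign hL trivial ?_)
  refine Reaches.loop hL he (by simp [Expr.eval, hm]) (fun j M' => M' v 0 = j ∧ I j M')
    ⟨by simp [Expr.eval], h0⟩ ?_ fun M' h => hQ M' h.2
  rintro j hj M' ⟨h1, h2⟩
  refine Reaches.seq (Reaches.mono (hstep j hj M' h1 h2) le_rfl ?_)
  rintro M'' ⟨h3, h4⟩
  have hj' : (j : ℤ) < m := by exact_mod_cast hj
  refine Safe.assign hL ⟨⟨trivial, ?_⟩, trivial⟩ ?_
  · simp only [Expr.eval, Int.toNat_zero, h3]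
    rw [abs_of_nonneg (by positivity)]
    linarith
  · have : (Expr.bin .add (.var v) (.lit 1)).eval M'' = ((j + 1 : ℕ) : ℤ) := by
      simp [Expr.eval, BinOp.eval, h3]
    rw [this]
    exact ⟨by simp, h4⟩

theorem Safe.forLoop {v : ℕ} (hL : 1 ≤ L) (hmL : m ≤ L) (he : e.Safe L (M.store v 0 0))
    (hm : e.eval (M.store v 0 0) = m) (I : ℕ → Mem → Prop) (h0 : I 0 (M.store v 0 0))
    (hstep : ∀ j < m, ∀ M' : Mem, M' v 0 = (j : ℤ) → I j M' →
      c.Safe L M' fun M'' => M'' v 0 = j ∧ I (j + 1) (M''.store v 0 ((j + 1 : ℕ) : ℤ)))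
    (hQ : ∀ M', I m M' → Q M') : (Cmd.forLoop v e c).Safe L M Q := by
  refine Reaches.mono (Reaches.forLoop hL ?_ he hm I h0 hstep hQ) ?_ fun _ h => h
  · exact_mod_cast hmL.trans Nat.lt_two_pow_self.le
  · simp only [Cmd.forLoop, bnd]
    gcongr

theorem Safe.sumLoop {acc v : ℕ} (hav : acc ≠ v) (hL : 1 ≤ L) (hmL : m ≤ L)
    (he : ∀ M', SameOff [acc, v] M M' → e.Safe L M' ∧ e.eval M' = m) (F : ℕ → ℤ)
    (hF : ∀ j ≤ m, |∑ t ∈ Finset.range j, F t| ≤ 2 ^ L)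
    (hf : ∀ j < m, ∀ M', SameOff [acc, v] M M' → M' v 0 = j → f.Safe L M' ∧ f.eval M' = F j)
    (hQ : ∀ M', SameOff [acc, v] M M' → M' acc 0 = ∑ t ∈ Finset.range m, F t → Q M') :
    (Cmd.sumLoop acc v e f).Safe L M Q := by
  refine Safe.seq (Safe.assign hL trivial ?_)
  have hs : SameOff [acc, v] M ((M.store acc 0 0).store v 0 0) :=
    ((SameOff.refl _ M).store (by simp)).store (by simp)
  refine Safe.forLoop hL hmL (he _ hs).1 (he _ hs).2
    (fun j M' => SameOff [acc, v] M M' ∧ M' acc 0 = ∑ t ∈ Finset.range j, F t)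
    ⟨hs, ?_⟩ ?_ fun M' h => hQ M' h.1 h.2
  · rw [Mem.store_of_ne _ _ _ hav]
    simp [Expr.eval]
  · rintro j hj M' hv ⟨h1, h2⟩
    obtain ⟨h3, h4⟩ := hf j hj M' h1 hv
    refine Safe.assign hL ⟨⟨trivial, ?_⟩, h3⟩ ⟨?_, (h1.store (by simp)).store (by simp), ?_⟩
    · simpa [Expr.eval, h2] using hF j hj.le
    · rw [Mem.store_of_ne _ _ _ hav.symm, hv]
    · rw [Mem.store_of_ne _ _ _ hav, Finset.sum_range_succ]
      simp [Expr.eval, BinOp.eval, h2, h4]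

/-- Fill cells `b, …, b + m - 1` of array `a`; the value of a cell may depend on earlier cells. -/
theorem Safe.table {v a b : ℕ} {l : List ℕ} {i : Expr} (hva : a ≠ v) (hL : 1 ≤ L) (hmL : m ≤ L)
    (hal : a ∉ l) (hvl : v ∉ l)
    (he : ∀ M', SameOff (a :: v :: l) M M' → e.Safe L M' ∧ e.eval M' = m) (F : ℕ → ℤ)
    (hc : ∀ j < m, ∀ M', SameOff (a :: v :: l) M M' → M' v 0 = j →
      (∀ p, M' a p = if b ≤ p ∧ p < b + j then F p else M a p) →
      c.Safe L M' fun M'' => SameOff l M' M'' ∧ i.Safe L M'' ∧ f.Safe L M'' ∧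
        i.eval M'' = (b + j : ℕ) ∧ f.eval M'' = F (b + j))
    (hQ : ∀ M', SameOff (a :: v :: l) M M' →
      (∀ p, M' a p = if b ≤ p ∧ p < b + m then F p else M a p) → Q M') :
    (Cmd.forLoop v e (.seq c (.write a i f))).Safe L M Q := by
  have hs : SameOff (a :: v :: l) M (M.store v 0 0) := (SameOff.refl _ M).store (by simp)
  refine Safe.forLoop hL hmL (he _ hs).1 (he _ hs).2
    (fun j M' => SameOff (a :: v :: l) M M' ∧
      ∀ p, M' a p = if b ≤ p ∧ p < b + j then F p else M a p)
    ⟨hs, fun p => ?_⟩ ?_ fun M' h => hQ M' h.1 h.2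
  · rw [Mem.store_of_ne _ _ _ hva, if_neg (by omega)]
  · rintro j hj M' hv ⟨h1, h2⟩
    refine Safe.seq (Safe.mono (hc j hj M' h1 hv h2) ?_)
    rintro M'' ⟨h3, h4, h5, h6, h7⟩
    refine Safe.write hL h4 h5 ⟨?_, ?_, fun p => ?_⟩
    · rw [Mem.store_of_ne _ _ _ hva.symm, h3 v hvl, hv]
    · refine ((h1.trans (h3.mono fun x hx => ?_)).store (by simp)).store (by simp)
      simp [hx]
    · rw [Mem.store_of_ne _ _ _ hva, h6, h7, Int.toNat_natCast, Mem.store_cell, h3 a hal, h2]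
      by_cases hp : p = b + j
      · subst hp
        rw [if_pos rfl, if_pos (by omega)]
      · rw [if_neg hp]
        exact if_congr (by omega) rfl rfl

end Cmd

end GSWStream

/-! ### Values of expressions, the equality-test circuit, matrices in memory. -/

namespace GSWStream

/-! ### Values of expressions -/

namespace Expr

instance : Add Expr := ⟨bin .add⟩
instance : Sub Expr := ⟨bin .sub⟩
instance : Mul Expr := ⟨bin .mul⟩
instance : Div Expr := ⟨bin .div⟩
instance : Mod Expr := ⟨bin .mod⟩

/-- Evaluation of `e` reads only cells with at most `L` bits and gives `z`. -/
def HasVal (L : ℕ) (M : Mem) (e : Expr) (z : ℤ) : Prop := e.Safe L M ∧ e.eval M = z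

namespace HasVal

variable {L : ℕ} {M : Mem} {e f i : Expr} {x y z : ℤ} {p s a : ℕ}

theorem congr (h : HasVal L M e x) (hxy : x = y) : HasVal L M e y := hxy ▸ h

theorem lit (z : ℤ) : HasVal L M (.lit z) z := ⟨trivial, rfl⟩

theorem natLit (p : ℕ) : HasVal L M (.lit p) p := ⟨trivial, rfl⟩

theorem read (hi : HasVal L M i p) (hz : M a p = z) (hzL : |z| ≤ 2 ^ L) :
    HasVal L M (.read a i) z := by
  have hp : (i.eval M).toNat = p := by rw [hi.2, Int.toNat_natCast]
  exact ⟨⟨hi.1, by rw [hp, hz]; exact hzL⟩, by simp only [eval]; rw [hp, hz]⟩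

theorem readNat (hi : HasVal L M i p) (hz : M a p = s) (hzL : s ≤ 2 ^ L) :
    HasVal L M (.read a i) s :=
  read hi hz (by rw [Nat.abs_cast]; exact_mod_cast hzL)

theorem var {v : ℕ} (hz : M v 0 = z) (hzL : |z| ≤ 2 ^ L) : HasVal L M (Expr.var v) z :=
  read (natLit 0) hz hzL

theorem varNat {v : ℕ} (hz : M v 0 = s) (hzL : s ≤ 2 ^ L) : HasVal L M (Expr.var v) s :=
  readNat (natLit 0) hz hzL

theorem bin (o : BinOp) (he : HasVal L M e x) (hf : HasVal L M f y) :
    HasVal L M (.bin o e f) (o.eval x y) :=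
  ⟨⟨he.1, hf.1⟩, by simp only [eval, he.2, hf.2]⟩

theorem add (he : HasVal L M e x) (hf : HasVal L M f y) : HasVal L M (e + f) (x + y) :=
  bin .add he hf

theorem sub (he : HasVal L M e x) (hf : HasVal L M f y) : HasVal L M (e - f) (x - y) :=
  bin .sub he hf

theorem mul (he : HasVal L M e x) (hf : HasVal L M f y) : HasVal L M (e * f) (x * y) :=
  bin .mul he hf

theorem div (he : HasVal L M e x) (hf : HasVal L M f y) : HasVal L M (e / f) (x / y) :=
  bin .div he hf

theorem mod (he : HasVal L M e x) (hf : HasVal L M f y) : HasVal L M (e % f) (x % y) :=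
  bin .mod he hf

theorem addNat (he : HasVal L M e p) (hf : HasVal L M f s) : HasVal L M (e + f) (p + s : ℕ) :=
  (add he hf).congr (by push_cast; rfl)

theorem mulNat (he : HasVal L M e p) (hf : HasVal L M f s) : HasVal L M (e * f) (p * s : ℕ) :=
  (mul he hf).congr (by push_cast; rfl)

theorem divNat (he : HasVal L M e p) (hf : HasVal L M f s) : HasVal L M (e / f) (p / s : ℕ) :=
  (div he hf).congr (by push_cast; rfl)

theorem modNat (he : HasVal L M e p) (hf : HasVal L M f s) : HasVal L M (e % f) (p % s : ℕ) :=
  (mod he hf).congr (by push_cast; rfl)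

end HasVal

end Expr

theorem Cmd.Safe.skip {L : ℕ} {M : Mem} {Q : Mem → Prop} (h : Q M) : Cmd.skip.Safe L M Q :=
  fun _ _ _ => ⟨h, rfl, le_rfl⟩

theorem Cmd.Safe.assignVal {L v : ℕ} {M : Mem} {Q : Mem → Prop} {e : Expr} {z : ℤ} (hL : 1 ≤ L)
    (he : e.HasVal L M z) (h : Q (M.store v 0 z)) : (Cmd.assign v e).Safe L M Q :=
  Safe.assign hL he.1 (he.2.symm ▸ h)

/-! ### Circuits testing for a point -/

/-- The wires that `pointCircuit` appends to the inputs `xs`. -/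
def pointWire {W : Type} (d : W) (φ : (Bool → Bool → Bool) → W → W → W) (i : ℕ) (xs : List W) :
    ℕ → W
  | 0 => φ (fun _ _ => true) (xs.getD 0 d) (xs.getD 0 d)
  | j + 1 => φ (fun a b => (a == i.testBit j) && b) (xs.getD j d) (pointWire d φ i xs j)

/-- The gates form a chain: each one reads one input and the wire directly before it. After `j`
comparisons the wires are the inputs followed by the first `j + 1` values of the recursion. -/
theorem run_pointCircuit {W : Type} (d : W) (φ : (Bool → Bool → Bool) → W → W → W) (i : ℕ)
    (xs : List W) :
    Circuit.run d φ (pointCircuit xs.length i) xs = pointWire d φ i xs xs.length := by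
  have key : ∀ j ≤ xs.length,
      ((List.range j).map fun j =>
        (⟨fun a b => (a == i.testBit j) && b, j, xs.length + j⟩ : Gate)).foldl
        (fun w γ => w ++ [φ γ.op (w.getD γ.fst d) (w.getD γ.snd d)])
        (xs ++ [pointWire d φ i xs 0]) =
      xs ++ (List.range (j + 1)).map (pointWire d φ i xs) := by
    intro j
    induction j with
    | zero => intro _; rfl
    | succ j ih =>
      intro hj
      rw [List.range_succ, List.map_append, List.foldl_append, ih (by omega),
        List.range_succ (n := j + 1), List.map_append, ← List.append_assoc]
      simp only [List.map_cons, List.map_nil, List.foldl_cons, List.foldl_nil, pointWire]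
      congr 3
      · rw [List.getD_append _ _ _ _ (by omega)]
      · rw [List.getD_append_right _ _ _ _ (by omega)]
        simp [List.getD]
  have h := key xs.length le_rfl
  unfold Circuit.run pointCircuit
  rw [List.foldl_cons]
  change List.getLastD (List.foldl _ (xs ++ [pointWire d φ i xs 0]) _) d = _
  rw [h, List.range_succ, List.map_append, ← List.append_assoc]
  simp

variable {P : Params}

/-- As a multilinear polynomial, `(a == b) && c` is `a c` for `b = 1` and `c - a c` for `b = 0`.
Each input bit thus costs a single ciphertext product. -/
theorem gateEval_pointOp (b : Bool) (X Y : Ct P) :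
    gateEval P (fun a c => (a == b) && c) X Y =
      if b then X * gadgetInv P Y else Y - X * gadgetInv P Y := by
  cases b <;> simp [gateEval, sub_eq_add_neg]

theorem gateEval_true (X Y : Ct P) : gateEval P (fun _ _ => true) X Y = gadget P := by
  simp [gateEval]

/-- The ciphertext on wire `l + j` of `pointCircuit l i`. -/
def pointGen (i : ℕ) {l : ℕ} (cts : Fin l → Ct P) (j : ℕ) : Ct P :=
  pointWire 0 (gateEval P) i (List.ofFn cts) j

theorem pointGen_zero (i : ℕ) {l : ℕ} (cts : Fin l → Ct P) : pointGen i cts 0 = gadget P :=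
  gateEval_true _ _

theorem pointGen_succ (i : ℕ) {l : ℕ} (cts : Fin l → Ct P) {j : ℕ} (hj : j < l) :
    pointGen i cts (j + 1) =
      if i.testBit j then cts ⟨j, hj⟩ * gadgetInv P (pointGen i cts j)
      else pointGen i cts j - cts ⟨j, hj⟩ * gadgetInv P (pointGen i cts j) := by
  have h : (List.ofFn cts).getD j 0 = cts ⟨j, hj⟩ := by
    simp [List.getD, hj]
  rw [pointGen, pointWire, gateEval_pointOp, h]
  rfl

theorem evalCt_pointCircuit (pk : Ct P) (i : ℕ) {l : ℕ} (cts : Fin l → Ct P) :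
    evalCt P pk (pointCircuit l i) cts = pointGen i cts l := by
  have h := run_pointCircuit 0 (gateEval P) i (List.ofFn cts)
  rw [List.length_ofFn] at h
  exact h

/-! ### Matrices in memory -/

/-- The entries of a matrix, listed row by row. -/
def flat (X : Ct P) (p : ℕ) : ℕ :=
  if h : p / P.h < P.g + 1 ∧ p % P.h < P.h then (X ⟨p / P.h, h.1⟩ ⟨p % P.h, h.2⟩).val else 0

theorem flat_mul_add (X : Ct P) (i : Fin (P.g + 1)) (j : Fin P.h) :
    flat X (i * P.h + j) = (X i j).val := by
  have h0 : 0 < P.h := j.pos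
  have h1 : (i * P.h + j : ℕ) / P.h = i := by
    rw [mul_comm, Nat.mul_add_div h0, Nat.div_eq_of_lt j.2, add_zero]
  have h2 : (i * P.h + j : ℕ) % P.h = j := by
    rw [mul_comm, Nat.mul_add_mod, Nat.mod_eq_of_lt j.2]
  have h : (i * P.h + j : ℕ) / P.h < P.g + 1 ∧ (i * P.h + j : ℕ) % P.h < P.h := by
    rw [h1, h2]
    exact ⟨i.2, j.2⟩
  have e1 : (⟨_, h.1⟩ : Fin (P.g + 1)) = i := Fin.ext h1
  have e2 : (⟨_, h.2⟩ : Fin P.h) = j := Fin.ext h2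
  rw [flat, dif_pos h, e1, e2]

theorem flat_lt (X : Ct P) (p : ℕ) : flat X p < P.q := by
  rw [flat]
  split_ifs
  · exact ZMod.val_lt _
  · exact Nat.pos_of_ne_zero (NeZero.ne _)

theorem row_lt {p : ℕ} (hp : p < (P.g + 1) * P.h) : p / P.h < P.g + 1 :=
  Nat.div_lt_of_lt_mul (by rwa [mul_comm])

theorem col_lt {p : ℕ} (hp : p < (P.g + 1) * P.h) : p % P.h < P.h :=
  Nat.mod_lt _ (Nat.pos_of_ne_zero fun h => by simp [h] at hp)

theorem flat_of_lt (X : Ct P) {p : ℕ} (hp : p < (P.g + 1) * P.h) :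
    flat X p = (X ⟨p / P.h, row_lt hp⟩ ⟨p % P.h, col_lt hp⟩).val :=
  dif_pos ⟨row_lt hp, col_lt hp⟩

theorem mul_add_lt {a b r s : ℕ} (ha : a < r) (hb : b < s) : a * s + b < r * s := by
  calc a * s + b < a * s + s := by omega
    _ = (a + 1) * s := by ring
    _ ≤ r * s := Nat.mul_le_mul_right _ ha

/-- With linear indexing a single counting loop runs through a whole matrix. -/
theorem holdsMat_iff {M : Mem} {a o : ℕ} {X : Ct P} :
    HoldsMat M a o X ↔ ∀ p < (P.g + 1) * P.h, M a (o + p) = flat X p := by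
  constructor
  · intro h p hp
    rw [flat_of_lt X hp, ← h]
    congr 1
    dsimp only
    rw [add_assoc, mul_comm, Nat.div_add_mod]
  · intro h i j
    rw [← flat_mul_add, ← h _ (mul_add_lt i.2 j.2), add_assoc]

theorem HoldsMat.congr {M M' : Mem} {a o : ℕ} {X : Ct P} (h : HoldsMat M a o X)
    (ha : M' a = M a) : HoldsMat M' a o X := fun i j => by rw [ha]; exact h i j

theorem HoldsParams.congr {M M' : Mem} {n k : ℕ} (h : HoldsParams M n k P) (ha : M' 0 = M 0) :
    HoldsParams M' n k P := by
  unfold HoldsParams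
  rw [ha]
  exact h

/-- `L` bounds the number of rounds of the loops and the number of bits of the numbers. -/
structure RoomFor (P : Params) (n L : ℕ) : Prop where
  cells : (Nat.clog 2 n + 1) * ((P.g + 1) * P.h) ≤ L
  -- Covers the unreduced inner products in ciphertext multiplication and in the decoder.
  prods : (P.g + 1) * P.h * P.q ^ 2 ≤ 2 ^ L
  -- Covers the integer approximations that the decoder stores.
  powers : 2 * 2 ^ P.len * P.q ≤ 2 ^ L
  -- All gadget blocks fit into the `h` columns, so that `G * G⁻¹(Y) = Y`.
  width : (P.g + 1) * P.len ≤ P.h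
  -- The table of powers of two up to `2 ^ len` also serves for extracting the bits of an index.
  clog_le : Nat.clog 2 n ≤ P.len
  lt_q : n < P.q

theorem Params.len_pos (P : Params) : 0 < P.len := Nat.clog_pos (by norm_num) P.two_le_q

theorem Params.q_le (P : Params) : P.q ≤ 2 ^ P.len := Nat.le_pow_clog (by norm_num) _

theorem le_two_pow_of_le {p L : ℕ} (hp : p ≤ L) : p ≤ 2 ^ L := hp.trans Nat.lt_two_pow_self.le

namespace RoomFor

variable {n L : ℕ}

theorem h_pos (R : RoomFor P n L) : 0 < P.h :=
  lt_of_lt_of_le (by have := P.len_pos; positivity) R.width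

theorem size_le (R : RoomFor P n L) : (P.g + 1) * P.h ≤ L :=
  le_trans (Nat.le_mul_of_pos_left _ (by omega)) R.cells

theorem size_pos (R : RoomFor P n L) : 0 < (P.g + 1) * P.h := Nat.mul_pos (by omega) R.h_pos

theorem one_le (R : RoomFor P n L) : 1 ≤ L := R.size_pos.trans_le R.size_le

theorem g_le (R : RoomFor P n L) : P.g + 1 ≤ L :=
  (Nat.le_mul_of_pos_right _ R.h_pos).trans R.size_le

theorem h_le (R : RoomFor P n L) : P.h ≤ L := (Nat.le_mul_of_pos_left _ (by omega)).trans R.size_le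

theorem len_le_h (R : RoomFor P n L) : P.len ≤ P.h :=
  (Nat.le_mul_of_pos_left _ (by omega)).trans R.width

theorem len_le (R : RoomFor P n L) : P.len ≤ L := R.len_le_h.trans R.h_le

theorem ell_le (R : RoomFor P n L) : Nat.clog 2 n + 1 ≤ L :=
  (Nat.le_mul_of_pos_right _ R.size_pos).trans R.cells

theorem sq_le (R : RoomFor P n L) : P.q ^ 2 ≤ 2 ^ L :=
  (Nat.le_mul_of_pos_left _ R.size_pos).trans R.prods

theorem two_mul_q_le (R : RoomFor P n L) : 2 * P.q ≤ 2 ^ L := by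
  have := P.two_le_q
  exact le_trans (by nlinarith) R.sq_le

theorem q_le (R : RoomFor P n L) : P.q ≤ 2 ^ L := le_trans (by omega) R.two_mul_q_le

end RoomFor

/-- Parameter number `i`. -/
abbrev par (i : ℕ) : Expr := .read 0 (.lit i)

/-- The number of entries of a ciphertext. -/
abbrev sizeExpr : Expr := (par 2 + .lit (1 : ℕ)) * par 3

section Reads

open GSWStream.Expr

variable {n k L : ℕ} {M : Mem}

theorem HoldsParams.val_g (H : HoldsParams M n k P) (R : RoomFor P n L) : HasVal L M (par 2) P.g :=
  .readNat (.natLit 2) H.2.2.1 (le_two_pow_of_le (Nat.le_of_succ_le R.g_le))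

theorem HoldsParams.val_h (H : HoldsParams M n k P) (R : RoomFor P n L) : HasVal L M (par 3) P.h :=
  .readNat (.natLit 3) H.2.2.2.1 (le_two_pow_of_le R.h_le)

theorem HoldsParams.val_q (H : HoldsParams M n k P) (R : RoomFor P n L) : HasVal L M (par 4) P.q :=
  .readNat (.natLit 4) H.2.2.2.2.1 R.q_le

theorem HoldsParams.val_len (H : HoldsParams M n k P) (R : RoomFor P n L) :
    HasVal L M (par 5) P.len :=
  .readNat (.natLit 5) H.2.2.2.2.2.1 (le_two_pow_of_le R.len_le)

theorem HoldsParams.val_ell (H : HoldsParams M n k P) (R : RoomFor P n L) :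
    HasVal L M (par 6) (Nat.clog 2 n : ℕ) :=
  .readNat (.natLit 6) H.2.2.2.2.2.2 (le_two_pow_of_le (Nat.le_of_succ_le R.ell_le))

theorem HoldsParams.val_size (H : HoldsParams M n k P) (R : RoomFor P n L) :
    HasVal L M sizeExpr ((P.g + 1) * P.h : ℕ) :=
  ((H.val_g R).addNat (.natLit 1)).mulNat (H.val_h R)

end Reads

end GSWStream

/-! ### The program that computes the evaluated ciphertext of an index. -/

namespace GSWStream

variable {P : Params}

/-! ### Entries of evaluated ciphertexts -/

theorem two_pow_lt_q {t : ℕ} (ht : t < P.len) : 2 ^ t < P.q :=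
  (Nat.lt_clog_iff_pow_lt (by norm_num)).1 ht

theorem flat_gadget {p : ℕ} (hp : p < (P.g + 1) * P.h) :
    flat (gadget P) p = if p % P.h / P.len = p / P.h then 2 ^ (p % P.h % P.len) else 0 := by
  rw [flat_of_lt _ hp]
  simp only [gadget, Matrix.of_apply]
  split_ifs
  · have h : 2 ^ (p % P.h % P.len) < P.q := two_pow_lt_q (Nat.mod_lt _ P.len_pos)
    have := ZMod.val_cast_of_lt h
    push_cast at this
    exact this
  · exact ZMod.val_zero

theorem ite_testBit (x t : ℕ) {α : Type*} [Semiring α] :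
    (if x.testBit t then (1 : α) else 0) = ((x / 2 ^ t % 2 : ℕ) : α) := by
  rw [Nat.testBit_eq_decide_div_mod_eq]
  rcases Nat.mod_two_eq_zero_or_one (x / 2 ^ t) with h | h <;> simp [h]

/-- A summand of an entry of `X * gadgetInv P Y`. -/
def mulTerm (X Y : Ct P) (row col t : ℕ) : ℕ :=
  flat X (row * P.h + t) * (flat Y (t / P.len * P.h + col) / 2 ^ (t % P.len) % 2)

/-- The rows of the bit decomposition behind the last gadget block vanish, so the sum stops there.
The natural number on the right is what the program accumulates before reducing modulo `q`. -/
theorem mul_gadgetInv_apply (hw : (P.g + 1) * P.len ≤ P.h) (X Y : Ct P) (i : Fin (P.g + 1))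
    (j : Fin P.h) : (X * gadgetInv P Y) i j =
      ((∑ t ∈ Finset.range ((P.g + 1) * P.len), mulTerm X Y i j t : ℕ) : ZMod P.q) := by
  have h1 : (X * gadgetInv P Y) i j = ∑ t : Fin P.h,
      (fun t : ℕ => if t < (P.g + 1) * P.len then (mulTerm X Y i j t : ZMod P.q) else 0) t := by
    rw [Matrix.mul_apply]
    refine Finset.sum_congr rfl fun t _ => ?_
    by_cases ht : (t : ℕ) < (P.g + 1) * P.len
    · have ht' : (t : ℕ) / P.len < P.g + 1 := Nat.div_lt_of_lt_mul (by rwa [mul_comm])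
      have h2 := flat_mul_add Y ⟨(t : ℕ) / P.len, ht'⟩ j
      simp only at h2
      simp only [gadgetInv, Matrix.of_apply, ht, ht', dif_pos, if_true, mulTerm]
      rw [flat_mul_add, h2, ite_testBit]
      push_cast
      rw [ZMod.natCast_zmod_val]
    · have ht' : ¬ (t : ℕ) / P.len < P.g + 1 := fun h => ht <| by
        rwa [Nat.div_lt_iff_lt_mul P.len_pos] at h
      simp only [gadgetInv, Matrix.of_apply, ht, ht', dif_neg, not_false_eq_true, if_false,
        mul_zero]
  rw [h1, Fin.sum_univ_eq_sum_range
    (fun t : ℕ => if t < (P.g + 1) * P.len then (mulTerm X Y i j t : ZMod P.q) else 0) P.h]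
  push_cast
  rw [← Finset.sum_subset (Finset.range_mono hw)]
  · exact Finset.sum_congr rfl fun t ht => if_pos (Finset.mem_range.1 ht)
  · intro t _ ht
    exact if_neg (by simpa using ht)

/-- With the index bit `b`, both cases of the recursion are `(1 - b) Y + (2 b - 1) X G⁻¹(Y)`. The
program evaluates this expression without a case distinction. -/
theorem flat_pointGen_succ (hw : (P.g + 1) * P.len ≤ P.h) (i : ℕ) {l : ℕ} (cts : Fin l → Ct P)
    {j : ℕ} (hj : j < l) {p : ℕ} (hp : p < (P.g + 1) * P.h) :
    (flat (pointGen i cts (j + 1)) p : ℤ) =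
      ((1 - (i / 2 ^ j % 2 : ℕ)) * flat (pointGen i cts j) p + (2 * (i / 2 ^ j % 2 : ℕ) - 1) *
        (∑ t ∈ Finset.range ((P.g + 1) * P.len),
          mulTerm (cts ⟨j, hj⟩) (pointGen i cts j) (p / P.h) (p % P.h) t : ℕ)) % P.q := by
  rw [← ZMod.val_intCast, flat_of_lt _ hp, pointGen_succ i cts hj]
  have h := mul_gadgetInv_apply hw (cts ⟨j, hj⟩) (pointGen i cts j) ⟨p / P.h, row_lt hp⟩
    ⟨p % P.h, col_lt hp⟩
  congr 2
  rw [flat_of_lt _ hp]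
  simp only [Int.cast_add, Int.cast_mul, Int.cast_sub, Int.cast_natCast, Int.cast_one,
    Int.cast_ofNat, ← h, ZMod.natCast_zmod_val]
  rw [Nat.testBit_eq_decide_div_mod_eq]
  rcases Nat.mod_two_eq_zero_or_one (i / 2 ^ j) with h | h
  · simp [h, sub_eq_add_neg]
  · simp only [h, decide_true, if_true]
    push_cast
    ring

theorem mulTerm_le (X Y : Ct P) (row col t : ℕ) : mulTerm X Y row col t ≤ P.q := by
  have h1 := (flat_lt X (row * P.h + t)).le
  have h2 : flat Y (t / P.len * P.h + col) / 2 ^ (t % P.len) % 2 ≤ 1 := by omega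
  calc mulTerm X Y row col t ≤ P.q * 1 := Nat.mul_le_mul h1 h2
    _ = P.q := mul_one _

theorem sum_mulTerm_le {n L : ℕ} (R : RoomFor P n L) (X Y : Ct P) (row col : ℕ) {m : ℕ}
    (hm : m ≤ (P.g + 1) * P.len) :
    ∑ t ∈ Finset.range m, mulTerm X Y row col t ≤ 2 ^ L := by
  calc ∑ t ∈ Finset.range m, mulTerm X Y row col t ≤ ∑ _t ∈ Finset.range m, P.q :=
        Finset.sum_le_sum fun t _ => mulTerm_le X Y row col t
    _ = m * P.q := by simp
    _ ≤ ((P.g + 1) * P.h) * P.q ^ 2 := by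
        refine Nat.mul_le_mul ?_ (Nat.le_self_pow (by norm_num) _)
        exact (hm.trans R.width).trans (Nat.le_mul_of_pos_left _ (by omega))
    _ ≤ 2 ^ L := R.prods

/-! ### The program that evaluates the circuit of a point -/

open GSWStream.Expr

/-- Array `12` receives the powers of two. -/
def powersCmd : Cmd :=
  .seq (.write 12 (.lit 0) (.lit 1))
    (.forLoop 14 (par 5) (.seq .skip
      (.write 12 (.lit (1 : ℕ) + .var 14) (.lit 2 * .read 12 (.var 14)))))

theorem powersCmd_safe {n k L : ℕ} {M : Mem} (R : RoomFor P n L) (H : HoldsParams M n k P) :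
    powersCmd.Safe L M fun M' => SameOff [12, 14] M M' ∧ ∀ t ≤ P.len, M' 12 t = (2 ^ t : ℕ) := by
  have hL := R.one_le
  refine Cmd.Safe.seq (Cmd.Safe.write hL trivial trivial ?_)
  -- Cell 0 is already written; every later cell doubles its predecessor.
  refine Cmd.Safe.table (l := []) (b := 1) (m := P.len) (by decide) hL R.len_le (by simp) (by simp)
    (fun M' hM' => ?_) (fun p => (2 ^ p : ℕ)) (fun j hj M' hM' hv hT => ?_) fun M' hM' hT => ?_
  · exact (H.congr ((hM' 0 (by decide)).trans (Mem.store_of_ne _ _ _ (by decide)))).val_len R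
  · refine Cmd.Safe.skip ⟨SameOff.refl _ _, ?_⟩
    have hj' : HasVal L M' (.var 14) j := .varNat hv (le_two_pow_of_le (hj.le.trans R.len_le))
    have hi : HasVal L M' (.lit (1 : ℕ) + .var 14) (1 + j : ℕ) := (HasVal.natLit 1).addNat hj'
    have hr : HasVal L M' (.lit 2 * .read 12 (.var 14)) (2 ^ (1 + j) : ℕ) := by
      refine ((HasVal.natLit 2).mulNat (HasVal.readNat hj' ?_ (s := 2 ^ j) ?_)).congr ?_
      · rw [hT]
        rcases Nat.eq_zero_or_pos j with rfl | h
        · simp [Expr.eval]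
        · rw [if_pos (by omega)]
      · exact Nat.pow_le_pow_right (by norm_num) (hj.le.trans R.len_le)
      · rw [pow_add, pow_one]
    exact ⟨hi.1, hr.1, hi.2, hr.2⟩
  · refine ⟨SameOff.trans ((SameOff.refl _ M).store (by simp)) hM', fun t ht => ?_⟩
    rw [hT]
    rcases Nat.eq_zero_or_pos t with rfl | h
    · simp [Expr.eval]
    · rw [if_pos (by omega)]

/-- The first part of array `11` receives the gadget matrix. -/
def gadgetCmd : Cmd :=
  .forLoop 14 sizeExpr (.seq .skip
    (.write 11 (.var 14) (.bin .eq (.var 14 % par 3 / par 5) (.var 14 / par 3) *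
      .read 12 (.var 14 % par 3 % par 5))))

theorem gadgetCmd_safe {n k L : ℕ} {M : Mem} (R : RoomFor P n L) (H : HoldsParams M n k P)
    (hpow : ∀ t ≤ P.len, M 12 t = (2 ^ t : ℕ)) :
    gadgetCmd.Safe L M fun M' => SameOff [11, 14] M M' ∧ HoldsMat M' 11 0 (gadget P) := by
  have hL := R.one_le
  refine Cmd.Safe.table (l := []) (b := 0) (m := (P.g + 1) * P.h) (by decide) hL R.size_le
    (by simp) (by simp) (fun M' hM' => ?_) (fun p => flat (gadget P) p)
    (fun j hj M' hM' hv hT => ?_) fun M' hM' hT => ?_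
  · exact (H.congr (hM' 0 (by decide))).val_size R
  · refine Cmd.Safe.skip ⟨SameOff.refl _ _, ?_⟩
    have H' := H.congr (hM' 0 (by decide))
    have hj' : HasVal L M' (.var 14) j := .varNat hv (le_two_pow_of_le (hj.le.trans R.size_le))
    have hlt : j % P.h % P.len < P.len := Nat.mod_lt _ P.len_pos
    have hr := HasVal.mul ((((hj'.modNat (H'.val_h R)).divNat (H'.val_len R))).bin .eq
      (hj'.divNat (H'.val_h R)))
      (HasVal.readNat ((hj'.modNat (H'.val_h R)).modNat (H'.val_len R))
        ((congrFun (hM' 12 (by decide)) _).trans (hpow _ hlt.le))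
        (Nat.pow_le_pow_right (by norm_num) (hlt.le.trans R.len_le)))
    refine ⟨hj'.1, hr.1, by rw [hj'.2, zero_add], hr.2.trans ?_⟩
    rw [zero_add, flat_gadget hj]
    simp only [BinOp.eval, Nat.cast_inj]
    split_ifs <;> simp
  · refine ⟨hM', holdsMat_iff.2 fun p hp => ?_⟩
    rw [hT, if_pos (by omega)]
    simp

/-- Bit number `var 14 / size` of the index in array `10`. -/
def bitExpr : Expr := .var 10 / .read 12 (.var 14 / sizeExpr) % .lit (2 : ℕ)

/-- A summand of an entry of a product with a bit decomposition. -/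
def termExpr : Expr :=
  .read 2 (.var 14 / par 3 * par 3 + .var 15) *
    (.read 11 (.var 14 / sizeExpr * sizeExpr + (.var 15 / par 5 * par 3 + .var 14 % par 3)) /
      .read 12 (.var 15 % par 5) % .lit (2 : ℕ))

/-- Array `11` receives, one after the other, the ciphertexts on the wires of the circuit of the
index in array `10`; the gadget matrix is already there. -/
def wiresCmd : Cmd :=
  .forLoop 14 (par 6 * sizeExpr) (.seq
    (.sumLoop 13 15 ((par 2 + .lit (1 : ℕ)) * par 5) termExpr)
    (.write 11 (sizeExpr + .var 14)
      (((.lit 1 - bitExpr) * .read 11 (.var 14) + (.lit 2 * bitExpr - .lit 1) * .var 13) % par 4)))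

theorem wiresCmd_safe {n k L i : ℕ} {M : Mem} (R : RoomFor P n L) (H : HoldsParams M n k P)
    (hpow : ∀ t ≤ P.len, M 12 t = (2 ^ t : ℕ)) (hG : HoldsMat M 11 0 (gadget P))
    (hi : M 10 0 = i) (hin : i < n) {cts : Fin (Nat.clog 2 n) → Ct P}
    (hc : ∀ j : Fin (Nat.clog 2 n), HoldsMat M 2 ((j : ℕ) * ((P.g + 1) * P.h)) (cts j)) :
    wiresCmd.Safe L M fun M' => SameOff [11, 14, 13, 15] M M' ∧
      HoldsMat M' 11 (Nat.clog 2 n * ((P.g + 1) * P.h)) (pointGen i cts (Nat.clog 2 n)) := by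
  have hL := R.one_le
  have hs0 := R.size_pos
  have hh0 := R.h_pos
  set z := (P.g + 1) * P.h with hz
  have hcells : Nat.clog 2 n * z + z ≤ L := le_of_eq_of_le (by ring) R.cells
  -- One loop over `w = j z + p` computes entry `p` of wire `j + 1` and stores it in cell `z + w`,
  -- so wire `j` occupies the block of `z` cells starting at `j z`. Block 0 is the gadget matrix and
  -- lies before the table.
  refine Cmd.Safe.table (l := [13, 15]) (b := z) (m := Nat.clog 2 n * z)
    (by decide) hL (by omega) (by simp) (by simp) (fun M' hM' => ?_)
    (fun p => flat (pointGen i cts (p / z)) (p % z))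
    (fun w hw M' hM' hv hT => ?_) fun M' hM' hT => ?_
  · have H' := H.congr (hM' 0 (by decide))
    exact (H'.val_ell R).mulNat (H'.val_size R)
  · set j := w / z with hjdef
    set p := w % z with hpdef
    have hwjp : w = j * z + p := by rw [hjdef, hpdef, mul_comm, Nat.div_add_mod]
    have hj : j < Nat.clog 2 n := Nat.div_lt_of_lt_mul (by rwa [mul_comm])
    have hp : p < z := Nat.mod_lt _ hs0
    have hmodh : w % P.h = p % P.h := by
      rw [hwjp, hz, ← mul_assoc, mul_comm, Nat.mul_add_mod]
    have hdivh : w / P.h * P.h = j * z + p / P.h * P.h := by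
      have h1 := Nat.div_add_mod w P.h
      have h2 := Nat.div_add_mod p P.h
      rw [mul_comm] at h1 h2
      omega
    -- Block `j` is complete in round `w`: it is the gadget matrix if `j = 0`, and otherwise it lies
    -- wholly below `z + w`.
    have hF : ∀ p' < z, M' 11 (j * z + p') = flat (pointGen i cts j) p' := by
      intro p' hp'
      have e1 : (j * z + p') / z = j := by
        rw [mul_comm, Nat.mul_add_div hs0, Nat.div_eq_of_lt hp', add_zero]
      have e2 : (j * z + p') % z = p' := by
        rw [mul_comm, Nat.mul_add_mod, Nat.mod_eq_of_lt hp']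
      rw [hT]
      split_ifs with hc1
      · rw [e1, e2]
      · have hj0 : j = 0 := by
          by_contra hne
          have : z ≤ j * z := Nat.le_mul_of_pos_left _ (Nat.pos_of_ne_zero hne)
          refine hc1 ⟨by omega, ?_⟩
          omega
        rw [hj0, pointGen_zero, zero_mul]
        exact holdsMat_iff.1 hG p' hp'
    -- The inner sum touches only its accumulator and its counter, so these facts are available both
    -- during the sum and after it.
    have Hmem : ∀ M'' : Mem, SameOff [13, 15] M' M'' →
        HoldsParams M'' n k P ∧ HasVal L M'' (.var 14) w ∧ HasVal L M'' (.var 10) i ∧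
        (∀ t ≤ P.len, M'' 12 t = (2 ^ t : ℕ)) ∧
        (∀ p' < z, M'' 2 (j * z + p') = flat (cts ⟨j, hj⟩) p') ∧
        ∀ p' < z, M'' 11 (j * z + p') = flat (pointGen i cts j) p' := by
      intro M'' hM''
      refine ⟨(H.congr (hM' 0 (by decide))).congr (hM'' 0 (by decide)), ?_, ?_, ?_, ?_, ?_⟩
      · exact .varNat ((congrFun (hM'' 14 (by decide)) 0).trans hv)
          (le_two_pow_of_le (by omega))
      · refine .varNat ?_ ((hin.trans R.lt_q).le.trans R.q_le)
        rw [hM'' 10 (by decide), hM' 10 (by decide), hi]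
      · intro t ht
        rw [hM'' 12 (by decide), hM' 12 (by decide), hpow t ht]
      · intro p' hp'
        rw [hM'' 2 (by decide), hM' 2 (by decide)]
        exact holdsMat_iff.1 (hc ⟨j, hj⟩) p' hp'
      · intro p' hp'
        rw [hM'' 11 (by decide)]
        exact hF p' hp'
    have hcol : p % P.h < P.h := Nat.mod_lt _ hh0
    have hrow : p / P.h < P.g + 1 := row_lt hp
    refine Cmd.Safe.sumLoop (m := (P.g + 1) * P.len) (by decide) hL (R.width.trans R.h_le)
      (fun M'' hM'' => ?_)
      (fun t => mulTerm (cts ⟨j, hj⟩) (pointGen i cts j) (p / P.h) (p % P.h) t)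
      (fun m hm => ?_) (fun t ht M'' hM'' hv' => ?_) fun M'' hM'' hacc => ?_
    · obtain ⟨H', -⟩ := Hmem M'' hM''
      exact ((H'.val_g R).addNat (.natLit 1)).mulNat (H'.val_len R)
    · have := sum_mulTerm_le R (cts ⟨j, hj⟩) (pointGen i cts j) (p / P.h) (p % P.h) hm
      rw [← Nat.cast_sum, Nat.abs_cast]
      exact_mod_cast this
    · obtain ⟨H', hw', -, hpow', hX, hY⟩ := Hmem M'' hM''
      have hth : t < P.h := ht.trans_le R.width
      have hv15 : HasVal L M'' (.var 15) t :=
        .varNat hv' (le_two_pow_of_le (hth.le.trans R.h_le))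
      have htl : t % P.len < P.len := Nat.mod_lt _ P.len_pos
      have htd : t / P.len < P.g + 1 := Nat.div_lt_of_lt_mul (by rwa [mul_comm])
      refine HasVal.congr (HasVal.mul (HasVal.readNat
        (((hw'.divNat (H'.val_h R)).mulNat (H'.val_h R)).addNat hv15)
        (s := flat (cts ⟨j, hj⟩) (p / P.h * P.h + t)) ?_ ?_)
        (HasVal.modNat (HasVal.divNat (HasVal.readNat
          (((hw'.divNat (H'.val_size R)).mulNat (H'.val_size R)).addNat
            (((hv15.divNat (H'.val_len R)).mulNat (H'.val_h R)).addNat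
              (hw'.modNat (H'.val_h R))))
          (s := flat (pointGen i cts j) (t / P.len * P.h + p % P.h)) ?_ ?_)
          (HasVal.readNat (hv15.modNat (H'.val_len R)) (hpow' _ htl.le) ?_)) (.natLit 2))) ?_
      · rw [hdivh, add_assoc]
        exact hX _ (mul_add_lt hrow hth)
      · exact (flat_lt _ _).le.trans R.q_le
      · rw [hmodh]
        exact hY _ (mul_add_lt htd hcol)
      · exact (flat_lt _ _).le.trans R.q_le
      · exact Nat.pow_le_pow_right (by norm_num) (htl.le.trans R.len_le)
      · rw [mulTerm, Nat.cast_mul]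
    · obtain ⟨H', hw', hi', hpow', hX, hY⟩ := Hmem M'' hM''
      refine ⟨hM'', ?_⟩
      have hidx : HasVal L M'' (sizeExpr + .var 14) (z + w : ℕ) := (H'.val_size R).addNat hw'
      have hb : HasVal L M'' bitExpr (i / 2 ^ j % 2 : ℕ) :=
        (hi'.divNat (HasVal.readNat (hw'.divNat (H'.val_size R)) (hpow' _ (hj.le.trans R.clog_le))
          (Nat.pow_le_pow_right (by norm_num) ((hj.le.trans R.clog_le).trans R.len_le)))).modNat
          (.natLit 2)
      have hval := ((((HasVal.lit 1).sub hb).mul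
        (HasVal.readNat hw' (s := flat (pointGen i cts j) p)
          (by rw [hwjp]; exact hY p hp) ((flat_lt _ _).le.trans R.q_le))).add
        ((((HasVal.lit 2).mul hb).sub (.lit 1)).mul (HasVal.varNat (hacc.trans
          (Nat.cast_sum _ _).symm) (sum_mulTerm_le R _ _ _ _ le_rfl)))).mod (H'.val_q R)
      refine ⟨hidx.1, hval.1, hidx.2, hval.2.trans ?_⟩
      have e1 : (z + w) / z = j + 1 := by rw [Nat.add_div_left _ hs0]
      have e2 : (z + w) % z = p := by rw [Nat.add_mod_left]
      rw [e1, e2, flat_pointGen_succ R.width i cts hj hp]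
  · refine ⟨hM', holdsMat_iff.2 fun p hp => ?_⟩
    have e1 : (Nat.clog 2 n * z + p) / z = Nat.clog 2 n := by
      rw [mul_comm, Nat.mul_add_div hs0, Nat.div_eq_of_lt hp, add_zero]
    have e2 : (Nat.clog 2 n * z + p) % z = p := by
      rw [mul_comm, Nat.mul_add_mod, Nat.mod_eq_of_lt hp]
    have hpz : p < z := hp
    rw [hT]
    -- The second case can occur only without input bits; the gadget matrix is then itself the
    -- result.
    split_ifs with hc1
    · rw [e1, e2]
    · have h0 : Nat.clog 2 n = 0 := by
        by_contra hne
        have : z ≤ Nat.clog 2 n * z := Nat.le_mul_of_pos_left _ (Nat.pos_of_ne_zero hne)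
        exact hc1 ⟨by omega, by omega⟩
      have h1 := (congrArg (pointGen i cts) h0).trans (pointGen_zero i cts)
      have h2 : Nat.clog 2 n * z + p = 0 + p := by rw [h0, zero_mul]
      rw [h1, h2]
      exact holdsMat_iff.1 hG p hp

/-- Array `11` receives, at its end, the evaluated ciphertext of the index in array `10`; array
`12` contains the powers of two. -/
def pointCmd : Cmd := .seq gadgetCmd wiresCmd

theorem pointCmd_safe {n k L : ℕ} {i : Fin n} {M : Mem} (R : RoomFor P n L)
    {D : Stored P (Nat.clog 2 n)} (H : HoldsStored M n k D)
    (hpow : ∀ t ≤ P.len, M 12 t = (2 ^ t : ℕ)) (hi : M 10 0 = (i : ℕ)) :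
    pointCmd.Safe L M fun M' => SameOff [11, 13, 14, 15] M M' ∧
      HoldsMat M' 11 (Nat.clog 2 n * ((P.g + 1) * P.h)) (D.point i) := by
  refine Cmd.Safe.seq (Cmd.Safe.mono (gadgetCmd_safe R H.1 hpow) ?_)
  rintro M₁ ⟨h₁, hG⟩
  refine Cmd.Safe.mono (wiresCmd_safe R (H.1.congr (h₁ 0 (by decide))) (i := i) (cts := D.cts)
    ?_ hG ?_ i.2 fun j => (H.2.2.1 j).congr (h₁ 2 (by decide))) ?_
  · intro t ht
    rw [h₁ 12 (by decide), hpow t ht]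
  · rw [h₁ 10 (by decide), hi]
  · rintro M₂ ⟨h₂, hY⟩
    refine ⟨(h₁.mono (by decide)).trans (h₂.mono (by decide)), ?_⟩
    rwa [Stored.point, evalCt_pointCircuit]

end GSWStream

/-! ### The update and report programs. -/

namespace GSWStream

variable {P : Params}

open GSWStream.Expr

/-! ### Adding a multiple of the evaluated ciphertext -/

theorem flat_add_zsmul (X Y : Ct P) (z : ℤ) {p : ℕ} (hp : p < (P.g + 1) * P.h) :
    (flat (X + z • Y) p : ℤ) = (flat X p + z * flat Y p) % P.q := by
  rw [← ZMod.val_intCast, flat_of_lt _ hp, flat_of_lt _ hp, flat_of_lt _ hp]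
  simp

theorem flat_zero (p : ℕ) : flat (0 : Ct P) p = 0 := by
  simp [flat]

theorem flat_ext {X Y : Ct P} (h : ∀ p < (P.g + 1) * P.h, flat X p = flat Y p) : X = Y := by
  ext i j
  have := h _ (mul_add_lt i.2 j.2)
  rw [flat_mul_add, flat_mul_add] at this
  exact ZMod.val_injective _ this

theorem abs_flat_le {n L : ℕ} (R : RoomFor P n L) (X : Ct P) (p : ℕ) : flat X p ≤ 2 ^ L :=
  (flat_lt _ _).le.trans R.q_le

/-- Add `c` times the matrix at the end of array `11` to the matrix in array `a`. -/
def addCmd (a : ℕ) (c : Expr) : Cmd :=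
  .forLoop 14 sizeExpr (.seq .skip (.write a (.var 14)
    ((.read a (.var 14) + c * .read 11 (par 6 * sizeExpr + .var 14)) % par 4)))

theorem addCmd_safe {n k L a : ℕ} {c : Expr} {z : ℤ} {M : Mem} {X Y : Ct P} (R : RoomFor P n L)
    (H : HoldsParams M n k P) (ha : a ∉ [0, 11, 14]) (hX : HoldsMat M a 0 X)
    (hY : HoldsMat M 11 (Nat.clog 2 n * ((P.g + 1) * P.h)) Y)
    (hc : ∀ M', SameOff [a, 14] M M' → HasVal L M' c z) :
    (addCmd a c).Safe L M fun M' => SameOff [a, 14] M M' ∧ HoldsMat M' a 0 (X + z • Y) := by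
  have hL := R.one_le
  simp only [List.mem_cons, List.not_mem_nil, or_false, not_or] at ha
  have h0 : 0 ∉ [a, 14] := by simp [ha.1, Ne.symm]
  have h11 : 11 ∉ [a, 14] := by simp [Ne.symm ha.2.1]
  refine Cmd.Safe.table (l := []) (b := 0) (m := (P.g + 1) * P.h) ha.2.2 hL R.size_le
    (by simp) (by simp) (fun M' hM' => ?_) (fun p => flat (X + z • Y) p)
    (fun j hj M' hM' hv hT => ?_) fun M' hM' hT => ?_
  · exact (H.congr (hM' 0 h0)).val_size R
  · refine Cmd.Safe.skip ⟨SameOff.refl _ _, ?_⟩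
    have H' := H.congr (hM' 0 h0)
    have hj' : HasVal L M' (.var 14) j := .varNat hv (le_two_pow_of_le (hj.le.trans R.size_le))
    -- The matrix is overwritten in place; round `j` reads cell `j` before it is changed.
    have hXj : M' a j = flat X j := by
      rw [hT, if_neg (by omega)]
      simpa using holdsMat_iff.1 hX j hj
    have hYj : M' 11 (Nat.clog 2 n * ((P.g + 1) * P.h) + j) = flat Y j := by
      rw [hM' 11 h11]
      exact holdsMat_iff.1 hY j hj
    have hr := ((HasVal.readNat hj' hXj (abs_flat_le R _ _)).add ((hc M' hM').mul (HasVal.readNat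
      (((H'.val_ell R).mulNat (H'.val_size R)).addNat hj') hYj (abs_flat_le R _ _)))).mod
      (H'.val_q R)
    refine ⟨hj'.1, hr.1, by rw [hj'.2, zero_add], hr.2.trans ?_⟩
    rw [zero_add, flat_add_zsmul _ _ _ hj]
  · refine ⟨hM', holdsMat_iff.2 fun p hp => ?_⟩
    rw [hT, if_pos (by omega)]
    simp

/-! ### The update program -/

/-- The part of the update behind the call of the subroutine. -/
def sketchCmd : Cmd :=
  .seq powersCmd (.seq (.assign 10 (.var 4)) (.seq pointCmd (addCmd 3 (.read 4 (.lit (1 : ℕ))))))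

theorem HoldsStored.congr {n k : ℕ} {M M' : Mem} {D : Stored P (Nat.clog 2 n)}
    (H : HoldsStored M n k D) {l : List ℕ} (hM : SameOff l M M') (hl : ∀ a < 4, a ∉ l) :
    HoldsStored M' n k D :=
  ⟨H.1.congr (hM 0 (hl 0 (by norm_num))), H.2.1.congr (hM 1 (hl 1 (by norm_num))),
    fun j => (H.2.2.1 j).congr (hM 2 (hl 2 (by norm_num))),
    H.2.2.2.congr (hM 3 (hl 3 (by norm_num)))⟩

theorem sketchCmd_safe {n k L : ℕ} {i : Fin n} {Δ : ℤ} {M : Mem} (R : RoomFor P n L)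
    {D : Stored P (Nat.clog 2 n)} (H : HoldsStored M n k D) (hi : M 4 0 = (i : ℕ))
    (hΔ : M 4 1 = Δ) (hΔL : |Δ| ≤ 2 ^ L) :
    sketchCmd.Safe L M fun M' =>
      HoldsStored M' n k { D with sketch := D.sketch + Δ • D.point i } := by
  have hL := R.one_le
  refine Cmd.Safe.seq ((powersCmd_safe R H.1).mono ?_)
  rintro M₁ ⟨h₁, hpow⟩
  have hi₁ : HasVal L M₁ (.var 4) (i : ℕ) := by
    refine .varNat ?_ ((i.2.trans R.lt_q).le.trans R.q_le)
    rw [h₁ 4 (by decide), hi]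
  refine Cmd.Safe.seq (Cmd.Safe.assignVal hL hi₁ ?_)
  set M₂ := M₁.store 10 0 (i : ℕ) with hM₂
  have h₂ : SameOff [10, 12, 14] M M₂ := (h₁.mono (by decide)).store (by decide)
  refine Cmd.Safe.seq ((pointCmd_safe (i := i) R (H.congr h₂ (by decide)) (fun t ht => ?_)
    ?_).mono ?_)
  · rw [← hpow t ht, hM₂, Mem.store_of_ne _ _ _ (by decide)]
  · simp [hM₂]
  rintro M₃ ⟨h₃, hY⟩
  have h₃' : SameOff [10, 11, 12, 13, 14, 15] M M₃ :=
    (h₂.mono (by decide)).trans (h₃.mono (by decide))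
  have H₃ := H.congr h₃' (by decide)
  refine (addCmd_safe R H₃.1 (by decide) H₃.2.2.2 hY (z := Δ) fun M' hM' => ?_).mono ?_
  · refine .read (.natLit 1) ?_ hΔL
    rw [hM' 4 (by decide), h₃' 4 (by decide), hΔ]
  · rintro M₄ ⟨h₄, hS⟩
    exact ⟨H₃.1.congr (h₄ 0 (by decide)), H₃.2.1.congr (h₄ 1 (by decide)),
      fun j => (H₃.2.2.1 j).congr (h₄ 2 (by decide)), hS⟩

/-- The update program. -/
def updateCmd : Cmd := .seq .call sketchCmd

theorem updateCmd_run {n k L : ℕ} {A : RecoveryAlg n} (R : RoomFor P n L) {s : StreamState A P}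
    {i : Fin n} {Δ : ℤ} {M : Mem} (H : HoldsStored M n k s.data) (hi : M 4 0 = (i : ℕ))
    (hΔ : M 4 1 = Δ) (hΔL : |Δ| ≤ 2 ^ L) :
    HoldsStored (updateCmd.run (updateSub A) (M, s.inner)).1.1 n k (streamUpdate s i Δ).data ∧
      (updateCmd.run (updateSub A) (M, s.inner)).1.2 = (streamUpdate s i Δ).inner ∧
      (updateCmd.run (updateSub A) (M, s.inner)).2 ≤
        sketchCmd.bnd L + 1 + A.updateTime s.inner i Δ := by
  -- The subroutine leaves the memory alone, so the sketch is updated from the memory given at the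
  -- start.
  have hsub : updateSub A (M, s.inner) =
      ((M, A.update s.inner i Δ), A.updateTime s.inner i Δ) := by
    have h0 : (M 4 0).toNat = i := by rw [hi, Int.toNat_natCast]
    have hlt : (M 4 0).toNat < n := by rw [h0]; exact i.2
    have he : (⟨(M 4 0).toNat, hlt⟩ : Fin n) = i := Fin.ext h0
    simp only [updateSub, hlt, dif_pos, he, hΔ]
  obtain ⟨h1, h2, h3⟩ := sketchCmd_safe R H hi hΔ hΔL A.State (updateSub A) (A.update s.inner i Δ)
  simp only [updateCmd, Cmd.run, hsub]
  exact ⟨h1, h2, by omega⟩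

/-! ### The report program -/

section SparseList

variable {n : ℕ} {l : List (Fin n × ℤ)} {x : Fin n → ℤ}

theorem IsSparseList.mem_toFinset (h : IsSparseList l x) (i : Fin n) :
    i ∈ (l.map Prod.fst).toFinset ↔ x i ≠ 0 := by
  simp only [List.mem_toFinset, List.mem_map, Prod.exists, exists_and_right, exists_eq_right]
  constructor
  · rintro ⟨v, hv⟩
    obtain ⟨h1, h2⟩ := (h.2 i v).1 hv
    rwa [h1]
  · exact fun hi => ⟨x i, (h.2 i _).2 ⟨rfl, hi⟩⟩

theorem IsSparseList.hammingNorm_eq (h : IsSparseList l x) : hammingNorm x = l.length := by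
  rw [← List.length_map (f := Prod.fst), ← List.toFinset_card_of_nodup h.1, hammingNorm]
  congr 1
  ext i
  rw [h.mem_toFinset]
  simp

/-- Coordinates missing from the list are zero. This reduces the verification sum over all `n`
coordinates to one evaluation per list entry. -/
theorem IsSparseList.sum_eq {α : Type*} [AddCommGroup α] (h : IsSparseList l x) (Y : Fin n → α) :
    (l.map fun p => p.2 • Y p.1).sum = ∑ i, x i • Y i := by
  have h1 : (l.map fun p => p.2 • Y p.1) = (l.map Prod.fst).map fun i => x i • Y i := by
    rw [List.map_map]
    refine List.map_congr_left fun p hp => ?_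
    simp only [Function.comp]
    rw [((h.2 p.1 p.2).1 hp).1]
  rw [h1, ← List.sum_toFinset _ h.1]
  refine Finset.sum_subset (Finset.subset_univ _) fun i _ hi => ?_
  rw [h.mem_toFinset, not_not] at hi
  rw [hi, zero_smul]

theorem IsSparseList.length_le (h : IsSparseList l x) : l.length ≤ n := by
  have := h.1.length_le_card
  simpa using this

end SparseList

theorem HoldsList.congr {n : ℕ} {M M' : Mem} {l : List (Fin n × ℤ)} (H : HoldsList M l)
    {w : List ℕ} (hM : SameOff w M M') (h5 : 5 ∉ w) (h6 : 6 ∉ w) (h7 : 7 ∉ w) :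
    HoldsList M' l := by
  unfold HoldsList
  rw [hM 5 h5, hM 6 h6, hM 7 h7]
  exact H

/-- Array `17` receives the zero matrix. -/
def zeroCmd : Cmd := .forLoop 14 sizeExpr (.seq .skip (.write 17 (.var 14) (.lit 0)))

theorem zeroCmd_safe {n k L : ℕ} {M : Mem} (R : RoomFor P n L) (H : HoldsParams M n k P) :
    zeroCmd.Safe L M fun M' => SameOff [17, 14] M M' ∧ HoldsMat M' 17 0 (0 : Ct P) := by
  have hL := R.one_le
  refine Cmd.Safe.table (l := []) (b := 0) (m := (P.g + 1) * P.h) (by decide) hL R.size_le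
    (by simp) (by simp) (fun M' hM' => ?_) (fun _ => 0)
    (fun j hj M' hM' hv hT => ?_) fun M' hM' hT => ?_
  · exact (H.congr (hM' 0 (by decide))).val_size R
  · have hj' : HasVal L M' (.var 14) j := .varNat hv (le_two_pow_of_le (hj.le.trans R.size_le))
    exact Cmd.Safe.skip ⟨SameOff.refl _ _, hj'.1, trivial, by rw [hj'.2, zero_add], rfl⟩
  · refine ⟨hM', holdsMat_iff.2 fun p hp => ?_⟩
    rw [hT, if_pos (by omega), flat_zero, Nat.cast_zero]

/-- Compare the matrices in the arrays `17` and `3`. -/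
def compareCmd : Cmd :=
  .seq (.assign 8 (.lit 1)) (.forLoop 14 sizeExpr
    (.assign 8 (.var 8 * .bin .eq (.read 17 (.var 14)) (.read 3 (.var 14)))))

open Classical in
theorem compareCmd_safe {n k L : ℕ} {M : Mem} {X Y : Ct P} (R : RoomFor P n L)
    (H : HoldsParams M n k P) (hX : HoldsMat M 17 0 X) (hY : HoldsMat M 3 0 Y) :
    compareCmd.Safe L M fun M' => SameOff [8, 14] M M' ∧ M' 8 0 = if X = Y then 1 else 0 := by
  have hL := R.one_le
  refine Cmd.Safe.seq (Cmd.Safe.assignVal hL (.lit 1) ?_)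
  have hs : SameOff [8, 14] M ((M.store 8 0 1).store 14 0 0) :=
    ((SameOff.refl _ M).store (by decide)).store (by decide)
  have hsz := (H.congr (hs 0 (by decide))).val_size R
  -- The flag is the product of the equality indicators of all entries compared so far, hence always
  -- 0 or 1.
  refine Cmd.Safe.forLoop hL R.size_le hsz.1 hsz.2
    (fun j M' => SameOff [8, 14] M M' ∧ M' 8 0 = if ∀ p < j, flat X p = flat Y p then 1 else 0)
    ⟨hs, ?_⟩ ?_ ?_
  · rw [Mem.store_of_ne _ _ _ (by decide)]
    simp
  · rintro j hj M' hv ⟨h1, h2⟩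
    have hj' : HasVal L M' (.var 14) j := .varNat hv (le_two_pow_of_le (hj.le.trans R.size_le))
    have hXj : M' 17 j = flat X j := by
      rw [h1 17 (by decide)]
      simpa using holdsMat_iff.1 hX j hj
    have hYj : M' 3 j = flat Y j := by
      rw [h1 3 (by decide)]
      simpa using holdsMat_iff.1 hY j hj
    have h8 : HasVal L M' (.var 8) (if ∀ p < j, flat X p = flat Y p then 1 else 0) := by
      refine .var h2 ?_
      split_ifs
      · simpa using one_le_pow₀ (by norm_num : (1 : ℤ) ≤ 2)
      · simp
    refine Cmd.Safe.assignVal hL (h8.mul ((HasVal.readNat hj' hXj (abs_flat_le R _ _)).bin .eq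
      (HasVal.readNat hj' hYj (abs_flat_le R _ _))))
      ⟨?_, (h1.store (by decide)).store (by decide), ?_⟩
    · rw [Mem.store_of_ne _ _ _ (by decide), hv]
    · rw [Mem.store_of_ne _ _ _ (by decide), Mem.store_same]
      have hiff : (∀ p < j + 1, flat X p = flat Y p) ↔
          (∀ p < j, flat X p = flat Y p) ∧ flat X j = flat Y j := by
        constructor
        · exact fun h => ⟨fun p hp => h p (by omega), h j (by omega)⟩
        · rintro ⟨h, h'⟩ p hp
          rcases Nat.lt_succ_iff_lt_or_eq.1 hp with hp | rfl
          exacts [h p hp, h']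
      simp only [BinOp.eval, Nat.cast_inj, hiff]
      split_ifs <;> simp_all
  · rintro M' ⟨h1, h2⟩
    refine ⟨h1, h2.trans (if_congr ⟨flat_ext, ?_⟩ rfl rfl)⟩
    rintro rfl p _
    rfl

/-- One round of the summation: add the multiple of the ciphertext of entry `var 18` of the
list. -/
def summandCmd : Cmd :=
  .seq (.assign 10 (.read 6 (.var 18))) (.seq pointCmd (addCmd 17 (.read 7 (.var 18))))

/-- Array `17` receives the linear combination of the evaluated ciphertexts that the list
describes. -/
def combineCmd : Cmd := .forLoop 18 (.var 5) summandCmd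

/-- The number of rounds is the length of the list, which the word length need not bound; hence `k`
times the standard time bound. The assumption `1 ≤ k` pays for the work outside the loop. -/
theorem combineCmd_reaches {n k L : ℕ} {M : Mem} (R : RoomFor P n L)
    {D : Stored P (Nat.clog 2 n)} {l : List (Fin n × ℤ)} (H : HoldsStored M n k D)
    (hl : HoldsList M l) (hpow : ∀ t ≤ P.len, M 12 t = (2 ^ t : ℕ))
    (h0 : HoldsMat M 17 0 (0 : Ct P)) (hlen : l.length ≤ 2 ^ L)
    (hval : ∀ p ∈ l, |p.2| ≤ 2 ^ L) (hk : l.length ≤ k) (hk1 : 1 ≤ k) :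
    combineCmd.Reaches (k * combineCmd.bnd L) M fun M' =>
      SameOff [10, 11, 13, 14, 15, 17, 18] M M' ∧
      HoldsMat M' 17 0 (l.map fun p => p.2 • D.point p.1).sum := by
  have hL := R.one_le
  have hs : SameOff [10, 11, 13, 14, 15, 17, 18] M (M.store 18 0 0) :=
    (SameOff.refl _ M).store (by decide)
  have he : HasVal L (M.store 18 0 0) (.var 5) l.length :=
    .varNat ((congrFun (hs 5 (by decide)) 0).trans hl.1) hlen
  have key := Cmd.Reaches.forLoop (v := 18) (e := .var 5) (c := summandCmd) (T := summandCmd.bnd L)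
    hL (by exact_mod_cast hlen) he.1 he.2
    (fun j M' => SameOff [10, 11, 13, 14, 15, 17, 18] M M' ∧
      HoldsMat M' 17 0 ((l.take j).map fun p => p.2 • D.point p.1).sum) (M := M)
    (Q := fun M' => SameOff [10, 11, 13, 14, 15, 17, 18] M M' ∧
      HoldsMat M' 17 0 (l.map fun p => p.2 • D.point p.1).sum)
    ⟨hs, by simpa using h0.congr (Mem.store_of_ne _ _ _ (by decide))⟩ ?_ ?_
  · refine key.mono ?_ fun _ h => h
    have h1 : ∀ a b c : ℕ, a + (b + 1 + l.length * c) ≤ k * (a + (b + 1 + L * c)) := by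
      intro a b c
      have h2 : l.length * c ≤ k * (L * c) := Nat.mul_le_mul hk (Nat.le_mul_of_pos_left c hL)
      have h3 : a + b + 1 ≤ k * (a + b + 1) := Nat.le_mul_of_pos_left _ hk1
      calc a + (b + 1 + l.length * c) = (a + b + 1) + l.length * c := by ring
        _ ≤ k * (a + b + 1) + k * (L * c) := add_le_add h3 h2
        _ = _ := by ring
    exact h1 _ _ _
  · rintro j hj M' hv ⟨h1, h2⟩
    have hj' : HasVal L M' (.var 18) j := .varNat hv (hj.le.trans hlen)
    have hl' := hl.congr h1 (by decide) (by decide) (by decide)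
    have H' := H.congr h1 (by decide)
    obtain ⟨h6, h7⟩ := hl'.2 ⟨j, hj⟩
    set e := l.get ⟨j, hj⟩ with he
    have hmem : e ∈ l := List.get_mem _ _
    refine Cmd.Safe.seq (Cmd.Safe.assignVal hL (HasVal.readNat hj' h6
      ((e.1.2.trans R.lt_q).le.trans R.q_le)) ?_)
    have hs₁ : SameOff [10] M' (M'.store 10 0 ((e.1 : ℕ) : ℤ)) :=
      (SameOff.refl _ M').store (by decide)
    refine Cmd.Safe.seq ((pointCmd_safe (i := e.1) R (H'.congr hs₁ (by decide)) (fun t ht => ?_)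
      (by simp)).mono ?_)
    · rw [hs₁ 12 (by decide), h1 12 (by decide), hpow t ht]
    rintro M₂ ⟨hs₂, hY⟩
    have hs₂' : SameOff [10, 11, 13, 14, 15] M' M₂ :=
      (hs₁.mono (by decide)).trans (hs₂.mono (by decide))
    refine (addCmd_safe R (H'.congr hs₂' (by decide)).1 (by decide) (h2.congr (hs₂' 17 (by decide)))
      hY (z := e.2) fun M'' hM'' => ?_).mono ?_
    · have hj'' : HasVal L M'' (.var 18) j := by
        refine .varNat ?_ (hj.le.trans hlen)
        rw [hM'' 18 (by decide), hs₂' 18 (by decide), hv]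
      refine .read hj'' ?_ (hval e hmem)
      rw [hM'' 7 (by decide), hs₂' 7 (by decide)]
      exact h7
    · rintro M₃ ⟨hs₃, hS⟩
      have hs₃' : SameOff [10, 11, 13, 14, 15, 17] M' M₃ :=
        (hs₂'.mono (by decide)).trans (hs₃.mono (by decide))
      refine ⟨by rw [hs₃' 18 (by decide), hv],
        (h1.trans (hs₃'.mono (by decide))).store (by decide), ?_⟩
      have htake : l.take (j + 1) = l.take j ++ [e] := by
        rw [he, List.get_eq_getElem, List.take_concat_get']
      rw [htake, List.map_append, List.sum_append]
      simp only [List.map_cons, List.map_nil, List.sum_cons, List.sum_nil, add_zero]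
      exact hS.congr (Mem.store_of_ne _ _ _ (by decide))
  · rintro M' ⟨h1, h2⟩
    rw [List.take_length] at h2
    exact ⟨h1, h2⟩

/-- The part of the report behind the call of the subroutine. -/
def verifyCmd : Cmd :=
  .ite (.bin .le (.var 5) (par 1))
    (.seq powersCmd (.seq zeroCmd (.seq combineCmd compareCmd))) (.assign 8 (.lit 0))

-- Comparing the length of the list with `k` before any other work caps the number of rounds by `k`,
-- even if the recovery algorithm reports a denser vector.
open Classical in
theorem verifyCmd_reaches {n k L : ℕ} {M : Mem} (R : RoomFor P n L)
    {D : Stored P (Nat.clog 2 n)} {l : List (Fin n × ℤ)} (H : HoldsStored M n k D)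
    (hl : HoldsList M l) (hlen : l.length ≤ 2 ^ L) (hval : ∀ p ∈ l, |p.2| ≤ 2 ^ L)
    (hk1 : 1 ≤ k) (hkn : k ≤ n) :
    verifyCmd.Reaches (k * verifyCmd.bnd L) M fun M' =>
      SameOff [8, 10, 11, 12, 13, 14, 15, 17, 18] M M' ∧
      M' 8 0 = if l.length ≤ k ∧ (l.map fun p => p.2 • D.point p.1).sum = D.sketch
        then 1 else 0 := by
  have hL := R.one_le
  -- The parts outside the long loop are charged `k` times as well, which keeps the bound in product
  -- form.
  have h1 : ∀ x, x ≤ k * x := fun x => Nat.le_mul_of_pos_left x hk1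
  have hk : HasVal L M (par 1) k :=
    .readNat (.natLit 1) H.1.2.1 ((hkn.trans R.lt_q.le).trans R.q_le)
  have h5 : HasVal L M (.var 5) l.length := .varNat hl.1 hlen
  have hcond := h5.bin .le hk
  have hT : (Expr.bin .le (.var 5) (par 1)).bnd L + 1 +
      (k * (Cmd.seq powersCmd (.seq zeroCmd (.seq combineCmd compareCmd))).bnd L +
        k * (Cmd.assign 8 (.lit 0)).bnd L) ≤ k * verifyCmd.bnd L := by
    simp only [verifyCmd, Cmd.bnd, mul_add k]
    gcongr <;> apply h1
  refine (Cmd.Reaches.ite hL hcond.1 (fun hne => ?_) fun heq => ?_).mono hT fun _ h => h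
  · have hlk : l.length ≤ k := by
      rw [hcond.2] at hne
      by_contra h
      simp [BinOp.eval, h] at hne
    have hT' : powersCmd.bnd L + (zeroCmd.bnd L + (k * combineCmd.bnd L + compareCmd.bnd L)) ≤
        k * (Cmd.seq powersCmd (.seq zeroCmd (.seq combineCmd compareCmd))).bnd L := by
      simp only [Cmd.bnd, mul_add k]
      gcongr <;> apply h1
    refine Cmd.Reaches.mono (Cmd.Reaches.seq ((powersCmd_safe R H.1).mono ?_)) hT' fun _ h => h
    rintro M₁ ⟨hs₁, hpow⟩
    have H₁ := H.congr hs₁ (by decide)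
    refine Cmd.Reaches.seq ((zeroCmd_safe R H₁.1).mono ?_)
    rintro M₂ ⟨hs₂, hz⟩
    have H₂ := H₁.congr hs₂ (by decide)
    have hl₂ := (hl.congr hs₁ (by decide) (by decide) (by decide)).congr hs₂ (by decide)
      (by decide) (by decide)
    refine Cmd.Reaches.seq ((combineCmd_reaches R H₂ hl₂ (fun t ht => ?_) hz hlen hval hlk hk1).mono
      le_rfl ?_)
    · rw [hs₂ 12 (by decide), hpow t ht]
    rintro M₃ ⟨hs₃, hS⟩
    have H₃ := H₂.congr hs₃ (by decide)
    refine (compareCmd_safe R H₃.1 hS H₃.2.2.2).mono ?_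
    rintro M₄ ⟨hs₄, h8⟩
    refine ⟨(((hs₁.mono (by decide)).trans (hs₂.mono (by decide))).trans
      (hs₃.mono (by decide))).trans (hs₄.mono (by decide)), ?_⟩
    rw [h8]
    simp [hlk]
  · have hlk : ¬ l.length ≤ k := by
      rw [hcond.2] at heq
      intro h
      simp [BinOp.eval, h] at heq
    refine Cmd.Reaches.mono (Cmd.Safe.assignVal hL (.lit 0) (Q := fun M' =>
      SameOff [8, 10, 11, 12, 13, 14, 15, 17, 18] M M' ∧
      M' 8 0 = if l.length ≤ k ∧ (l.map fun p => p.2 • D.point p.1).sum = D.sketch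
        then 1 else 0) ⟨(SameOff.refl _ M).store (by decide), ?_⟩) (h1 _) fun _ h => h
    simp [hlk]

/-- The report program. -/
def reportCmd : Cmd := .seq .call verifyCmd

theorem reportCmd_run {n k L : ℕ} {A : RecoveryAlg n} (R : RoomFor P n L) {s : StreamState A P}
    {M : Mem} (H : HoldsStored M n k s.data) (hk1 : 1 ≤ k) (hkn : k ≤ n)
    (hval : ∀ i, |A.report s.inner i| ≤ 2 ^ L) :
    HoldsOutput (reportCmd.run (reportSub A) (M, s.inner)).1.1 (streamReport k s) ∧
      HoldsStored (reportCmd.run (reportSub A) (M, s.inner)).1.1 n k s.data ∧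
      (reportCmd.run (reportSub A) (M, s.inner)).1.2 = s.inner ∧
      (reportCmd.run (reportSub A) (M, s.inner)).2 ≤
        k * verifyCmd.bnd L + 1 + A.reportTime s.inner := by
  set l := A.reportList s.inner with hldef
  have hsp : IsSparseList l (A.report s.inner) := A.reportList_spec s.inner
  obtain ⟨M₁, hM₁⟩ : ∃ M₁, M₁ = (reportSub A (M, s.inner)).1.1 := ⟨_, rfl⟩
  have hsub : reportSub A (M, s.inner) = ((M₁, s.inner), A.reportTime s.inner) := by
    rw [hM₁]
    rfl
  have hs₁ : SameOff [5, 6, 7] M M₁ := by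
    intro a ha
    simp only [List.mem_cons, List.not_mem_nil, or_false, not_or] at ha
    rw [hM₁]
    funext t
    simp [reportSub, ha]
  have hl : HoldsList M₁ l := by
    rw [hM₁]
    refine ⟨by simp [reportSub, hldef], fun t => ?_⟩
    have ht : (t : ℕ) < (A.reportList s.inner).length := t.2
    simp [reportSub, ht, hldef]
  have H₁ := H.congr hs₁ (by decide)
  have hlen : l.length ≤ 2 ^ L := (hsp.length_le.trans R.lt_q.le).trans R.q_le
  have hv : ∀ p ∈ l, |p.2| ≤ 2 ^ L := by
    rintro ⟨i, v⟩ hp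
    have := ((hsp.2 i v).1 hp).1
    rw [← this]
    exact hval i
  obtain ⟨⟨h1, h8⟩, h2, h3⟩ := verifyCmd_reaches R H₁ hl hlen hv hk1 hkn A.State (reportSub A) s.inner
  simp only [reportCmd, Cmd.run, hsub]
  refine ⟨?_, H₁.congr h1 (by decide), h2, by omega⟩
  rw [hsp.sum_eq] at h8
  have hl' := hl.congr h1 (by decide) (by decide) (by decide)
  unfold streamReport
  rw [hsp.hammingNorm_eq]
  split_ifs with hc1 hc2
  · simp only [HoldsOutput]
    rw [h8, if_neg (by omega)]
  · simp only [HoldsOutput]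
    exact ⟨by rw [h8, if_pos ⟨by omega, hc2⟩], l, hsp, hl'⟩
  · simp only [HoldsOutput]
    rw [h8, if_neg fun h => hc2 h.2]

end GSWStream

/-! ### The decoder: from residues modulo `q` to an integer. -/

namespace GSWStream

variable {P : Params}

open GSWStream.Expr

/-! ### The decoder -/

/-- Entry `t` of the last block of `s X`, as an integer. -/
def decEntry (s : Fin (P.g + 1) → ZMod P.q) (X : Ct P) (t : ℕ) : ℕ :=
  ∑ i ∈ Finset.range (P.g + 1), (if hi : i < P.g + 1 then (s ⟨i, hi⟩).val else 0) *
    flat X (i * P.h + (P.g * P.len + t))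

/-- Integer approximations of `y, 2 y, 4 y, …` computed from approximations modulo `q`. -/
def decApprox (q : ℕ) (b : ℕ → ℤ) : ℕ → ℤ
  | 0 => 0
  | t + 1 => 2 * decApprox q b t + (b t - 2 * decApprox q b t) % q -
      q * BinOp.le.eval q (2 * ((b t - 2 * decApprox q b t) % q))

/-- Each step doubles and adds at most `q` in absolute value, whatever the residues are. This crude
bound only serves to show that the decoder's cells fit into words. -/
theorem abs_decApprox_le {q : ℕ} (hq : 0 < q) (b : ℕ → ℤ) (t : ℕ) :
    |decApprox q b t| ≤ (2 ^ t - 1) * q := by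
  induction t with
  | zero => simp [decApprox]
  | succ t ih =>
    have hq' : (0 : ℤ) < q := by exact_mod_cast hq
    have h1 := Int.emod_nonneg (b t - 2 * decApprox q b t) hq'.ne'
    have h2 := Int.emod_lt_of_pos (b t - 2 * decApprox q b t) hq'
    rw [abs_le] at ih ⊢
    simp only [decApprox, BinOp.eval, pow_succ]
    split_ifs <;> constructor <;> nlinarith

/-- If `2 z` is within `q / 4` of `2 ^ t y`, then `2 ^ t y + e_t` differs from `2 z` by less than `q
/ 2`, so its residue modulo `q` determines it as an integer. It becomes the next `z`; its double
misses `2 ^ (t + 1) y` by `2 e_t`, again at most `q / 4`. At the start `z = 0`, and the smallness of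
`y` itself gives the hypothesis. In this way `2 ^ t y` is followed far beyond `q`. -/
theorem decApprox_succ_eq {q : ℕ} {b e : ℕ → ℤ} {y : ℤ} {m : ℕ} (hy : 8 * |y| ≤ q)
    (hb : ∀ t < m, b t ≡ 2 ^ t * y + e t [ZMOD q]) (he : ∀ t < m, 8 * |e t| < q) :
    ∀ t < m, decApprox q b (t + 1) = 2 ^ t * y + e t := by
  have step : ∀ t < m, 4 * |2 * decApprox q b t - 2 ^ t * y| ≤ q →
      decApprox q b (t + 1) = 2 ^ t * y + e t := by
    intro t ht h4
    set z := decApprox q b t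
    set d := 2 ^ t * y + e t - 2 * z with hd
    have hd2 : 2 * |d| < q := by
      have h1 : |d| ≤ |2 * z - 2 ^ t * y| + |e t| := by
        rw [hd, show 2 ^ t * y + e t - 2 * z = -(2 * z - 2 ^ t * y) + e t by ring]
        exact (abs_add_le _ _).trans (by rw [abs_neg])
      have := he t ht
      omega
    have hmod : (b t - 2 * z) % q = d % q := (hb t ht).sub_right _
    -- Subtracting `q` when twice the residue reaches `q` gives the centred representative, which is
    -- `d` itself as `2 |d| < q`.
    have hcent : d % q - q * BinOp.le.eval q (2 * (d % q)) = d := by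
      rcases le_or_gt 0 d with h0 | h0
      · rw [abs_of_nonneg h0] at hd2
        rw [Int.emod_eq_of_lt h0 (by omega)]
        simp [BinOp.eval, hd2]
      · rw [abs_of_neg h0] at hd2
        have : d % q = d + q := by
          rw [← Int.add_emod_right, Int.emod_eq_of_lt (by omega) (by omega)]
        rw [this]
        simp only [BinOp.eval]
        rw [if_pos (by omega)]
        ring
    simp only [decApprox]
    rw [show decApprox q b t = z from rfl, hmod]
    linarith
  intro t
  induction t with
  | zero =>
    intro ht
    refine step 0 ht ?_
    simp only [decApprox, pow_zero, one_mul, mul_zero, zero_sub, abs_neg]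
    have := abs_nonneg y
    omega
  | succ t ih =>
    intro ht
    refine step (t + 1) ht ?_
    rw [ih (by omega), show 2 * (2 ^ t * y + e t) - 2 ^ (t + 1) * y = 2 * e t by ring, abs_mul]
    have := he t (by omega)
    simp only [Nat.abs_ofNat]
    omega

/-- The last approximation is `2 ^ (m - 1) y + e` with `|e| < q / 8 ≤ 2 ^ m / 8`. The quotient is
its division by `2 ^ (m - 1)` rounded to the nearest integer, written with a floor and without the
exponent `m - 1`. -/
theorem decApprox_round {q m : ℕ} {b e : ℕ → ℤ} {y : ℤ} (hm : 0 < m) (hq : q ≤ 2 ^ m)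
    (hy : 8 * |y| ≤ q) (hb : ∀ t < m, b t ≡ 2 ^ t * y + e t [ZMOD q])
    (he : ∀ t < m, 8 * |e t| < q) :
    (4 * decApprox q b m + (2 ^ m : ℕ)) / (2 * (2 ^ m : ℕ)) = y := by
  obtain ⟨t, rfl⟩ : ∃ t, m = t + 1 := ⟨m - 1, by omega⟩
  rw [decApprox_succ_eq hy hb he t (by omega)]
  have h1 := he t (by omega)
  have h2 : (q : ℤ) ≤ 2 ^ (t + 1) := by exact_mod_cast hq
  have h3 := abs_le.1 (le_refl |e t|)
  push_cast
  rw [Int.ediv_eq_iff_of_pos (by positivity)]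
  constructor <;> rw [pow_succ] at * <;> linarith

/-- One round of the decoder. -/
def decStepCmd : Cmd :=
  .seq (.sumLoop 13 15 (par 2 + .lit (1 : ℕ))
    (.read 2 (.var 15) * .read 3 (.var 15 * par 3 + (par 2 * par 5 + .var 14))))
  (.seq (.assign 22 ((.var 13 - .lit 2 * .var 20) % par 4))
  (.seq (.assign 20 (.lit 2 * .var 20 + .var 22 - par 4 * .bin .le (par 4) (.lit 2 * .var 22)))
    (.assign 21 (.lit (2 : ℕ) * .var 21))))

/-- The decoder. -/
def decodeCmd : Cmd :=
  .seq (.assign 20 (.lit 0)) (.seq (.assign 21 (.lit 1)) (.seq (.forLoop 14 (par 5) decStepCmd)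
    (.assign 8 ((.lit 4 * .var 20 + .var 21) / (.lit 2 * .var 21)))))

theorem decEntry_le {n L : ℕ} (R : RoomFor P n L) (s : Fin (P.g + 1) → ZMod P.q) (X : Ct P)
    (t : ℕ) {m : ℕ} (hm : m ≤ P.g + 1) :
    ∑ i ∈ Finset.range m, (if hi : i < P.g + 1 then (s ⟨i, hi⟩).val else 0) *
      flat X (i * P.h + (P.g * P.len + t)) ≤ 2 ^ L := by
  calc _ ≤ ∑ _i ∈ Finset.range m, P.q * P.q := by
        refine Finset.sum_le_sum fun i _ => Nat.mul_le_mul ?_ (flat_lt _ _).le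
        split_ifs
        · exact (ZMod.val_lt _).le
        · exact Nat.zero_le _
    _ = m * P.q ^ 2 := by simp [sq]
    _ ≤ ((P.g + 1) * P.h) * P.q ^ 2 := by
        exact Nat.mul_le_mul_right _ (hm.trans (Nat.le_mul_of_pos_right _ R.h_pos))
    _ ≤ 2 ^ L := R.prods

theorem decodeCmd_safe {n k L : ℕ} {M : Mem} (R : RoomFor P n L)
    {κ : Ct P × (Fin (P.g + 1) → ZMod P.q)} {X : Ct P} (H : HoldsDecInput M n k κ X) :
    decodeCmd.Safe L M fun M' => M' 8 0 =
      (4 * decApprox P.q (fun t => decEntry κ.2 X t) P.len + (2 ^ P.len : ℕ)) /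
        (2 * (2 ^ P.len : ℕ)) := by
  have hL := R.one_le
  obtain ⟨HP, -, Hs, HX⟩ := H
  set z := decApprox P.q (fun t => decEntry κ.2 X t) with hz
  have hq0 : 0 < P.q := lt_of_lt_of_le (by norm_num) P.two_le_q
  have hzL : ∀ t ≤ P.len, |z t| ≤ 2 ^ L := by
    intro t ht
    refine (abs_decApprox_le hq0 _ t).trans ?_
    have h1 : (2 ^ t * P.q : ℕ) ≤ 2 ^ L := le_trans (le_trans (Nat.mul_le_mul_right _
      (Nat.pow_le_pow_right (by norm_num) ht)) (by nlinarith [Nat.zero_le (2 ^ P.len * P.q)]))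
      R.powers
    have h2 : ((2 : ℤ) ^ t * P.q) ≤ 2 ^ L := by exact_mod_cast h1
    have h3 : (0 : ℤ) ≤ P.q := by positivity
    linarith
  have hpL : ∀ t ≤ P.len, 2 ^ t ≤ 2 ^ L := fun t ht =>
    Nat.pow_le_pow_right (by norm_num) (ht.trans R.len_le)
  refine Cmd.Safe.seq (Cmd.Safe.assignVal hL (.lit 0) ?_)
  refine Cmd.Safe.seq (Cmd.Safe.assignVal hL (.lit 1) ?_)
  set M₀ := (M.store 20 0 0).store 21 0 1 with hM₀
  have hs₀ : SameOff [13, 14, 15, 20, 21, 22] M (M₀.store 14 0 0) :=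
    (((SameOff.refl _ M).store (by decide)).store (by decide)).store (by decide)
  have he := (HP.congr (hs₀ 0 (by decide))).val_len R
  refine Cmd.Safe.seq (Cmd.Safe.forLoop hL R.len_le he.1 he.2
    (fun t M' => SameOff [13, 14, 15, 20, 21, 22] M M' ∧ M' 20 0 = z t ∧ M' 21 0 = (2 ^ t : ℕ))
    ⟨hs₀, ?_, ?_⟩ ?_ ?_)
  · rw [hM₀, Mem.store_of_ne _ _ _ (by decide), Mem.store_of_ne _ _ _ (by decide)]
    simp [hz, decApprox]
  · rw [hM₀, Mem.store_of_ne _ _ _ (by decide)]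
    simp
  · rintro t ht M' hv ⟨hs, h20, h21⟩
    refine Cmd.Safe.seq (Cmd.Safe.sumLoop (m := P.g + 1) (by decide) hL R.g_le
      (fun M'' hM'' => ?_) (fun i => ((if hi : i < P.g + 1 then (κ.2 ⟨i, hi⟩).val else 0) *
        flat X (i * P.h + (P.g * P.len + t)) : ℕ))
      (fun m hm => ?_) (fun i hi M'' hM'' hv' => ?_) fun M'' hM'' hacc => ?_)
    · have H' := (HP.congr (hs 0 (by decide))).congr (hM'' 0 (by decide))
      exact (H'.val_g R).addNat (.natLit 1)
    · rw [← Nat.cast_sum, Nat.abs_cast]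
      exact_mod_cast decEntry_le R κ.2 X t hm
    · have H' := (HP.congr (hs 0 (by decide))).congr (hM'' 0 (by decide))
      have hi' : HasVal L M'' (.var 15) i := .varNat hv' (le_two_pow_of_le (hi.le.trans R.g_le))
      have ht' : HasVal L M'' (.var 14) t :=
        .varNat (by rw [hM'' 14 (by decide), hv]) (le_two_pow_of_le (ht.le.trans R.len_le))
      have hcol : P.g * P.len + t < P.h :=
        lt_of_lt_of_le (by rw [add_mul, one_mul]; omega) R.width
      refine HasVal.mulNat (HasVal.readNat hi' ?_ ?_) (HasVal.readNat ((hi'.mulNat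
        (H'.val_h R)).addNat (((H'.val_g R).mulNat (H'.val_len R)).addNat ht')) ?_
        (abs_flat_le R _ _))
      · rw [hM'' 2 (by decide), hs 2 (by decide), dif_pos hi]
        exact Hs ⟨i, hi⟩
      · rw [dif_pos hi]
        exact (ZMod.val_lt _).le.trans R.q_le
      · rw [hM'' 3 (by decide), hs 3 (by decide)]
        simpa using holdsMat_iff.1 HX _ (mul_add_lt hi hcol)
    · have H' := (HP.congr (hs 0 (by decide))).congr (hM'' 0 (by decide))
      have hs'' : SameOff [13, 14, 15, 20, 21, 22] M M'' := hs.trans (hM''.mono (by decide))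
      have hb : HasVal L M'' (.var 13) (decEntry κ.2 X t) := by
        refine .varNat ?_ (decEntry_le R κ.2 X t le_rfl)
        rw [hacc, decEntry, Nat.cast_sum]
      have hz20 : M'' 20 0 = z t := by rw [hM'' 20 (by decide), h20]
      refine Cmd.Safe.seq (Cmd.Safe.assignVal hL
        ((hb.sub ((HasVal.lit 2).mul (.var hz20 (hzL t ht.le)))).mod (H'.val_q R)) ?_)
      set D : ℤ := ((decEntry κ.2 X t : ℕ) - 2 * z t) % P.q with hD
      set M₁ := M''.store 22 0 D with hM₁
      have hs₁ : SameOff [13, 14, 15, 20, 21, 22] M M₁ := hs''.store (by decide)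
      have H₁ := HP.congr (hs₁ 0 (by decide))
      have hDL : |D| ≤ 2 ^ L := by
        have hq' : (0 : ℤ) < P.q := by exact_mod_cast hq0
        rw [abs_of_nonneg (Int.emod_nonneg _ hq'.ne')]
        exact (Int.emod_lt_of_pos _ hq').le.trans (by exact_mod_cast R.q_le)
      have h22 : HasVal L M₁ (.var 22) D := .var (by simp [hM₁]) hDL
      have h20₁ : HasVal L M₁ (.var 20) (z t) :=
        .var (by rw [hM₁, Mem.store_of_ne _ _ _ (by decide), hz20]) (hzL t ht.le)
      refine Cmd.Safe.seq (Cmd.Safe.assignVal hL ((((HasVal.lit 2).mul h20₁).add h22).sub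
        ((H₁.val_q R).mul ((H₁.val_q R).bin .le ((HasVal.lit 2).mul h22)))) ?_)
      set M₂ := M₁.store 20 0 _ with hM₂
      have h21₂ : HasVal L M₂ (.var 21) (2 ^ t : ℕ) := by
        refine .varNat ?_ (hpL t ht.le)
        rw [hM₂, Mem.store_of_ne _ _ _ (by decide), hM₁, Mem.store_of_ne _ _ _ (by decide),
          hM'' 21 (by decide), h21]
      refine Cmd.Safe.assignVal hL ((HasVal.natLit 2).mulNat h21₂) ⟨?_, ?_, ?_, ?_⟩
      · rw [Mem.store_of_ne _ _ _ (by decide), hM₂, Mem.store_of_ne _ _ _ (by decide), hM₁,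
          Mem.store_of_ne _ _ _ (by decide), hM'' 14 (by decide), hv]
      · exact ((hs₁.store (by decide)).store (by decide)).store (by decide)
      · rw [Mem.store_of_ne _ _ _ (by decide), Mem.store_of_ne _ _ _ (by decide), hM₂,
          Mem.store_same, hz, decApprox]
      · rw [Mem.store_of_ne _ _ _ (by decide), Mem.store_same, pow_succ, mul_comm]
  · rintro M' ⟨hs, h20, h21⟩
    have h20' : HasVal L M' (.var 20) (z P.len) := .var h20 (hzL _ le_rfl)
    have h21' : HasVal L M' (.var 21) (2 ^ P.len : ℕ) := .varNat h21 (hpL _ le_rfl)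
    exact Cmd.Safe.assignVal hL ((((HasVal.lit 4).mul h20').add h21').div
      ((HasVal.lit 2).mul h21')) (by simp)

theorem cast_decEntry (s : Fin (P.g + 1) → ZMod P.q) (X : Ct P) {t : ℕ}
    (hcol : P.g * P.len + t < P.h) :
    ((decEntry s X t : ℕ) : ZMod P.q) = Matrix.vecMul s X ⟨P.g * P.len + t, hcol⟩ := by
  rw [decEntry, Matrix.vecMul, dotProduct, Nat.cast_sum,
    ← Fin.sum_univ_eq_sum_range (fun i => (((if hi : i < P.g + 1 then (s ⟨i, hi⟩).val else 0) *
    flat X (i * P.h + (P.g * P.len + t)) : ℕ) : ZMod P.q))]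
  refine Finset.sum_congr rfl fun i _ => ?_
  have h := flat_mul_add X i ⟨P.g * P.len + t, hcol⟩
  simp only at h
  rw [dif_pos i.2, h, Nat.cast_mul, ZMod.natCast_zmod_val, ZMod.natCast_zmod_val]

end GSWStream

/-! ### Noise growth and correctness of decoding. -/

namespace GSWStream

variable {P : Params}

/-! ### Noise of ciphertexts -/

theorem sum_range_mul_eq {α : Type*} [AddCommMonoid α] (f : ℕ → α) (a b : ℕ) :
    ∑ t ∈ Finset.range (a * b), f t =
      ∑ i ∈ Finset.range a, ∑ u ∈ Finset.range b, f (i * b + u) := by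
  induction a with
  | zero => simp
  | succ a ih => rw [add_mul, one_mul, Finset.sum_range_add, ih, Finset.sum_range_succ]

theorem sum_two_pow_mul_bit (x m : ℕ) :
    ∑ u ∈ Finset.range m, 2 ^ u * (x / 2 ^ u % 2) = x % 2 ^ m := by
  induction m with
  | zero => simp [Nat.mod_one]
  | succ m ih => rw [Finset.sum_range_succ, ih, Nat.mod_pow_succ]

/-- Row `i` of the gadget matrix is supported on block `i`, where it reassembles entry `(i, j)` from
its bits. No bit is lost, since entries are below `q ≤ 2 ^ len`. -/
theorem gadget_mul_gadgetInv (hw : (P.g + 1) * P.len ≤ P.h) (Y : Ct P) :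
    gadget P * gadgetInv P Y = Y := by
  ext i j
  rw [mul_gadgetInv_apply hw, sum_range_mul_eq, Finset.sum_eq_single (i : ℕ)]
  · have h : ∀ u ∈ Finset.range P.len, mulTerm (gadget P) Y i j (i * P.len + u) =
        2 ^ u * ((Y i j).val / 2 ^ u % 2) := by
      intro u hu
      have hu' : u < P.len := Finset.mem_range.1 hu
      have h1 : (i * P.len + u) / P.len = i := by
        rw [mul_comm, Nat.mul_add_div P.len_pos, Nat.div_eq_of_lt hu', add_zero]
      have h2 : (i * P.len + u) % P.len = u := by
        rw [mul_comm, Nat.mul_add_mod, Nat.mod_eq_of_lt hu']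
      have h3 : i * P.len + u < P.h := (mul_add_lt i.2 hu').trans_le hw
      have h4 := flat_mul_add (gadget P) i ⟨_, h3⟩
      simp only at h4
      have h5 := ZMod.val_cast_of_lt (two_pow_lt_q hu')
      push_cast at h5
      rw [mulTerm, h1, h2, flat_mul_add, h4]
      simp only [gadget, Matrix.of_apply, h1, h2, if_true, h5]
    rw [Finset.sum_congr rfl h, sum_two_pow_mul_bit,
      Nat.mod_eq_of_lt ((ZMod.val_lt _).trans_le P.q_le), ZMod.natCast_zmod_val]
  · intro a ha hai
    refine Finset.sum_eq_zero fun u hu => ?_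
    have hu' : u < P.len := Finset.mem_range.1 hu
    have h1 : (a * P.len + u) / P.len = a := by
      rw [mul_comm, Nat.mul_add_div P.len_pos, Nat.div_eq_of_lt hu', add_zero]
    have h3 : a * P.len + u < P.h := (mul_add_lt (Finset.mem_range.1 ha) hu').trans_le hw
    have h4 := flat_mul_add (gadget P) i ⟨_, h3⟩
    simp only at h4
    rw [mulTerm, h4]
    simp [gadget, h1, hai]
  · intro h
    exact absurd (Finset.mem_range.2 i.2) h

/-- A Boolean matrix as a matrix over `ℤ_q`. -/
abbrev boolMat (R : Matrix (Fin P.h) (Fin P.h) Bool) : Matrix (Fin P.h) (Fin P.h) (ZMod P.q) :=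
  R.map fun b => if b then (1 : ZMod P.q) else 0

theorem gadgetInv_eq_boolMat (Y : Ct P) : ∃ R, gadgetInv P Y = boolMat R := by
  refine ⟨Matrix.of fun t j => if ht : (t : ℕ) / P.len < P.g + 1 then
    (Y ⟨(t : ℕ) / P.len, ht⟩ j).val.testBit ((t : ℕ) % P.len) else false, ?_⟩
  ext t j
  simp only [gadgetInv, boolMat, Matrix.map_apply, Matrix.of_apply]
  split_ifs <;> simp_all

/-- `v` is the reduction of an integer vector with entries bounded by `E`. -/
def SmallVec (E : ℝ) (v : Fin P.h → ZMod P.q) : Prop :=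
  ∃ e : Fin P.h → ℤ, (∀ j, |(e j : ℝ)| ≤ E) ∧ v = fun j => (e j : ZMod P.q)

theorem SmallVec.zero : SmallVec 0 (0 : Fin P.h → ZMod P.q) :=
  ⟨0, by simp, by ext; simp⟩

theorem SmallVec.mono {E E' : ℝ} {v : Fin P.h → ZMod P.q} (h : SmallVec E v) (hE : E ≤ E') :
    SmallVec E' v := by
  obtain ⟨e, he, rfl⟩ := h
  exact ⟨e, fun j => (he j).trans hE, rfl⟩

theorem SmallVec.add {E E' : ℝ} {v w : Fin P.h → ZMod P.q} (h : SmallVec E v)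
    (h' : SmallVec E' w) : SmallVec (E + E') (v + w) := by
  obtain ⟨e, he, rfl⟩ := h
  obtain ⟨e', he', rfl⟩ := h'
  refine ⟨e + e', fun j => ?_, by ext; simp⟩
  push_cast [Pi.add_apply]
  exact (abs_add_le _ _).trans (add_le_add (he j) (he' j))

theorem SmallVec.zsmul {E X : ℝ} {v : Fin P.h → ZMod P.q} (h : SmallVec E v) {z : ℤ}
    (hz : |(z : ℝ)| ≤ X) : SmallVec (X * E) (z • v) := by
  obtain ⟨e, he, rfl⟩ := h
  refine ⟨z • e, fun j => ?_, by ext; simp⟩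
  simp only [Pi.smul_apply, smul_eq_mul, Int.cast_mul, abs_mul]
  exact mul_le_mul hz (he j) (abs_nonneg _) ((abs_nonneg _).trans hz)

theorem SmallVec.neg {E : ℝ} {v : Fin P.h → ZMod P.q} (h : SmallVec E v) : SmallVec E (-v) := by
  simpa using h.zsmul (z := -1) (X := 1) (by simp)

theorem SmallVec.sum {K : ℕ} {E : ℝ} {v : Fin K → Fin P.h → ZMod P.q}
    (h : ∀ i, SmallVec E (v i)) : SmallVec (K * E) (∑ i, v i) := by
  induction K with
  | zero => simpa using SmallVec.zero
  | succ K ih =>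
    rw [Fin.sum_univ_succ, Nat.cast_succ, add_mul, one_mul, add_comm ((K : ℝ) * E)]
    exact (h 0).add (ih fun i => h i.succ)

theorem SmallVec.vecMul {E : ℝ} {v : Fin P.h → ZMod P.q} (h : SmallVec E v)
    (R : Matrix (Fin P.h) (Fin P.h) Bool) : SmallVec (P.h * E) (Matrix.vecMul v (boolMat R)) := by
  obtain ⟨e, he, rfl⟩ := h
  refine ⟨fun j => ∑ t, e t * if R t j then 1 else 0, fun j => ?_, ?_⟩
  · push_cast
    calc |∑ t, (e t : ℝ) * if R t j then 1 else 0| ≤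
        ∑ t, |(e t : ℝ) * if R t j then 1 else 0| := Finset.abs_sum_le_sum_abs _ _
      _ ≤ ∑ _t : Fin P.h, E := by
          refine Finset.sum_le_sum fun t _ => ?_
          split_ifs
          · simpa using he t
          · simpa using (abs_nonneg _).trans (he t)
      _ = P.h * E := by simp
  · ext j
    simp [Matrix.vecMul, dotProduct]

/-- Under the key `s`, the matrix `X` encrypts `μ` with noise bounded by `E`. -/
def Encrypts (s : Fin (P.g + 1) → ZMod P.q) (E : ℝ) (μ : Bool) (X : Ct P) : Prop :=
  ∃ v, SmallVec E v ∧ Matrix.vecMul s X = (if μ then Matrix.vecMul s (gadget P) else 0) + v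

variable {s : Fin (P.g + 1) → ZMod P.q} {pk : Ct P} {B : ℝ}

theorem Encrypts.enc (hpk : SmallVec B (Matrix.vecMul s pk)) (μ : Bool)
    (R : Matrix (Fin P.h) (Fin P.h) Bool) : Encrypts s (P.h * B) μ (enc P pk μ R) := by
  refine ⟨Matrix.vecMul (Matrix.vecMul s pk) (boolMat R), hpk.vecMul R, ?_⟩
  rw [GSWStream.enc, Matrix.vecMul_add, Matrix.vecMul_vecMul, add_comm]
  cases μ <;> simp

/-- If `s X = μ s G + v`, then `s X G⁻¹(Y) = μ s Y + v G⁻¹(Y)`. The noise of `X` is multiplied by a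
0/1 matrix, costing a factor `h`. That of `Y` enters with coefficient 0 or 1, also in `Y - X
G⁻¹(Y)`, where the multiples of `s Y` combine before noise is counted. -/
theorem Encrypts.pointStep (hw : (P.g + 1) * P.len ≤ P.h) {E E' : ℝ} {μ ν : Bool} {X Y : Ct P}
    (hX : Encrypts s E μ X) (hY : Encrypts s E' ν Y) (hE' : 0 ≤ E') (b : Bool) :
    Encrypts s (E' + P.h * E) ((μ == b) && ν)
      (if b then X * gadgetInv P Y else Y - X * gadgetInv P Y) := by
  obtain ⟨v, hv, hXv⟩ := hX
  obtain ⟨w, hw', hYw⟩ := hY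
  obtain ⟨R, hR⟩ := gadgetInv_eq_boolMat Y
  have hprod : Matrix.vecMul s (X * gadgetInv P Y) =
      (if μ then Matrix.vecMul s Y else 0) + Matrix.vecMul v (boolMat R) := by
    rw [← Matrix.vecMul_vecMul, hXv, Matrix.add_vecMul, hR]
    congr 1
    cases μ
    · simp
    · rw [← hR]
      simp only [if_true]
      rw [Matrix.vecMul_vecMul, gadget_mul_gadgetInv hw]
  have hs := hv.vecMul R
  have h0 : SmallVec (E' + P.h * E) (Matrix.vecMul v (boolMat R)) := hs.mono (by linarith)
  cases b
  · cases μ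
    · refine ⟨w - Matrix.vecMul v (boolMat R), ?_, ?_⟩
      · rw [sub_eq_add_neg]
        exact hw'.add hs.neg
      · simp only [Bool.false_eq_true, if_false, Matrix.vecMul_sub, hprod, hYw]
        cases ν <;> simp [add_sub_assoc]
    · refine ⟨-Matrix.vecMul v (boolMat R), h0.neg, ?_⟩
      simp [Matrix.vecMul_sub, hprod]
  · cases μ
    · exact ⟨_, h0, by simp [hprod]⟩
    · refine ⟨w + Matrix.vecMul v (boolMat R), hw'.add hs, ?_⟩
      simp only [if_true, hprod, hYw]
      cases ν <;> simp [add_assoc]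

/-- The left factor of every product is a fresh ciphertext, so each input bit adds the same amount
of noise. The gadget matrix, the constant 1 at the start, has none. -/
theorem Encrypts.pointGen (hw : (P.g + 1) * P.len ≤ P.h) {E : ℝ} (hE : 0 ≤ E) {l : ℕ}
    {b : Fin l → Bool} {cts : Fin l → Ct P} (h : ∀ j, Encrypts s E (b j) (cts j)) (i : ℕ) {j : ℕ}
    (hj : j ≤ l) : Encrypts s (j * (P.h * E))
      (pointWire false (fun op a b => op a b) i (List.ofFn b) j) (pointGen i cts j) := by
  induction j with
  | zero =>
    rw [pointGen_zero]
    exact ⟨0, by simpa using SmallVec.zero, by simp [pointWire]⟩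
  | succ j ih =>
    have hj' : j < l := hj
    rw [pointGen_succ i cts hj']
    have hb : (List.ofFn b).getD j false = b ⟨j, hj'⟩ := by simp [List.getD, hj']
    simp only [pointWire, hb]
    have h1 := Encrypts.pointStep hw (h ⟨j, hj'⟩) (ih hj'.le) (by positivity) (i.testBit j)
    rw [Nat.cast_succ, add_mul, one_mul]
    exact h1

/-- The bound `l h ^ 2 B` of an evaluated ciphertext also covers the bound `h B` of a fresh one,
since `l` and `h` are at least 1. -/
theorem Encrypts.of_isCiphertext (hw : (P.g + 1) * P.len ≤ P.h) (hh : 0 < P.h) {n : ℕ}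
    (hn : 2 ≤ n) (hB : 0 ≤ B) (hpk : SmallVec B (Matrix.vecMul s pk)) {μ : Bool} {ct : Ct P}
    (h : IsCiphertext P n pk μ ct) : Encrypts s (Nat.clog 2 n * (P.h ^ 2 * B)) μ ct := by
  rcases h with ⟨R, rfl⟩ | ⟨i, b, R, rfl, rfl⟩
  · obtain ⟨v, hv, hx⟩ := Encrypts.enc hpk μ R
    refine ⟨v, hv.mono ?_, hx⟩
    have h1 : (1 : ℝ) ≤ Nat.clog 2 n := by exact_mod_cast Nat.clog_pos (by norm_num) hn
    have h2 : (1 : ℝ) ≤ P.h := by exact_mod_cast hh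
    have h3 : (0 : ℝ) ≤ P.h * B := by positivity
    nlinarith [mul_nonneg h3 (sub_nonneg.2 h2), mul_nonneg (mul_nonneg h3 (by positivity :
      (0 : ℝ) ≤ P.h)) (sub_nonneg.2 h1)]
  · have h1 := Encrypts.pointGen hw (by positivity) (fun j => Encrypts.enc hpk (b j) (R j)) i
      (le_refl (Nat.clog 2 n))
    have h2 := run_pointCircuit false (fun op a b => op a b) i (List.ofFn b)
    rw [List.length_ofFn] at h2
    rw [evalCt_pointCircuit, Circuit.eval, h2]
    convert h1 using 2
    ring

/-- Only the last row of the gadget matrix meets the last block, and the last coordinate of the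
secret key is 1. -/
theorem vecMul_gadget_last (hs : s (Fin.last P.g) = 1) {t : ℕ} (ht : t < P.len)
    (hcol : P.g * P.len + t < P.h) :
    Matrix.vecMul s (gadget P) ⟨P.g * P.len + t, hcol⟩ = 2 ^ t := by
  have h1 : (P.g * P.len + t) / P.len = P.g := by
    rw [mul_comm, Nat.mul_add_div P.len_pos, Nat.div_eq_of_lt ht, add_zero]
  have h2 : (P.g * P.len + t) % P.len = t := by
    rw [mul_comm, Nat.mul_add_mod, Nat.mod_eq_of_lt ht]
  rw [Matrix.vecMul, dotProduct, Finset.sum_eq_single (Fin.last P.g)]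
  · simp [gadget, h1, h2, hs]
  · intro i _ hi
    have : P.g ≠ i := fun h => hi (Fin.ext (by simp [h]))
    simp [gadget, h1, this]
  · simp

/-- The relation `s X = μ s G + v` is linear, so the combination satisfies it with the integer `y`
in place of `μ`. The last gadget block supplies the residues of `2 ^ t y + e_t`, and the hypothesis
on `q` makes both `y` and `e_t` small enough for rounding. -/
theorem decode_correct {n L K Xmax : ℕ} (R : RoomFor P n L) (hn : 2 ≤ n) (hB : 0 ≤ B)
    (hs : s (Fin.last P.g) = 1) (hpk : SmallVec B (Matrix.vecMul s pk)) {x : Fin K → ℤ}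
    {μ : Fin K → Bool} {ct : Fin K → Ct P} (hct : ∀ i, IsCiphertext P n pk (μ i) (ct i))
    (hx : ∀ i, |x i| ≤ (Xmax : ℤ))
    (hq : 8 * ((K : ℝ) * Xmax) * Nat.clog 2 n * P.h ^ 2 * (B + 1) ≤ P.q) :
    (4 * decApprox P.q (fun t => decEntry s (∑ i, x i • ct i) t) P.len + (2 ^ P.len : ℕ)) /
        (2 * (2 ^ P.len : ℕ)) = ∑ i, x i * if μ i then 1 else 0 := by
  set y : ℤ := ∑ i, x i * if μ i then 1 else 0 with hy
  have hx' : ∀ i, |(x i : ℝ)| ≤ Xmax := fun i => by exact_mod_cast hx i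
  choose v hv hvec using fun i =>
    Encrypts.of_isCiphertext R.width R.h_pos hn hB hpk (hct i)
  have hsum : Matrix.vecMul s (∑ i, x i • ct i) =
      y • Matrix.vecMul s (gadget P) + ∑ i, x i • v i := by
    rw [Matrix.vecMul_sum, hy, Finset.sum_smul, ← Finset.sum_add_distrib]
    refine Finset.sum_congr rfl fun i _ => ?_
    rw [Matrix.vecMul_smul, hvec]
    cases μ i <;> simp
  have hE := SmallVec.sum fun i => (hv i).zsmul (hx' i)
  obtain ⟨e, he, hev⟩ := hE
  have hl1 : (1 : ℝ) ≤ Nat.clog 2 n := by exact_mod_cast Nat.clog_pos (by norm_num) hn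
  have hh1 : (1 : ℝ) ≤ P.h := by exact_mod_cast R.h_pos
  have hq0 : (0 : ℝ) < P.q := by
    have := P.two_le_q
    exact_mod_cast (by omega : 0 < P.q)
  have hKX : (0 : ℝ) ≤ (K : ℝ) * Xmax := by positivity
  have hwidth : ∀ t < P.len, P.g * P.len + t < P.h := fun t ht =>
    lt_of_lt_of_le (by rw [add_mul, one_mul]; omega) R.width
  refine decApprox_round (e := fun t => if ht : t < P.len then e ⟨P.g * P.len + t, hwidth t ht⟩
    else 0) P.len_pos P.q_le ?_ (fun t ht => ?_) fun t ht => ?_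
  · have h1 : |(y : ℝ)| ≤ K * Xmax := by
      rw [hy]
      push_cast
      calc |∑ i, (x i : ℝ) * if μ i then 1 else 0| ≤ ∑ i, |(x i : ℝ) * if μ i then 1 else 0| :=
            Finset.abs_sum_le_sum_abs _ _
        _ ≤ ∑ _i : Fin K, (Xmax : ℝ) := by
            refine Finset.sum_le_sum fun i _ => ?_
            split_ifs
            · simpa using hx' i
            · simp
        _ = K * Xmax := by simp
    -- The summand 1 in `B + 1` is needed here: for tiny `B` the noise term alone would not control
    -- `y`.
    have h2 : (1 : ℝ) ≤ Nat.clog 2 n * P.h ^ 2 * (B + 1) :=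
      one_le_mul_of_one_le_of_one_le (one_le_mul_of_one_le_of_one_le hl1 (one_le_pow₀ hh1))
        (by linarith)
    have h3 : 8 * |(y : ℝ)| ≤ P.q := by nlinarith
    exact_mod_cast h3
  · rw [← ZMod.intCast_eq_intCast_iff, dif_pos ht]
    push_cast
    rw [cast_decEntry s _ (hwidth t ht), hsum, hev]
    rw [Pi.add_apply, Pi.smul_apply, vecMul_gadget_last hs ht (hwidth t ht), zsmul_eq_mul]
    ring
  · rw [dif_pos ht]
    have h1 := he ⟨P.g * P.len + t, hwidth t ht⟩
    have h2 : 8 * |(e ⟨P.g * P.len + t, hwidth t ht⟩ : ℝ)| < P.q := by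
      -- The strict inequality comes from the summand 1 in `B + 1`, or, if `K * Xmax = 0`, from the
      -- noise being zero and `q` positive.
      rcases hKX.eq_or_lt with h0 | h0
      · have : (K : ℝ) * (Xmax * (Nat.clog 2 n * (P.h ^ 2 * B))) = 0 := by
          rw [← mul_assoc, ← h0, zero_mul]
        linarith
      · have h3 : 0 < (K : ℝ) * Xmax * Nat.clog 2 n * P.h ^ 2 := by positivity
        nlinarith
    exact_mod_cast h2

end GSWStream

/-! ### The Gaussian tail and the probability of a key with small noise. -/

namespace GSWStream

/-! ### Tail of the discrete Gaussian -/

theorem summable_exp_neg_pi_mul_sq {a : ℝ} (ha : 0 < a) :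
    Summable fun x : ℤ => Real.exp (-Real.pi * a * (x : ℝ) ^ 2) := by
  have h := summable_pow_mul_jacobiTheta₂_term_bound 0 ha 0
  refine h.congr fun x => ?_
  simp only [pow_zero, one_mul, Int.cast_abs]
  congr 1
  ring

/-- Poisson summation turns both sides into dual sums. The prefactors differ by `√2`, and the dual
sum grows with `a` because its exponents `-π x ^ 2 / a` do. -/
theorem tsum_exp_neg_half_le {a : ℝ} (ha : 0 < a) :
    ∑' x : ℤ, Real.exp (-Real.pi * (a / 2) * (x : ℝ) ^ 2) ≤
      Real.sqrt 2 * ∑' x : ℤ, Real.exp (-Real.pi * a * (x : ℝ) ^ 2) := by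
  have ha2 : 0 < a / 2 := by positivity
  rw [Real.tsum_exp_neg_mul_int_sq ha2, Real.tsum_exp_neg_mul_int_sq ha, ← mul_assoc]
  have h1 : 1 / (a / 2) ^ (1 / 2 : ℝ) = Real.sqrt 2 * (1 / a ^ (1 / 2 : ℝ)) := by
    rw [← Real.sqrt_eq_rpow, ← Real.sqrt_eq_rpow, Real.sqrt_div ha.le]
    field_simp
  rw [h1]
  refine mul_le_mul_of_nonneg_left ?_ (by positivity)
  have e : ∀ b : ℝ, (fun x : ℤ => Real.exp (-Real.pi / b * (x : ℝ) ^ 2)) =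
      fun x : ℤ => Real.exp (-Real.pi * (1 / b) * (x : ℝ) ^ 2) := by
    intro b
    ext x
    congr 1
    ring
  rw [e, e]
  refine (summable_exp_neg_pi_mul_sq (by positivity)).tsum_le_tsum (fun x => ?_)
    (summable_exp_neg_pi_mul_sq (by positivity))
  apply Real.exp_le_exp.2
  have h2 : 1 / a ≤ 1 / (a / 2) := one_div_le_one_div_of_le ha2 (by linarith)
  have h3 := mul_nonneg (mul_nonneg Real.pi_pos.le (sub_nonneg.2 h2)) (sq_nonneg (x : ℝ))
  nlinarith

theorem gaussWeight_eq (σ : ℝ) (x : ℤ) :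
    gaussWeight σ x = ENNReal.ofReal (Real.exp (-Real.pi * (1 / σ ^ 2) * (x : ℝ) ^ 2)) := by
  rw [gaussWeight]
  congr 2
  ring

/-- For `|x| > σ t` half of the exponent is given away for the factor `exp (-π t ^ 2 / 2)`. The
remaining weights form a Gaussian sum with halved exponent, at most `√2` times the normalisation. No
lower bound on `σ` is needed. -/
theorem discreteGaussian_tail (σ : ℝ) (hσ : 0 < σ) {t : ℝ} (ht : 0 ≤ t) :
    (discreteGaussian σ hσ).toOuterMeasure {x : ℤ | σ * t < |(x : ℝ)|} ≤
      ENNReal.ofReal (Real.sqrt 2 * Real.exp (-Real.pi * t ^ 2 / 2)) := by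
  set a := 1 / σ ^ 2 with ha
  have ha0 : 0 < a := by positivity
  rw [PMF.toOuterMeasure_apply]
  have h1 : ∀ x, Set.indicator {x : ℤ | σ * t < |(x : ℝ)|} (discreteGaussian σ hσ) x ≤
      ENNReal.ofReal (Real.exp (-Real.pi * t ^ 2 / 2) *
        Real.exp (-Real.pi * (a / 2) * (x : ℝ) ^ 2)) * (∑' x, gaussWeight σ x)⁻¹ := by
    intro x
    by_cases hx : σ * t < |(x : ℝ)|
    · rw [Set.indicator_of_mem (by exact hx), discreteGaussian, PMF.normalize_apply, gaussWeight_eq]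
      gcongr
      rw [← Real.exp_add, Real.exp_le_exp]
      have h2 : (σ * t) ^ 2 ≤ (x : ℝ) ^ 2 := by
        rw [← sq_abs (x : ℝ)]
        exact pow_le_pow_left₀ (by positivity) hx.le 2
      have h3 : t ^ 2 ≤ a * (x : ℝ) ^ 2 := by
        rw [ha, div_mul_eq_mul_div, one_mul, le_div_iff₀ (by positivity)]
        linarith [mul_pow σ t 2]
      nlinarith [Real.pi_pos, mul_nonneg Real.pi_pos.le (sub_nonneg.2 h3)]
    · rw [Set.indicator_of_notMem (by exact hx)]
      exact zero_le
  refine (ENNReal.tsum_le_tsum h1).trans ?_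
  have hs : Summable fun x : ℤ => Real.exp (-Real.pi * t ^ 2 / 2) *
      Real.exp (-Real.pi * (a / 2) * (x : ℝ) ^ 2) :=
    (summable_exp_neg_pi_mul_sq (by positivity)).mul_left _
  rw [ENNReal.tsum_mul_right, ← ENNReal.ofReal_tsum_of_nonneg (fun x => by positivity) hs,
    tsum_mul_left]
  have hW : ∑' x, gaussWeight σ x =
      ENNReal.ofReal (∑' x : ℤ, Real.exp (-Real.pi * a * (x : ℝ) ^ 2)) := by
    rw [ENNReal.ofReal_tsum_of_nonneg (fun x => by positivity) (summable_exp_neg_pi_mul_sq ha0)]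
    exact tsum_congr fun x => gaussWeight_eq σ x
  have h0 := gaussWeight_tsum_ne_zero σ
  have htop := gaussWeight_tsum_ne_top hσ
  rw [← div_eq_mul_inv]
  refine ENNReal.div_le_of_le_mul ?_
  rw [hW, ← ENNReal.ofReal_mul (by positivity)]
  apply ENNReal.ofReal_le_ofReal
  calc _ ≤ Real.exp (-Real.pi * t ^ 2 / 2) *
        (Real.sqrt 2 * ∑' x : ℤ, Real.exp (-Real.pi * a * (x : ℝ) ^ 2)) := by
        gcongr
        exact tsum_exp_neg_half_le ha0
    _ = _ := by ring

/-! ### Probability of good keys -/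

theorem toOuterMeasure_le_one {α : Type*} (p : PMF α) (S : Set α) : p.toOuterMeasure S ≤ 1 := by
  rw [← (p.toOuterMeasure_apply_eq_one_iff _).2 (Set.subset_univ p.support)]
  exact p.toOuterMeasure.mono (Set.subset_univ S)

/-- Union bound, one coordinate at a time. -/
theorem toOuterMeasure_iid_exists_le {α : Type} (p : PMF α) (S : Set α) (m : ℕ) :
    (iid p m).toOuterMeasure {v | ∃ j, v j ∈ S} ≤ m * p.toOuterMeasure S := by
  induction m with
  | zero =>
    have : {v : Fin 0 → α | ∃ j, v j ∈ S} = ∅ := by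
      ext v
      simp
    rw [this]
    simp
  | succ m ih =>
    rw [iid, PMF.toOuterMeasure_bind_apply]
    have h1 : ∀ a, p a * ((iid p m).map (Fin.cons (α := fun _ => α) a)).toOuterMeasure
        {v | ∃ j, v j ∈ S} ≤ S.indicator p a + p a * (m * p.toOuterMeasure S) := by
      intro a
      rw [PMF.toOuterMeasure_map_apply]
      by_cases ha : a ∈ S
      · rw [Set.indicator_of_mem ha]
        refine le_add_right ?_
        calc p a * _ ≤ p a * 1 := by
              gcongr
              exact toOuterMeasure_le_one _ _
          _ = p a := mul_one _
      · rw [Set.indicator_of_notMem ha, zero_add]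
        gcongr
        refine le_trans ((iid p m).toOuterMeasure.mono ?_) ih
        rintro v ⟨j, hj⟩
        refine Fin.cases (fun h => absurd h ha) (fun i h => ⟨i, h⟩) j hj
    refine (ENNReal.tsum_le_tsum h1).trans ?_
    rw [ENNReal.tsum_add, ENNReal.tsum_mul_right, p.tsum_coe, ← PMF.toOuterMeasure_apply]
    push_cast
    rw [one_mul, add_mul, one_mul, add_comm]

theorem one_sub_le_toOuterMeasure {α : Type*} (p : PMF α) {S : Set α} {ε : ENNReal}
    (h : p.toOuterMeasure Sᶜ ≤ ε) : 1 - ε ≤ p.toOuterMeasure S := by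
  rw [tsub_le_iff_right]
  have h1 : p.toOuterMeasure (S ∪ Sᶜ) = 1 := by
    rw [Set.union_compl_self, PMF.toOuterMeasure_apply_eq_one_iff]
    exact Set.subset_univ _
  calc 1 = p.toOuterMeasure (S ∪ Sᶜ) := h1.symm
    _ ≤ p.toOuterMeasure S + p.toOuterMeasure Sᶜ := MeasureTheory.measure_union_le _ _
    _ ≤ _ := by gcongr

theorem le_toOuterMeasure_bind {α β : Type*} (p : PMF α) (f : α → PMF β) {S : Set β} {c : ENNReal}
    (h : ∀ a, c ≤ (f a).toOuterMeasure S) : c ≤ (p.bind f).toOuterMeasure S := by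
  rw [PMF.toOuterMeasure_bind_apply]
  calc c = ∑' a, p a * c := by rw [ENNReal.tsum_mul_right, p.tsum_coe, one_mul]
    _ ≤ _ := ENNReal.tsum_le_tsum fun a => by gcongr; exact h a

variable {P : Params}

/-- The secret key cancels the LWE part of the last row, so exactly the noise vector remains. -/
theorem vecMul_snoc (s : Fin P.g → ZMod P.q) (A : Matrix (Fin P.g) (Fin P.h) (ZMod P.q))
    (e : Fin P.h → ZMod P.q) :
    Matrix.vecMul (Fin.snoc (α := fun _ => ZMod P.q) (-s) 1)
      (Fin.snoc (α := fun _ => Fin P.h → ZMod P.q) A (Matrix.vecMul s A + e) : Ct P) = e := by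
  ext j
  have h1 : ∀ i : Fin P.g, (Fin.snoc (α := fun _ => Fin P.h → ZMod P.q) A
      (Matrix.vecMul s A + e) : Ct P) i.castSucc j = A i j := fun i =>
    congrFun (Fin.snoc_castSucc (α := fun _ => Fin P.h → ZMod P.q) _ _ i) j
  have h2 : (Fin.snoc (α := fun _ => Fin P.h → ZMod P.q) A
      (Matrix.vecMul s A + e) : Ct P) (Fin.last P.g) j = (Matrix.vecMul s A + e) j :=
    congrFun (Fin.snoc_last (α := fun _ => Fin P.h → ZMod P.q) _ _) j
  change ∑ i : Fin (P.g + 1), _ * _ = e j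
  rw [Fin.sum_univ_castSucc, h2]
  simp only [h1]
  simp [Matrix.vecMul, dotProduct]

/-- The estimate holds conditionally on every choice of `s̄` and `Ā`, so only the noise coordinates
enter the union bound. -/
theorem keyGen_noise_small (P : Params) {t : ℝ} (ht : 0 ≤ t) :
    1 - P.h * ENNReal.ofReal (Real.sqrt 2 * Real.exp (-Real.pi * t ^ 2 / 2)) ≤
      (keyGen P).toOuterMeasure {κ | κ.2 (Fin.last P.g) = 1 ∧
        SmallVec (P.σ * t) (Matrix.vecMul κ.2 κ.1)} := by
  refine le_toOuterMeasure_bind _ _ fun s => le_toOuterMeasure_bind _ _ fun A => ?_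
  rw [PMF.toOuterMeasure_map_apply]
  have h1 : (noise P).toOuterMeasure {e | ∀ j, |(e j : ℝ)| ≤ P.σ * t}ᶜ ≤
      P.h * ENNReal.ofReal (Real.sqrt 2 * Real.exp (-Real.pi * t ^ 2 / 2)) := by
    have h2 : {e : Fin P.h → ℤ | ∀ j, |(e j : ℝ)| ≤ P.σ * t}ᶜ =
        {e | ∃ j, e j ∈ {x : ℤ | P.σ * t < |(x : ℝ)|}} := by
      ext e
      simp
    rw [h2]
    refine (toOuterMeasure_iid_exists_le _ _ _).trans ?_
    gcongr
    exact discreteGaussian_tail P.σ P.σ_pos ht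
  refine (one_sub_le_toOuterMeasure _ h1).trans ((noise P).toOuterMeasure.mono ?_)
  intro e he
  refine ⟨Fin.snoc_last (α := fun _ => ZMod P.q) 1 (-s), e, he, ?_⟩
  exact vecMul_snoc s A _

end GSWStream

/-! ### Bit strings, composition of circuits, and encryption by a circuit. -/

namespace GSWStream

variable {P : Params}

/-! ### Bit representations -/

theorem bitsElt_eq (x : ZMod P.q) :
    bitsElt P x = List.ofFn fun t : Fin P.len => x.val.testBit t := by
  rw [bitsElt, List.ofFn_eq_map, ← List.map_coe_finRange_eq_range, List.map_map]
  rfl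

theorem bitsVec_eq {m : ℕ} (v : Fin m → ZMod P.q) :
    bitsVec P v = List.ofFn fun p : Fin (m * P.len) => (v p.divNat).val.testBit p.modNat := by
  rw [List.ofFn_mul, bitsVec]
  congr 2
  ext1 j
  rw [bitsElt_eq]
  congr 1
  ext1 t
  have h := finProdFinEquiv.symm_apply_apply (j, t)
  have h1 : (⟨(j : ℕ) * P.len + t, mul_add_lt j.2 t.2⟩ : Fin (m * P.len)) =
      finProdFinEquiv (j, t) := Fin.ext (by simp [finProdFinEquiv, mul_comm, add_comm])
  rw [h1]
  simp only [finProdFinEquiv_symm_apply, Prod.mk.injEq] at h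
  rw [h.1, h.2]

theorem bitsMat_eq {l m : ℕ} (A : Matrix (Fin l) (Fin m) (ZMod P.q)) :
    bitsMat P A = List.ofFn fun p : Fin (l * (m * P.len)) =>
      (A p.divNat p.modNat.divNat).val.testBit p.modNat.modNat := by
  rw [List.ofFn_mul, bitsMat]
  congr 2
  ext1 i
  rw [bitsVec_eq]
  congr 1
  ext1 t
  have h := finProdFinEquiv.symm_apply_apply (i, t)
  have h1 : (⟨(i : ℕ) * (m * P.len) + t, mul_add_lt i.2 t.2⟩ : Fin (l * (m * P.len))) =
      finProdFinEquiv (i, t) := Fin.ext (by simp [finProdFinEquiv, mul_comm, add_comm])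
  rw [h1]
  simp only [finProdFinEquiv_symm_apply, Prod.mk.injEq] at h
  rw [h.1, h.2]

theorem length_bitsMat {l m : ℕ} (A : Matrix (Fin l) (Fin m) (ZMod P.q)) :
    (bitsMat P A).length = l * (m * P.len) := by
  rw [bitsMat_eq, List.length_ofFn]

theorem bits_injective : Function.Injective fun (x : ZMod P.q) (t : Fin P.len) =>
    x.val.testBit t := by
  intro x y h
  refine ZMod.val_injective _ (Nat.eq_of_testBit_eq fun t => ?_)
  by_cases ht : t < P.len
  · exact congrFun h ⟨t, ht⟩
  · have hlt : ∀ z : ZMod P.q, z.val < 2 ^ t := fun z =>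
      ((ZMod.val_lt z).trans_le P.q_le).trans_le (Nat.pow_le_pow_right (by norm_num) (by omega))
    rw [Nat.testBit_lt_two_pow (hlt x), Nat.testBit_lt_two_pow (hlt y)]

theorem bitsMat_injective {l m : ℕ} :
    Function.Injective (bitsMat P : Matrix (Fin l) (Fin m) (ZMod P.q) → List Bool) := by
  intro A B h
  rw [bitsMat_eq, bitsMat_eq] at h
  have h' := List.ofFn_injective h
  ext i j
  refine bits_injective (funext fun t => ?_)
  have h1 := congrFun h' (finProdFinEquiv (i, finProdFinEquiv (j, t)))
  have h2 := finProdFinEquiv.symm_apply_apply (i, finProdFinEquiv (j, t))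
  have h3 := finProdFinEquiv.symm_apply_apply (j, t)
  simp only [finProdFinEquiv_symm_apply, Prod.mk.injEq] at h2 h3
  rw [h2.1, h2.2, h3.1, h3.2] at h1
  exact h1

/-- The entry and the bit depend only on the position, not on the matrix. A circuit can therefore
address them by fixed wires. -/
theorem exists_bit {l m : ℕ} {w : ℕ} (hw : w < l * (m * P.len)) :
    ∃ (i : Fin l) (j : Fin m) (t : Fin P.len), ∀ A : Matrix (Fin l) (Fin m) (ZMod P.q),
      (bitsMat P A).getD w false = (A i j).val.testBit t := by
  refine ⟨Fin.divNat ⟨w, hw⟩, (Fin.modNat ⟨w, hw⟩).divNat, (Fin.modNat ⟨w, hw⟩).modNat,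
    fun A => ?_⟩
  rw [bitsMat_eq, List.getD_eq_getElem _ _ (by simpa using hw), List.getElem_ofFn]

theorem exists_position {l m : ℕ} (i : Fin l) (j : Fin m) (t : Fin P.len) :
    ∃ w < l * (m * P.len), ∀ A : Matrix (Fin l) (Fin m) (ZMod P.q),
      (bitsMat P A).getD w false = (A i j).val.testBit t := by
  refine ⟨_, (finProdFinEquiv (i, finProdFinEquiv (j, t))).2, fun A => ?_⟩
  rw [bitsMat_eq, List.getD_eq_getElem _ _ (by rw [List.length_ofFn]; exact Fin.is_lt _),
    List.getElem_ofFn, Fin.eta]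
  have h2 := finProdFinEquiv.symm_apply_apply (i, finProdFinEquiv (j, t))
  have h3 := finProdFinEquiv.symm_apply_apply (j, t)
  simp only [finProdFinEquiv_symm_apply, Prod.mk.injEq] at h2 h3
  rw [h2.1, h2.2, h3.1, h3.2]

/-! ### Composition of circuits -/

/-- All wires of a circuit. -/
def Circuit.wires (C : Circuit) (x : List Bool) : List Bool :=
  C.foldl (fun w γ => w ++ [γ.op (w.getD γ.fst false) (w.getD γ.snd false)]) x

theorem Circuit.eval_eq (C : Circuit) (x : List Bool) :
    Circuit.eval C x = (Circuit.wires C x).getLastD false := rfl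

theorem Circuit.wires_append (C D : Circuit) (x : List Bool) :
    Circuit.wires (C ++ D) x = Circuit.wires D (Circuit.wires C x) :=
  List.foldl_append

theorem Circuit.length_wires (C : Circuit) (x : List Bool) :
    (Circuit.wires C x).length = x.length + C.length := by
  induction C generalizing x with
  | nil => rfl
  | cons γ C ih =>
    change (Circuit.wires C _).length = _
    rw [ih]
    simp
    omega

theorem Circuit.prefix_wires (C : Circuit) (x : List Bool) : x <+: Circuit.wires C x := by
  induction C generalizing x with
  | nil => exact List.prefix_rfl
  | cons γ C ih => exact (List.prefix_append _ _).trans (ih _)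

theorem Circuit.getD_wires (C : Circuit) {x : List Bool} {w : ℕ} (hw : w < x.length) :
    (Circuit.wires C x).getD w false = x.getD w false := by
  obtain ⟨y, hy⟩ := Circuit.prefix_wires C x
  rw [← hy, List.getD_append _ _ _ _ hw]

theorem Circuit.wires_singleton (γ : Gate) (x : List Bool) :
    Circuit.wires [γ] x = x ++ [γ.op (x.getD γ.fst false) (x.getD γ.snd false)] := rfl

theorem Circuit.getD_wires_singleton (γ : Gate) (x : List Bool) :
    (Circuit.wires [γ] x).getD x.length false =
      γ.op (x.getD γ.fst false) (x.getD γ.snd false) := by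
  rw [Circuit.wires_singleton, List.getD_append_right _ _ _ _ le_rfl]
  simp

/-- Renaming of the wires of a circuit. -/
def Circuit.rewire (ρ : ℕ → ℕ) (C : Circuit) : Circuit :=
  C.map fun γ => ⟨γ.op, ρ γ.fst, ρ γ.snd⟩

/-- Inputs may be moved to arbitrary existing wires, while gate wires are shifted as a block, so
every new gate keeps its place relative to the renaming. Agreement is also required on wires that do
not exist, where both sides read the default value `false`, as gates may refer to such wires. -/
theorem Circuit.getD_wires_rewire {ρ : ℕ → ℕ} {a b : ℕ} (hlt : ∀ w < a, ρ w < b)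
    (hge : ∀ w, ρ (a + w) = b + w) (C : Circuit) {x y : List Bool} {t : ℕ} (hx : x.length = a + t)
    (hy : y.length = b + t) (h : ∀ w, y.getD (ρ w) false = x.getD w false) (w : ℕ) :
    (Circuit.wires (Circuit.rewire ρ C) y).getD (ρ w) false =
      (Circuit.wires C x).getD w false := by
  induction C generalizing x y t with
  | nil => exact h w
  | cons γ C ih =>
    refine ih (t := t + 1) (by simp [hx]; omega) (by simp [hy]; omega) fun v => ?_
    dsimp only
    rw [h, h]
    rcases lt_trichotomy v (a + t) with hv | rfl | hv
    · have hρ : ρ v < y.length := by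
        rcases lt_or_ge v a with hva | hva
        · have := hlt v hva
          omega
        · obtain ⟨u, rfl⟩ := Nat.exists_eq_add_of_le hva
          rw [hge]
          omega
      rw [List.getD_append _ _ _ _ hρ, List.getD_append _ _ _ _ (by omega), h]
    · rw [hge, List.getD_append_right _ _ _ _ (by omega),
        List.getD_append_right _ _ _ _ (by omega), hx, hy]
      simp
    · obtain ⟨u, rfl⟩ := Nat.exists_eq_add_of_lt hv
      have hρ : ρ (a + t + u + 1) = b + (t + u + 1) := by
        rw [← hge]
        congr 1
        omega
      rw [hρ, List.getD_eq_default _ _ (by simp; omega), List.getD_eq_default _ _ (by simp; omega)]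

section Available

variable {X : Type} {inp : X → List Bool}

/-- Some wire of the circuit `C` carries the bit `b`, for all inputs `inp x`. -/
def Available (inp : X → List Bool) (C : Circuit) (b : X → Bool) : Prop :=
  ∃ w, ∀ x, w < (Circuit.wires C (inp x)).length ∧ (Circuit.wires C (inp x)).getD w false = b x

theorem Available.append {C : Circuit} {b : X → Bool} (h : Available inp C b) (D : Circuit) :
    Available inp (C ++ D) b := by
  obtain ⟨w, hw⟩ := h
  refine ⟨w, fun x => ?_⟩
  rw [Circuit.wires_append, Circuit.getD_wires _ (hw x).1, Circuit.length_wires D]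
  exact ⟨(hw x).1.trans_le (Nat.le_add_right _ _), (hw x).2⟩

theorem exists_comp {a b : ℕ} {Y : X → List Bool} (ha : ∀ x, (inp x).length = a)
    (hb : ∀ x, (Y x).length = b) {C : Circuit}
    (h : ∀ w < b, Available inp C fun x => (Y x).getD w false) (D : Circuit) :
    ∃ D' : Circuit, D'.length ≤ C.length + D.length + 1 ∧
      ∀ x, Circuit.eval D' (inp x) = Circuit.eval D (Y x) := by
  choose! π hπ using h
  set m := a + C.length with hm
  have hwl : ∀ x, (Circuit.wires C (inp x)).length = m := fun x => by
    rw [Circuit.length_wires, ha]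
  set ρ : ℕ → ℕ := fun w => if w < b then π w else m + (w - b) with hρ
  -- The additional gate copies the output wire of `D` to the end. It matters if `D` has no gates:
  -- then the last wire of `C` need not be the intended output.
  refine ⟨C ++ (Circuit.rewire ρ D ++ [⟨fun u _ => u, ρ (b + D.length - 1), 0⟩]), ?_,
    fun x => ?_⟩
  · simp [Circuit.rewire]
    omega
  · have key := Circuit.getD_wires_rewire (ρ := ρ) (a := b) (b := m) (t := 0)
      (fun w hw => by
        simp only [hρ, hw, if_true]
        rw [← hwl x]
        exact (hπ w hw x).1)
      (fun w => by simp [hρ]) D (x := Y x) (y := Circuit.wires C (inp x)) (by simp [hb])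
      (by simp [hwl]) (fun w => by
        by_cases hw : w < b
        · simp only [hρ, hw, if_true]
          exact (hπ w hw x).2
        · simp only [hρ, hw, if_false]
          rw [List.getD_eq_default _ _ (by rw [hwl]; omega),
            List.getD_eq_default _ _ (by rw [hb]; omega)])
    rw [Circuit.eval_eq, Circuit.wires_append, Circuit.wires_append, Circuit.wires_singleton,
      Circuit.eval_eq, List.getLastD_concat]
    simp only
    rw [key, List.getLastD_eq_getLast?, List.getLast?_eq_getElem?, Circuit.length_wires, hb]
    rfl

theorem Available.exists_gate {C : Circuit} {b b' : X → Bool} (h : Available inp C b)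
    (h' : Available inp C b') (ha : ∃ a, ∀ x, (inp x).length = a) (op : Bool → Bool → Bool) :
    ∃ γ : Gate, Available inp (C ++ [γ]) fun x => op (b x) (b' x) := by
  obtain ⟨w, hw⟩ := h
  obtain ⟨w', hw'⟩ := h'
  obtain ⟨a, ha⟩ := ha
  refine ⟨⟨op, w, w'⟩, a + C.length, fun x => ?_⟩
  have hl : (Circuit.wires C (inp x)).length = a + C.length := by rw [Circuit.length_wires, ha]
  rw [Circuit.wires_append, ← hl, Circuit.getD_wires_singleton, Circuit.length_wires [_],
    (hw x).2, (hw' x).2]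
  simp

/-- Every Boolean function of `m` available bits is available after `4 · 2^m` more gates. -/
theorem Available.exists_apply (ha : ∃ a, ∀ x, (inp x).length = a) {C : Circuit} {m : ℕ}
    {b : Fin m → X → Bool} (h : ∀ i, Available inp C (b i)) (F : (Fin m → Bool) → Bool) :
    ∃ D : Circuit, D.length + 3 ≤ 4 * 2 ^ m ∧
      Available inp (C ++ D) fun x => F fun i => b i x := by
  induction m generalizing C with
  | zero =>
    obtain ⟨a, ha⟩ := ha
    refine ⟨[⟨fun _ _ => F Fin.elim0, 0, 0⟩], by simp, a + C.length, fun x => ?_⟩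
    have hl : (Circuit.wires C (inp x)).length = a + C.length := by rw [Circuit.length_wires, ha]
    rw [Circuit.wires_append, ← hl, Circuit.getD_wires_singleton, Circuit.length_wires [_]]
    refine ⟨by simp, congrArg F (Subsingleton.elim _ _)⟩
  | succ m ih =>
    -- Shannon expansion in the first bit: both restrictions and three gates to select between them.
    -- Sizes obey `s ↦ 2 s + 3`, so `s + 3` doubles in each step.
    obtain ⟨D₀, hl₀, h₀⟩ := ih (fun i => h i.succ) fun y => F (Fin.cons (α := fun _ => Bool) false y)
    obtain ⟨D₁, hl₁, h₁⟩ := ih (fun i => (h i.succ).append D₀)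
      fun y => F (Fin.cons (α := fun _ => Bool) true y)
    have hs := ((h 0).append D₀).append D₁
    obtain ⟨γ₁, hγ₁⟩ := hs.exists_gate h₁ ha fun s u => s && u
    obtain ⟨γ₀, hγ₀⟩ := (hs.append [γ₁]).exists_gate ((h₀.append D₁).append [γ₁]) ha
      fun s u => !s && u
    obtain ⟨γ, hγ⟩ := (hγ₁.append [γ₀]).exists_gate hγ₀ ha fun s u => s || u
    refine ⟨D₀ ++ (D₁ ++ ([γ₁] ++ ([γ₀] ++ [γ]))), ?_, ?_⟩
    · simp only [List.length_append, List.length_cons, List.length_nil, pow_succ]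
      omega
    · simp only [List.append_assoc] at hγ ⊢
      convert hγ using 2 with x
      have hcons : (fun i => b i x) = Fin.cons (α := fun _ => Bool) (b 0 x) fun i => b i.succ x := by
        ext i
        refine Fin.cases rfl (fun i => rfl) i
      rw [hcons]
      cases b 0 x <;> simp

/-- Circuits for the separate goals are appended one after the other; availability is never lost by
appending. -/
theorem exists_forall_of_mono {ι : Type*} [Fintype ι] {p : ι → Circuit → Prop}
    (hmono : ∀ i C D, p i C → p i (C ++ D)) {C : Circuit} {c : ℕ}
    (h : ∀ i D, ∃ D' : Circuit, D'.length ≤ c ∧ p i (C ++ D ++ D')) :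
    ∃ D : Circuit, D.length ≤ Fintype.card ι * c ∧ ∀ i, p i (C ++ D) := by
  classical
  have key : ∀ s : Finset ι, ∃ D : Circuit, D.length ≤ s.card * c ∧ ∀ i ∈ s, p i (C ++ D) := by
    intro s
    induction s using Finset.induction_on with
    | empty => exact ⟨[], by simp, by simp⟩
    | insert i s hi ih =>
      obtain ⟨D, hD, hp⟩ := ih
      obtain ⟨D', hD', hp'⟩ := h i D
      refine ⟨D ++ D', ?_, fun j hj => ?_⟩
      · rw [Finset.card_insert_of_notMem hi, List.length_append, add_mul, one_mul]
        omega
      · rw [← List.append_assoc]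
        rcases Finset.mem_insert.1 hj with rfl | hj
        · exact hp'
        · exact hmono _ _ _ (hp j hj)
  obtain ⟨D, hD, hp⟩ := key Finset.univ
  exact ⟨D, hD, fun i => hp i (Finset.mem_univ i)⟩

/-- All bits of an element of `ℤ_q` are available. -/
def AvailableElt (inp : X → List Bool) (C : Circuit) (v : X → ZMod P.q) : Prop :=
  ∀ t : Fin P.len, Available inp C fun x => (v x).val.testBit t

theorem AvailableElt.append {C : Circuit} {v : X → ZMod P.q} (h : AvailableElt inp C v)
    (D : Circuit) : AvailableElt inp (C ++ D) v := fun t => (h t).append D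

/-- The number of gates of the circuit for a binary operation on `ℤ_q`. -/
def opSize (P : Params) : ℕ := P.len * (4 * 2 ^ (P.len + P.len))

/-- Every output bit is computed from its truth table in the `2 len` input bits. This costs a
polynomial in `2 ^ len`, which is affordable because `q` is polynomial in `n`, and spares any
arithmetic circuit. -/
theorem AvailableElt.exists_apply (ha : ∃ a, ∀ x, (inp x).length = a) {C : Circuit}
    {u v : X → ZMod P.q} (hu : AvailableElt inp C u) (hv : AvailableElt inp C v)
    (F : ZMod P.q → ZMod P.q → ZMod P.q) :
    ∃ D : Circuit, D.length ≤ opSize P ∧ AvailableElt inp (C ++ D) fun x => F (u x) (v x) := by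
  have hdec := Function.leftInverse_invFun (bits_injective (P := P))
  set dec := Function.invFun fun (x : ZMod P.q) (t : Fin P.len) => x.val.testBit t
  have h := exists_forall_of_mono (C := C) (c := 4 * 2 ^ (P.len + P.len))
    (p := fun (t : Fin P.len) C => Available inp C fun x => (F (u x) (v x)).val.testBit t)
    (fun t C D h => h.append D) fun t D => ?_
  · rw [Fintype.card_fin] at h
    exact h
  · set b : Fin (P.len + P.len) → X → Bool := fun i => Fin.addCases
      (fun t x => (u x).val.testBit t) (fun t x => (v x).val.testBit t) i with hbdef
    have hb : ∀ i, Available inp (C ++ D) (b i) := by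
      intro i
      refine Fin.addCases (fun t => ?_) (fun t => ?_) i
      · simp only [hbdef, Fin.addCases_left]
        exact (hu.append D) t
      · simp only [hbdef, Fin.addCases_right]
        exact (hv.append D) t
    obtain ⟨D', hD', h'⟩ := Available.exists_apply ha hb fun y =>
      (F (dec fun t => y (Fin.castAdd P.len t)) (dec fun t => y (Fin.natAdd P.len t))).val.testBit t
    refine ⟨D', by omega, ?_⟩
    convert h' using 2 with x
    simp only [hbdef, Fin.addCases_left, Fin.addCases_right]
    rw [hdec (u x), hdec (v x)]

theorem AvailableElt.exists_sum (ha : ∃ a, ∀ x, (inp x).length = a) {C : Circuit} {ι : Type*}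
    [Nonempty ι] {v : ι → X → ZMod P.q} (hv : ∀ i, AvailableElt inp C (v i)) (z : ZMod P.q)
    (s : Finset ι) : ∃ D : Circuit, D.length ≤ (s.card + 1) * opSize P ∧
      AvailableElt inp (C ++ D) fun x => z + ∑ i ∈ s, v i x := by
  classical
  induction s using Finset.induction_on with
  | empty =>
    -- The constant `z` is produced by an operation that ignores its operands; some available
    -- element is needed to supply them.
    obtain ⟨i⟩ := ‹Nonempty ι›
    simpa using (hv i).exists_apply ha (hv i) fun _ _ => z
  | insert i s hi ih =>
    obtain ⟨D, hD, h⟩ := ih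
    obtain ⟨D', hD', h'⟩ := h.exists_apply ha ((hv i).append D) fun a b => a + b
    refine ⟨D ++ D', ?_, ?_⟩
    · rw [Finset.card_insert_of_notMem hi, List.length_append, add_mul _ 1, one_mul]
      omega
    · rw [← List.append_assoc]
      convert h' using 2 with x
      rw [Finset.sum_insert hi]
      ring

end Available

/-- The number of gates of the encryption circuit. -/
def encSize (P : Params) : ℕ := (P.g + 1) * P.h * ((P.h + 1) * opSize P)

/-- For fixed randomness an entry of the ciphertext is a constant plus a subset sum of a row of the
key, so a circuit needs only additions. -/
theorem enc_apply (pk : Ct P) (μ : Bool) (R : Matrix (Fin P.h) (Fin P.h) Bool)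
    (i : Fin (P.g + 1)) (j : Fin P.h) : enc P pk μ R i j =
      (if μ then gadget P i j else 0) + ∑ t ∈ Finset.univ.filter (fun t => R t j), pk i t := by
  rw [enc, Matrix.add_apply, add_comm, Matrix.mul_apply, Finset.sum_filter]
  congr 1
  · cases μ <;> simp
  · exact Finset.sum_congr rfl fun t _ => by cases h : R t j <;> simp [h]

theorem exists_encCircuit (hh : 0 < P.h) (μ : Bool) (R : Matrix (Fin P.h) (Fin P.h) Bool)
    (D : Circuit) : ∃ D' : Circuit, D'.length ≤ encSize P + D.length + 1 ∧
      ∀ pk : Ct P, Circuit.eval D' (bitsMat P pk) =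
        Circuit.eval D (bitsMat P pk ++ bitsMat P (enc P pk μ R)) := by
  have ha : ∃ a, ∀ x : Ct P, (bitsMat P x).length = a := ⟨_, fun x => length_bitsMat x⟩
  have : Nonempty (Fin P.h) := ⟨⟨0, hh⟩⟩
  have hin : ∀ (C : Circuit) (i : Fin (P.g + 1)) (j : Fin P.h),
      AvailableElt (bitsMat P) C fun pk : Ct P => pk i j := by
    intro C i j t
    obtain ⟨w, hw, h⟩ := exists_position (P := P) i j t
    refine ⟨w, fun x => ?_⟩
    rw [Circuit.length_wires, Circuit.getD_wires _ (by rwa [length_bitsMat]), h, length_bitsMat]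
    exact ⟨by omega, rfl⟩
  obtain ⟨C, hC, hout⟩ := exists_forall_of_mono (C := []) (c := (P.h + 1) * opSize P)
    (p := fun (ij : Fin (P.g + 1) × Fin P.h) C =>
      AvailableElt (bitsMat P) C fun pk : Ct P => enc P pk μ R ij.1 ij.2)
    (fun _ C D h => h.append D) fun ij D => by
      obtain ⟨D', hD', h'⟩ := AvailableElt.exists_sum ha (fun t => hin ([] ++ D) ij.1 t)
        (if μ then gadget P ij.1 ij.2 else 0) (Finset.univ.filter (fun t => R t ij.2))
      refine ⟨D', hD'.trans (Nat.mul_le_mul_right _ (Nat.add_le_add_right ?_ 1)), ?_⟩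
      · exact (Finset.card_le_univ _).trans (by simp)
      · simpa only [enc_apply] using h'
  rw [List.nil_append] at hout
  simp only [Fintype.card_prod, Fintype.card_fin] at hC
  set m := (P.g + 1) * (P.h * P.len) with hm
  have hav : ∀ w < m + m, Available (bitsMat P) C fun pk : Ct P =>
      (bitsMat P pk ++ bitsMat P (enc P pk μ R)).getD w false := by
    intro w hw
    rcases lt_or_ge w m with hwm | hwm
    · obtain ⟨i, j, t, h⟩ := exists_bit hwm
      convert hin C i j t using 2 with x
      rw [List.getD_append _ _ _ _ (by rw [length_bitsMat]; exact hwm), h]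
    · have hwm' : w - m < m := by omega
      obtain ⟨i, j, t, h⟩ := exists_bit hwm'
      convert hout (i, j) t using 2 with x
      rw [List.getD_append_right _ _ _ _ (by rw [length_bitsMat]; exact hwm), length_bitsMat, h]
  obtain ⟨D', hD', h'⟩ := exists_comp (fun x => length_bitsMat x)
    (fun x => by rw [List.length_append, length_bitsMat, length_bitsMat]) hav D
  exact ⟨D', hD'.trans (by rw [encSize]; omega), h'⟩

end GSWStream

/-! ### The leftover hash lemma. -/

namespace GSWStream

open scoped BigOperators

/-! ### The leftover hash lemma -/

section Hash

variable {α β κ : Type*} [Fintype α] [Fintype β] [Fintype κ]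

theorem expect_fin_succ {m : ℕ} (f : (Fin (m + 1) → α) → ℝ) :
    𝔼 a, f a = 𝔼 x : α, 𝔼 y : Fin m → α, f (Fin.cons (α := fun _ => α) x y) := by
  rw [← Finset.expect_product', Finset.univ_product_univ]
  exact (Fintype.expect_equiv (Fin.consEquiv fun _ => α) _ _ fun i => rfl).symm

theorem abs_expect_le_of_forall [Nonempty α] {f : α → ℝ} {δ : ℝ} (h : ∀ a, |f a| ≤ δ) : |𝔼 a, f a| ≤ δ :=
  (Finset.abs_expect_le _ _).trans (Finset.expect_le Finset.univ_nonempty fun a _ => h a)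

/-- If no test distinguishes `φ a` from uniform with advantage more than `δ`, then no test
distinguishes `m` independent copies with advantage more than `m δ`. -/
theorem abs_expect_comp_sub_le [Nonempty α] [Nonempty β] {φ : α → β} {δ : ℝ}
    (h : ∀ ψ : β → ℝ, (∀ b, 0 ≤ ψ b) → (∀ b, ψ b ≤ 1) → |𝔼 a, ψ (φ a) - 𝔼 b, ψ b| ≤ δ)
    {m : ℕ} (Φ : (Fin m → β) → ℝ) (h0 : ∀ b, 0 ≤ Φ b) (h1 : ∀ b, Φ b ≤ 1) :
    |𝔼 a : Fin m → α, Φ (φ ∘ a) - 𝔼 b, Φ b| ≤ m * δ := by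
  induction m with
  | zero =>
    have e1 : ∀ a : Fin 0 → α, Φ (φ ∘ a) = Φ Fin.elim0 := fun a =>
      congrArg Φ (Subsingleton.elim _ _)
    have e2 : ∀ b : Fin 0 → β, Φ b = Φ Fin.elim0 := fun b => congrArg Φ (Subsingleton.elim _ _)
    simp only [e1]
    rw [Fintype.expect_const, Finset.expect_congr rfl fun b _ => e2 b, Fintype.expect_const]
    simp
  | succ m ih =>
    rw [expect_fin_succ, expect_fin_succ]
    have e1 : ∀ (x : α) (y : Fin m → α), φ ∘ (Fin.cons (α := fun _ => α) x y) =
        Fin.cons (α := fun _ => β) (φ x) (φ ∘ y) := by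
      intro x y
      ext i
      refine Fin.cases rfl (fun i => rfl) i
    simp only [e1]
    -- Hybrid argument: the last `m` coordinates are replaced by induction with the first one fixed;
    -- averaging over them then gives the single-copy test `ψ` for the first.
    set ψ : β → ℝ := fun b => 𝔼 y : Fin m → β, Φ (Fin.cons (α := fun _ => β) b y) with hψ
    have hA : |𝔼 x : α, 𝔼 y : Fin m → α, Φ (Fin.cons (α := fun _ => β) (φ x) (φ ∘ y)) -
        𝔼 x : α, ψ (φ x)| ≤ m * δ := by
      rw [← Finset.expect_sub_distrib]
      exact abs_expect_le_of_forall fun x =>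
        ih (fun y => Φ (Fin.cons (α := fun _ => β) (φ x) y)) (fun _ => h0 _) fun _ => h1 _
    have hB := h ψ (fun b => Finset.expect_nonneg fun _ _ => h0 _)
      fun b => Finset.expect_le Finset.univ_nonempty fun _ _ => h1 _
    have := abs_add_le (𝔼 x : α, 𝔼 y : Fin m → α, Φ (Fin.cons (α := fun _ => β) (φ x) (φ ∘ y)) -
        𝔼 x : α, ψ (φ x)) (𝔼 x : α, ψ (φ x) - 𝔼 b, ψ b)
    rw [sub_add_sub_cancel] at this
    push_cast
    linarith

variable [DecidableEq β]

/-- The probability that `H a` takes the value `b`. -/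
noncomputable def freq (φ : α → β) (b : β) : ℝ :=
  ((Finset.univ.filter fun a => φ a = b).card : ℝ) / Fintype.card α

theorem expect_comp_eq (φ : α → β) (ψ : β → ℝ) : 𝔼 a, ψ (φ a) = ∑ b, freq φ b * ψ b := by
  rw [Fintype.expect_eq_sum_div_card, ← Finset.sum_fiberwise Finset.univ φ, Finset.sum_div]
  refine Finset.sum_congr rfl fun b _ => ?_
  rw [Finset.sum_congr rfl fun a ha => by rw [(Finset.mem_filter.1 ha).2], Finset.sum_const, freq,
    nsmul_eq_mul]
  ring

theorem sum_freq [Nonempty α] (φ : α → β) : ∑ b, freq φ b = 1 := by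
  have h := expect_comp_eq φ fun _ => 1
  simpa using h.symm

theorem abs_expect_sub_le_sum (φ : α → β) (ψ : β → ℝ) (h0 : ∀ b, 0 ≤ ψ b) (h1 : ∀ b, ψ b ≤ 1) :
    |𝔼 a, ψ (φ a) - 𝔼 b, ψ b| ≤ ∑ b, |freq φ b - 1 / Fintype.card β| := by
  rw [expect_comp_eq, Fintype.expect_eq_sum_div_card, Finset.sum_div, ← Finset.sum_sub_distrib]
  refine (Finset.abs_sum_le_sum_abs _ _).trans (Finset.sum_le_sum fun b _ => ?_)
  rw [show freq φ b * ψ b - ψ b / Fintype.card β = (freq φ b - 1 / Fintype.card β) * ψ b by ring,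
    abs_mul, abs_of_nonneg (h0 b)]
  exact mul_le_of_le_one_right (abs_nonneg _) (h1 b)

/-- Both sides count the ordered pairs with equal images, that is, collisions. -/
theorem sum_card_sq (φ : α → β) :
    ∑ b, ((Finset.univ.filter fun a => φ a = b).card : ℝ) ^ 2 =
      ∑ a, ∑ a', if φ a = φ a' then (1 : ℝ) else 0 := by
  have h1 : ∀ b, ((Finset.univ.filter fun a => φ a = b).card : ℝ) ^ 2 =
      ∑ a, ∑ a', if φ a = b ∧ φ a' = b then (1 : ℝ) else 0 := by
    intro b
    rw [sq, Finset.card_filter]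
    push_cast
    rw [Finset.sum_mul_sum]
    refine Finset.sum_congr rfl fun a _ => Finset.sum_congr rfl fun a' _ => ?_
    split_ifs <;> simp_all
  simp only [h1]
  rw [Finset.sum_comm]
  refine Finset.sum_congr rfl fun a _ => ?_
  rw [Finset.sum_comm]
  refine Finset.sum_congr rfl fun a' _ => ?_
  rw [Finset.sum_eq_single (φ a)]
  · simp [eq_comm]
  · intro b _ hb
    rw [if_neg fun h => hb h.1.symm]
  · simp

/-- The leftover hash lemma for a universal family `H` of hash functions. -/
theorem expect_sum_abs_freq_le [Nonempty α] [Nonempty β] [Nonempty κ] (H : κ → α → β)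
    (hH : ∀ a a', a ≠ a' →
      Fintype.card β * (Finset.univ.filter fun k => H k a = H k a').card = Fintype.card κ) :
    𝔼 k, ∑ b, |freq (H k) b - 1 / Fintype.card β| ≤
      Real.sqrt ((Fintype.card β : ℝ) / Fintype.card α) := by
  classical
  set a₀ : ℝ := ((Fintype.card α : ℕ) : ℝ) with ha₀
  set b₀ : ℝ := ((Fintype.card β : ℕ) : ℝ) with hb₀
  set k₀ : ℝ := ((Fintype.card κ : ℕ) : ℝ) with hk₀
  have ha : 0 < a₀ := by rw [ha₀]; exact_mod_cast Fintype.card_pos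
  have hb : 0 < b₀ := by rw [hb₀]; exact_mod_cast Fintype.card_pos
  have hk : 0 < k₀ := by rw [hk₀]; exact_mod_cast Fintype.card_pos
  -- The squared `L²` distance from uniform is the collision probability minus `1 / b₀`.
  have h1 : ∀ k, ∑ b, |freq (H k) b - 1 / b₀| ^ 2 =
      (∑ a, ∑ a', if H k a = H k a' then (1 : ℝ) else 0) / a₀ ^ 2 - 1 / b₀ := by
    intro k
    have e1 : ∀ b, |freq (H k) b - 1 / b₀| ^ 2 =
        ((Finset.univ.filter fun a => H k a = b).card : ℝ) ^ 2 / a₀ ^ 2 -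
          2 / b₀ * freq (H k) b + 1 / b₀ ^ 2 := by
      intro b
      rw [sq_abs, freq]
      ring
    simp only [e1]
    rw [Finset.sum_add_distrib, Finset.sum_sub_distrib, ← Finset.sum_div, ← Finset.mul_sum,
      sum_freq, sum_card_sq, Finset.sum_const, Finset.card_univ, nsmul_eq_mul, ← hb₀]
    field_simp
    ring
  -- Diagonal pairs collide for all keys, other pairs for a fraction `1 / b₀` of them. The second
  -- term is also allowed on the diagonal, which makes the bound a clean product and later cancels
  -- `1 / b₀`.
  have h2 : ∑ k, ∑ a, ∑ a', (if H k a = H k a' then (1 : ℝ) else 0) ≤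
      a₀ * k₀ + a₀ ^ 2 * (k₀ / b₀) := by
    rw [Finset.sum_comm]
    have e1 : ∀ a, ∑ k, ∑ a', (if H k a = H k a' then (1 : ℝ) else 0) ≤ k₀ + a₀ * (k₀ / b₀) := by
      intro a
      rw [Finset.sum_comm]
      calc ∑ a', ∑ k, (if H k a = H k a' then (1 : ℝ) else 0) ≤
          ∑ a', ((if a = a' then k₀ else 0) + k₀ / b₀) := by
            refine Finset.sum_le_sum fun a' _ => ?_
            by_cases haa : a = a'
            · subst haa
              simp only [if_true, Finset.sum_const, Finset.card_univ, nsmul_eq_mul, mul_one]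
              rw [← hk₀]
              have := div_pos hk hb
              linarith
            · rw [if_neg haa, zero_add, ← Finset.sum_filter, Finset.sum_const, nsmul_eq_mul, mul_one,
                le_div_iff₀ hb, mul_comm, hb₀, hk₀]
              exact_mod_cast (hH a a' haa).le
        _ = k₀ + a₀ * (k₀ / b₀) := by
            rw [Finset.sum_add_distrib]
            simp [ha₀]
    calc _ ≤ ∑ _a : α, (k₀ + a₀ * (k₀ / b₀)) := Finset.sum_le_sum fun a _ => e1 a
      _ = _ := by
        simp only [Finset.sum_const, Finset.card_univ, nsmul_eq_mul]
        rw [← ha₀]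
        ring
  have h3 : ∑ k, ∑ b, |freq (H k) b - 1 / b₀| ^ 2 ≤ k₀ / a₀ := by
    simp only [h1]
    rw [Finset.sum_sub_distrib, ← Finset.sum_div, Finset.sum_const, Finset.card_univ, nsmul_eq_mul,
      ← hk₀]
    calc _ ≤ (a₀ * k₀ + a₀ ^ 2 * (k₀ / b₀)) / a₀ ^ 2 - k₀ * (1 / b₀) := by gcongr
      _ = k₀ / a₀ := by
        field_simp
        ring
  -- Cauchy–Schwarz over pairs of a key and a value passes from `L²` to `L¹`.
  have h4 : (∑ k, ∑ b, |freq (H k) b - 1 / b₀|) ^ 2 ≤ k₀ ^ 2 * (b₀ / a₀) := by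
    rw [← Finset.sum_product', ← Finset.sum_product'] at *
    refine sq_sum_le_card_mul_sum_sq.trans ?_
    rw [Finset.card_product, Finset.card_univ, Finset.card_univ]
    push_cast
    rw [← hk₀, ← hb₀]
    calc k₀ * b₀ * _ ≤ k₀ * b₀ * (k₀ / a₀) := by gcongr
      _ = _ := by ring
  rw [Fintype.expect_eq_sum_div_card, div_le_iff₀ hk]
  refine (Real.le_sqrt_of_sq_le h4).trans_eq ?_
  rw [Real.sqrt_mul (by positivity), Real.sqrt_sq hk.le, mul_comm]

/-- All `m` hash values share one key. The hybrid argument is carried out for each fixed key and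
only then averaged, so the test may depend on the key. -/
theorem abs_expect_hash_le [Nonempty α] [Nonempty β] [Nonempty κ] (H : κ → α → β)
    (hH : ∀ a a', a ≠ a' →
      Fintype.card β * (Finset.univ.filter fun k => H k a = H k a').card = Fintype.card κ)
    {m : ℕ} (F : κ → (Fin m → β) → ℝ) (h0 : ∀ k b, 0 ≤ F k b) (h1 : ∀ k b, F k b ≤ 1) :
    |𝔼 k, 𝔼 a : Fin m → α, F k (H k ∘ a) - 𝔼 k, 𝔼 b, F k b| ≤
      m * Real.sqrt ((Fintype.card β : ℝ) / Fintype.card α) := by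
  rw [← Finset.expect_sub_distrib]
  refine (Finset.abs_expect_le _ _).trans ?_
  calc _ ≤ 𝔼 k, (m : ℝ) * ∑ b, |freq (H k) b - 1 / Fintype.card β| :=
        Finset.expect_le_expect fun k _ => abs_expect_comp_sub_le
          (fun ψ hψ0 hψ1 => abs_expect_sub_le_sum (H k) ψ hψ0 hψ1) (F k) (h0 k) (h1 k)
    _ = m * 𝔼 k, ∑ b, |freq (H k) b - 1 / Fintype.card β| := by rw [Finset.mul_expect]
    _ ≤ _ := by
        gcongr
        exact expect_sum_abs_freq_le H hH

end Hash

end GSWStream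

/-! ### Pseudorandomness of keys and ciphertexts for fixed parameters. -/

namespace GSWStream

open scoped BigOperators

/-! ### Uniform distributions -/

section Uniform

variable {α β γ : Type*} [Fintype α] [Nonempty α]

theorem uniform_bind_toReal (f : α → PMF β) (b : β) :
    (((PMF.uniformOfFintype α).bind f) b).toReal = 𝔼 a, (f a b).toReal := by
  rw [PMF.bind_apply, tsum_fintype, ENNReal.toReal_sum fun a _ =>
    ENNReal.mul_ne_top (PMF.apply_ne_top _ _) (PMF.apply_ne_top _ _),
    Fintype.expect_eq_sum_div_card, Finset.sum_div]
  refine Finset.sum_congr rfl fun a _ => ?_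
  rw [PMF.uniformOfFintype_apply, ENNReal.toReal_mul, ENNReal.toReal_inv, ENNReal.toReal_natCast]
  ring

theorem uniform_map_toReal [DecidableEq β] (f : α → β) (b : β) :
    (((PMF.uniformOfFintype α).map f) b).toReal = 𝔼 a, if f a = b then 1 else 0 := by
  rw [PMF.map, uniform_bind_toReal]
  refine Finset.expect_congr rfl fun a _ => ?_
  simp only [Function.comp, PMF.pure_apply, eq_comm]
  split_ifs <;> simp

theorem uniform_map_equiv [Fintype β] [Nonempty β] (e : α ≃ β) :
    (PMF.uniformOfFintype α).map e = PMF.uniformOfFintype β := by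
  classical
  ext b
  rw [PMF.map_apply, tsum_eq_single (e.symm b)]
  · simp [Fintype.card_congr e]
  · intro a ha
    rw [if_neg]
    rintro rfl
    simp at ha

end Uniform

variable {P : Params}

/-! ### Public keys -/

theorem bitsMat_snoc {l m : ℕ} (A : Matrix (Fin l) (Fin m) (ZMod P.q)) (v : Fin m → ZMod P.q) :
    bitsMat P (Fin.snoc (α := fun _ => Fin m → ZMod P.q) A v : Matrix (Fin (l + 1)) (Fin m) _) =
      bitsMat P A ++ bitsVec P v := by
  change (List.ofFn fun i => bitsVec P (Fin.snoc (α := fun _ => Fin m → ZMod P.q) A v i)).flatten =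
    (List.ofFn fun i => bitsVec P (A i)).flatten ++ bitsVec P v
  rw [List.ofFn_succ', List.concat_eq_append, List.flatten_append]
  congr 1
  · congr 2
    ext1 i
    exact congrArg _ (Fin.snoc_castSucc (α := fun _ => Fin m → ZMod P.q) _ _ i)
  · simp only [List.flatten_cons, List.flatten_nil, List.append_nil]
    exact congrArg _ (Fin.snoc_last (α := fun _ => Fin m → ZMod P.q) _ _)

theorem keyGen_bits : ((keyGen P).map fun κ => bitsMat P κ.1) =
    (lweSample P).map fun x => bitsMat P x.1 ++ bitsVec P x.2 := by
  rw [keyGen, PMF.bind_comm, lweSample]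
  simp only [PMF.map_bind, PMF.map_comp]
  congr 1
  funext A
  congr 1
  funext s
  congr 1
  funext e
  exact bitsMat_snoc A _

theorem uniform_ct_bits : (PMF.uniformOfFintype (Ct P)).map (bitsMat P) =
    (PMF.uniformOfFintype
        (Matrix (Fin P.g) (Fin P.h) (ZMod P.q) × (Fin P.h → ZMod P.q))).map
      fun x => bitsMat P x.1 ++ bitsVec P x.2 := by
  let e : (Matrix (Fin P.g) (Fin P.h) (ZMod P.q) × (Fin P.h → ZMod P.q)) ≃ Ct P :=
    -- The factors are swapped since `Fin.snocEquiv` expects the last row first.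
    (Equiv.prodComm _ _).trans (Fin.snocEquiv fun _ : Fin (P.g + 1) => Fin P.h → ZMod P.q)
  rw [← uniform_map_equiv e, PMF.map_comp]
  congr 1
  funext x
  exact bitsMat_snoc x.1 x.2

theorem indist_publicKey {T ε : ℝ} (h : LWEHard P T ε) :
    Indist T ε ((keyGen P).map fun κ => bitsMat P κ.1)
      ((PMF.uniformOfFintype (Ct P)).map (bitsMat P)) := by
  rw [keyGen_bits, uniform_ct_bits]
  exact h

/-! ### Public keys with ciphertexts -/

/-- A uniform matrix in place of the public key. -/
noncomputable def idealKeyCt (P : Params) (μ : Bool) : PMF (List Bool) :=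
  (PMF.uniformOfFintype (Ct P)).bind fun pk =>
    (PMF.uniformOfFintype (Matrix (Fin P.h) (Fin P.h) Bool)).map fun R =>
      bitsMat P pk ++ bitsMat P (enc P pk μ R)

/-- The randomness `R` is independent of the key, so the average over it can be taken outside. For
each fixed `R`, encryption followed by the distinguisher is a circuit acting on the key alone. -/
theorem abs_real_sub_ideal_le (hh : 0 < P.h) {T T' ε : ℝ}
    (h : Indist T ε ((keyGen P).map fun κ => bitsMat P κ.1)
      ((PMF.uniformOfFintype (Ct P)).map (bitsMat P)))
    (hT : T' + encSize P + 1 ≤ T) (μ : Bool) : Indist T' ε (realKeyCt P μ) (idealKeyCt P μ) := by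
  intro C hC
  have e1 : ∀ {α : Type} (p : PMF α) (k : α → Ct P),
      ((p.bind fun κ => (PMF.uniformOfFintype (Matrix (Fin P.h) (Fin P.h) Bool)).map fun R =>
        bitsMat P (k κ) ++ bitsMat P (enc P (k κ) μ R)).map (Circuit.eval C)) =
      (PMF.uniformOfFintype (Matrix (Fin P.h) (Fin P.h) Bool)).bind fun R =>
        p.map fun κ => Circuit.eval C (bitsMat P (k κ) ++ bitsMat P (enc P (k κ) μ R)) := by
    intro α p k
    simp only [PMF.map_bind, PMF.map_comp]
    simp only [PMF.map]
    rw [PMF.bind_comm]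
    rfl
  have e2 : (realKeyCt P μ).map (Circuit.eval C) = _ := e1 (keyGen P) Prod.fst
  have e3 : (idealKeyCt P μ).map (Circuit.eval C) = _ := e1 (PMF.uniformOfFintype (Ct P)) id
  rw [e2, e3, uniform_bind_toReal, uniform_bind_toReal, ← Finset.expect_sub_distrib]
  refine abs_expect_le_of_forall fun R => ?_
  obtain ⟨D, hD, hev⟩ := exists_encCircuit hh μ R C
  have hD' : (D.length : ℝ) ≤ T := by
    have : (D.length : ℝ) ≤ encSize P + C.length + 1 := by exact_mod_cast hD
    linarith
  have h1 := h D hD'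
  rw [PMF.map_comp, PMF.map_comp] at h1
  convert h1 using 6
  · funext κ
    exact (hev _).symm
  · funext κ
    exact (hev _).symm

/-- A collision means `A d = 0` for the difference `d` of the two vectors. Some coordinate of `d` is
`±1`, a unit for every modulus, so `A ↦ A d` is onto and all its fibres have equal size. Primality
of `q` is not needed. -/
theorem card_filter_vecMul_eq (r r' : Fin P.h → Bool) (hr : r ≠ r') :
    Fintype.card (Fin (P.g + 1) → ZMod P.q) * (Finset.univ.filter fun A : Ct P =>
      Matrix.mulVec A (fun t => if r t then (1 : ZMod P.q) else 0) =
        Matrix.mulVec A (fun t => if r' t then (1 : ZMod P.q) else 0)).card =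
      Fintype.card (Ct P) := by
  classical
  set d : Fin P.h → ZMod P.q :=
    (fun t => if r t then (1 : ZMod P.q) else 0) - fun t => if r' t then (1 : ZMod P.q) else 0
    with hd
  obtain ⟨t₀, ht₀⟩ := Function.ne_iff.1 hr
  have hunit : d t₀ * d t₀ = 1 := by
    rw [hd]
    cases h1 : r t₀ <;> cases h2 : r' t₀ <;> simp_all
  let f : Ct P →+ (Fin (P.g + 1) → ZMod P.q) :=
    { toFun := fun A => Matrix.mulVec A d
      map_zero' := Matrix.zero_mulVec d
      map_add' := fun A B => Matrix.add_mulVec A B d }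
  have hsurj : ∀ v, v ∈ Set.range f := by
    intro v
    refine ⟨Matrix.of fun i t => if t = t₀ then v i * d t₀ else 0, ?_⟩
    ext i
    change ∑ t : Fin P.h, _ * _ = _
    rw [Finset.sum_eq_single t₀]
    · simp [mul_assoc, hunit]
    · intro t _ ht
      simp [ht]
    · simp
  have h1 : (Finset.univ.filter fun A : Ct P =>
      Matrix.mulVec A (fun t => if r t then (1 : ZMod P.q) else 0) =
        Matrix.mulVec A (fun t => if r' t then (1 : ZMod P.q) else 0)) =
      Finset.univ.filter fun A => f A = 0 := by
    ext A
    simp only [Finset.mem_filter, Finset.mem_univ, true_and]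
    change _ ↔ Matrix.mulVec A d = 0
    rw [hd, Matrix.mulVec_sub, sub_eq_zero]
  rw [h1]
  have h2 := Finset.card_eq_sum_card_fiberwise (f := f) (s := Finset.univ) (t := Finset.univ)
    fun _ _ => Finset.mem_coe.2 (Finset.mem_univ _)
  rw [Finset.card_univ] at h2
  rw [h2, Finset.sum_congr rfl fun v _ =>
    AddMonoidHom.card_fiber_eq_of_mem_range f (hsurj v) (hsurj 0), Finset.sum_const,
    Finset.card_univ, smul_eq_mul]

/-- The statistical distance of encryptions under uniform keys from uniform matrices. -/
noncomputable def hashError (P : Params) : ℝ :=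
  P.h * Real.sqrt ((P.q : ℝ) ^ (P.g + 1) / 2 ^ P.h)

/-- The columns of `A R` are hashes of the columns of `R`, independent and uniform, under the common
key `A`. Adding the fixed matrix `μ G` does not change the uniform distribution. -/
theorem abs_ideal_sub_uniform_le (μ : Bool) (C : Circuit) :
    |(((idealKeyCt P μ).map (Circuit.eval C)) true).toReal -
      (((uniformKeyCt P).map (Circuit.eval C)) true).toReal| ≤ hashError P := by
  classical
  set G : Ct P := if μ then gadget P else 0 with hG
  set F : Ct P → (Fin P.h → Fin (P.g + 1) → ZMod P.q) → ℝ := fun A b =>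
    if Circuit.eval C (bitsMat P A ++ bitsMat P (Matrix.transpose (Matrix.of b) + G)) = true
      then 1 else 0 with hF
  have h := abs_expect_hash_le (κ := Ct P) (α := Fin P.h → Bool)
    (β := Fin (P.g + 1) → ZMod P.q) (fun A r => Matrix.mulVec A fun t => if r t then 1 else 0)
    card_filter_vecMul_eq F (fun A b => by simp only [hF]; split_ifs <;> norm_num)
    (fun A b => by simp only [hF]; split_ifs <;> norm_num)
  have e1 : (((idealKeyCt P μ).map (Circuit.eval C)) true).toReal =
      𝔼 A : Ct P, 𝔼 a : Fin P.h → Fin P.h → Bool,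
        F A ((fun r => Matrix.mulVec A fun t => if r t then 1 else 0) ∘ a) := by
    rw [idealKeyCt, PMF.map_bind, uniform_bind_toReal]
    refine Finset.expect_congr rfl fun A _ => ?_
    rw [PMF.map_comp, uniform_map_toReal]
    refine Fintype.expect_equiv (Equiv.piComm _) _ _ fun R => ?_
    simp only [hF, Function.comp]
    -- Hashing works column by column while matrices are stored by rows; hence the transposition.
    have : enc P A μ R = Matrix.transpose (Matrix.of ((fun r => Matrix.mulVec A fun t =>
        if r t then (1 : ZMod P.q) else 0) ∘ (Equiv.piComm _) R)) + G := rfl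
    exact if_congr (by simp only [this]) rfl rfl
  have e2 : (((uniformKeyCt P).map (Circuit.eval C)) true).toReal =
      𝔼 A : Ct P, 𝔼 b, F A b := by
    rw [uniformKeyCt, PMF.map_comp, uniform_map_toReal, ← Finset.univ_product_univ,
      Finset.expect_product]
    refine Finset.expect_congr rfl fun A _ => ?_
    refine (Fintype.expect_equiv ((Equiv.piComm _).trans (Equiv.addRight G)) _ _ fun b => ?_).symm
    simp only [hF, Function.comp]
    rfl
  rw [e1, e2]
  refine h.trans_eq ?_
  simp [hashError]

theorem indist_keyCt (hh : 0 < P.h) {T T' ε ε' : ℝ} (h : LWEHard P T ε)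
    (hT : T' + encSize P + 1 ≤ T) (hε : ε + hashError P ≤ ε') (μ : Bool) :
    Indist T' ε' (realKeyCt P μ) (uniformKeyCt P) := by
  intro C hC
  have h1 := abs_real_sub_ideal_le hh (indist_publicKey h) hT μ C hC
  have h2 := abs_ideal_sub_uniform_le (P := P) μ C
  have h3 := abs_sub_le (((realKeyCt P μ).map (Circuit.eval C)) true).toReal
    (((idealKeyCt P μ).map (Circuit.eval C)) true).toReal
    (((uniformKeyCt P).map (Circuit.eval C)) true).toReal
  linarith

end GSWStream

/-! ### Growth of the parameters with `n`. -/

namespace GSWStream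

/-! ### Growth of the parameters -/

theorem one_le_logb {n : ℕ} (hn : 2 ≤ n) : 1 ≤ Real.logb 2 n := by
  rw [Real.le_logb_iff_rpow_le one_lt_two (by positivity), Real.rpow_one]
  exact_mod_cast hn

theorem logb_le_clog (n : ℕ) : Real.logb 2 n ≤ Nat.clog 2 n := by
  rcases Nat.eq_zero_or_pos n with rfl | hn
  · simp
  rw [Real.logb_le_iff_le_rpow one_lt_two (by positivity), Real.rpow_natCast]
  exact_mod_cast Nat.le_pow_clog one_lt_two n

theorem clog_le_two_mul_logb {n : ℕ} (hn : 2 ≤ n) : (Nat.clog 2 n : ℝ) ≤ 2 * Real.logb 2 n := by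
  have h1 : 2 ^ (Nat.clog 2 n - 1) < n := by
    have h0 : 0 < Nat.clog 2 n := Nat.clog_pos one_lt_two hn
    exact Nat.pow_pred_clog_lt_self one_lt_two hn
  have h2 : ((Nat.clog 2 n - 1 : ℕ) : ℝ) ≤ Real.logb 2 n := by
    rw [Real.le_logb_iff_rpow_le one_lt_two (by positivity), Real.rpow_natCast]
    exact_mod_cast h1.le
  have h3 : (Nat.clog 2 n : ℝ) ≤ ((Nat.clog 2 n - 1 : ℕ) : ℝ) + 1 := by
    exact_mod_cast (by omega : Nat.clog 2 n ≤ Nat.clog 2 n - 1 + 1)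
  linarith [one_le_logb hn]

theorem rpow_logb_le_secParam (r : ℝ) (n : ℕ) : Real.logb 2 n ^ r ≤ secParam r n := Nat.le_ceil _

theorem one_le_secParam {r : ℝ} (hr : 0 < r) {n : ℕ} (hn : 2 ≤ n) : 1 ≤ secParam r n := by
  have := (Real.one_le_rpow (one_le_logb hn) hr.le).trans (rpow_logb_le_secParam r n)
  exact_mod_cast this

theorem secParam_le {r : ℝ} (hr : 0 < r) {n : ℕ} (hn : 2 ≤ n) :
    (secParam r n : ℝ) ≤ 2 * Real.logb 2 n ^ r := by
  have h := Real.one_le_rpow (one_le_logb hn) hr.le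
  have := (Nat.ceil_lt_add_one (zero_le_one.trans h)).le
  unfold secParam
  linarith

theorem secParam_le_clog_pow {r : ℝ} (hr : 0 < r) {n : ℕ} (hn : 2 ≤ n) :
    secParam r n ≤ Nat.clog 2 n ^ ⌈r⌉₊ := by
  refine Nat.ceil_le.2 ?_
  have h1 := one_le_logb hn
  have h2 := logb_le_clog n
  push_cast
  rw [← Real.rpow_natCast]
  calc Real.logb 2 n ^ r ≤ (Nat.clog 2 n : ℝ) ^ r := by gcongr
    _ ≤ (Nat.clog 2 n : ℝ) ^ (⌈r⌉₊ : ℝ) :=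
      Real.rpow_le_rpow_of_exponent_le (h1.trans h2) (Nat.le_ceil r)

theorem clog_le_secParam_pow {r : ℝ} (hr : 0 < r) {n : ℕ} (hn : 2 ≤ n) :
    Nat.clog 2 n ≤ secParam r n ^ ⌈1 / r⌉₊ := by
  have h1 := one_le_logb hn
  have h2 : Real.logb 2 n ≤ ((secParam r n ^ ⌈1 / r⌉₊ : ℕ) : ℝ) := by
    push_cast
    rw [← Real.rpow_natCast]
    calc Real.logb 2 n = (Real.logb 2 n ^ r) ^ (1 / r) := by
          rw [← Real.rpow_mul (by linarith), mul_one_div_cancel hr.ne', Real.rpow_one]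
      _ ≤ (secParam r n : ℝ) ^ (1 / r) := by
          have := rpow_logb_le_secParam r n
          gcongr
      _ ≤ (secParam r n : ℝ) ^ (⌈1 / r⌉₊ : ℝ) :=
          Real.rpow_le_rpow_of_exponent_le (by exact_mod_cast one_le_secParam hr hn)
            (Nat.le_ceil _)
  rw [Real.logb_le_iff_le_rpow one_lt_two (by positivity), Real.rpow_natCast] at h2
  exact Nat.clog_le_of_le_pow (by exact_mod_cast h2)

theorem tendsto_logb : Tendsto (fun n : ℕ => Real.logb 2 n) atTop atTop :=
  (Real.tendsto_logb_atTop one_lt_two).comp tendsto_natCast_atTop_atTop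

theorem tendsto_secParam {r : ℝ} (hr : 0 < r) : Tendsto (secParam r) atTop atTop :=
  tendsto_nat_ceil_atTop.comp ((tendsto_rpow_atTop hr).comp tendsto_logb)

/-- The assumptions on the parameters, with explicit constants: `m` is the security parameter. -/
structure Regime (params : ℕ → Params) (r : ℝ) (K C : ℕ) : Prop where
  r_pos : 0 < r
  dim : ∀ m, (params m).g = m
  le_h : ∀ m ≥ 1, 2 * (m + 1) * (params m).len ≤ (params m).h
  h_le : ∀ m ≥ 1, (params m).h ≤ K * (m * (params m).len)
  lt_q : ∀ n ≥ 2, n < (params (secParam r n)).q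
  len_le : ∀ n ≥ 2, (params (secParam r n)).len ≤ C * Nat.clog 2 n

/-- A modulus polynomial in `n` has `O(log n)` bits, with a constant depending on the polynomial
only. -/
theorem clog_le_mul_clog {K a n q : ℕ} (hn : 2 ≤ n) (hq : q ≤ K * n ^ a) :
    Nat.clog 2 q ≤ (Nat.clog 2 K + a) * Nat.clog 2 n := by
  have h0 : 0 < Nat.clog 2 n := Nat.clog_pos one_lt_two hn
  refine Nat.clog_le_of_le_pow (hq.trans ?_)
  calc K * n ^ a ≤ 2 ^ Nat.clog 2 K * (2 ^ Nat.clog 2 n) ^ a := by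
        gcongr <;> exact Nat.le_pow_clog one_lt_two _
    _ = 2 ^ (Nat.clog 2 K + Nat.clog 2 n * a) := by rw [← pow_mul, ← pow_add]
    _ ≤ 2 ^ ((Nat.clog 2 K + a) * Nat.clog 2 n) := by
        refine Nat.pow_le_pow_right (by norm_num) ?_
        nlinarith [Nat.zero_le (Nat.clog 2 K)]

/-- A word length that suffices for all computations. -/
def wordLength (P : Params) (n : ℕ) : ℕ :=
  (Nat.clog 2 n + 1) * ((P.g + 1) * P.h) + 2 * P.len + 1

namespace Regime

variable {params : ℕ → Params} {r : ℝ} {K C : ℕ}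

theorem roomFor (hR : Regime params r K C) {n : ℕ} (hn : 2 ≤ n) :
    RoomFor (params (secParam r n)) n (wordLength (params (secParam r n)) n) := by
  set P := params (secParam r n) with hP
  have hg : P.g = secParam r n := hR.dim _
  have hw := hR.le_h _ (one_le_secParam hR.r_pos hn)
  have hlt := hR.lt_q n hn
  have hq := P.q_le
  have hb : ((P.g + 1) * P.h) ≤ (Nat.clog 2 n + 1) * ((P.g + 1) * P.h) :=
    Nat.le_mul_of_pos_left _ (by omega)
  refine ⟨?_, ?_, ?_, ?_, ?_, hlt⟩
  · unfold wordLength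
    omega
  -- The factor in front is replaced by the crude bound `x ≤ 2 ^ x`; the first summand of the word
  -- length pays for it.
  · calc (P.g + 1) * P.h * P.q ^ 2 ≤ 2 ^ ((P.g + 1) * P.h) * (2 ^ P.len) ^ 2 := by
          gcongr
          exact Nat.lt_two_pow_self.le
      _ = 2 ^ ((P.g + 1) * P.h + P.len * 2) := by rw [← pow_mul, ← pow_add]
      _ ≤ 2 ^ wordLength P n := Nat.pow_le_pow_right (by norm_num) (by unfold wordLength; omega)
  · calc 2 * 2 ^ P.len * P.q ≤ 2 * 2 ^ P.len * 2 ^ P.len := by gcongr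
      _ = 2 ^ (P.len * 2 + 1) := by ring
      _ ≤ 2 ^ wordLength P n := Nat.pow_le_pow_right (by norm_num) (by unfold wordLength; omega)
  · rw [← hP, ← hg] at hw
    nlinarith [Nat.zero_le ((P.g + 1) * P.len)]
  · exact Nat.clog_mono_right 2 hlt.le

theorem wordLength_le (hR : Regime params r K C) {n : ℕ} (hn : 2 ≤ n) :
    wordLength (params (secParam r n)) n ≤
      (4 * (K * C) + 2 * C + 1) * (Nat.clog 2 n * secParam r n) ^ 2 := by
  have hm := one_le_secParam hR.r_pos hn
  have hl : 1 ≤ Nat.clog 2 n := Nat.clog_pos one_lt_two hn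
  have hh := hR.h_le _ hm
  have hlen := hR.len_le n hn
  rw [wordLength, hR.dim]
  generalize secParam r n = m at *
  generalize Nat.clog 2 n = l at *
  have h1 : (params m).h ≤ K * (m * (C * l)) := hh.trans (by gcongr)
  have h2 : l ≤ (l * m) ^ 2 := by
    calc l = l * 1 := by ring
      _ ≤ l * m * (l * m) := Nat.mul_le_mul (Nat.le_mul_of_pos_right _ hm) (Nat.mul_pos hl hm)
      _ = _ := by ring
  calc (l + 1) * ((m + 1) * (params m).h) + 2 * (params m).len + 1
      ≤ (l + l) * ((m + m) * (K * (m * (C * l)))) + 2 * (C * l) + l := by gcongr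
    _ = 4 * (K * C) * (l * m) ^ 2 + (2 * C + 1) * l := by ring
    _ ≤ 4 * (K * C) * (l * m) ^ 2 + (2 * C + 1) * (l * m) ^ 2 := by gcongr
    _ = _ := by ring

theorem exists_wordLength_le (hR : Regime params r K C) : ∃ B d : ℕ, ∀ n ≥ 2,
    wordLength (params (secParam r n)) n ≤ B * secParam r n ^ d ∧
      wordLength (params (secParam r n)) n ≤ B * Nat.clog 2 n ^ d := by
  refine ⟨4 * (K * C) + 2 * C + 1, (⌈1 / r⌉₊ + ⌈r⌉₊ + 1) * 2, fun n hn => ?_⟩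
  have hm := one_le_secParam hR.r_pos hn
  have hl : 1 ≤ Nat.clog 2 n := Nat.clog_pos one_lt_two hn
  have h := hR.wordLength_le hn
  have h1 := clog_le_secParam_pow hR.r_pos hn
  have h2 := secParam_le_clog_pow hR.r_pos hn
  rw [pow_mul, pow_mul]
  refine ⟨h.trans ?_, h.trans ?_⟩ <;> gcongr
  · calc Nat.clog 2 n * secParam r n ≤ secParam r n ^ ⌈1 / r⌉₊ * secParam r n := by gcongr
      _ = secParam r n ^ (⌈1 / r⌉₊ + 1) := (pow_succ _ _).symm
      _ ≤ _ := Nat.pow_le_pow_right hm (by omega)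
  · calc Nat.clog 2 n * secParam r n ≤ Nat.clog 2 n * Nat.clog 2 n ^ ⌈r⌉₊ := by gcongr
      _ = Nat.clog 2 n ^ (⌈r⌉₊ + 1) := (pow_succ' _ _).symm
      _ ≤ _ := Nat.pow_le_pow_right hl (by omega)

/-- One pair of constants gives both forms, polynomial in the security parameter for the decoder and
polynomial in `log n` for the stream. The power of 2 comes from rounding `log n` up. -/
theorem exists_polyBdd_le (hR : Regime params r K C) {f : ℕ → ℕ} (hf : PolyBdd f) :
    ∃ B d : ℕ, ∀ n ≥ 2, f (wordLength (params (secParam r n)) n) ≤ B * secParam r n ^ d ∧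
      (f (wordLength (params (secParam r n)) n) : ℝ) ≤ B * Real.logb 2 n ^ d := by
  obtain ⟨B, d, h⟩ := hR.exists_wordLength_le
  obtain ⟨B', d', h'⟩ := hf
  refine ⟨B' * B ^ d' * 2 ^ (d * d'), d * d', fun n hn => ?_⟩
  obtain ⟨h1, h2⟩ := h n hn
  have h3 := h' _ (show 1 ≤ wordLength (params (secParam r n)) n by unfold wordLength; omega)
  constructor
  · calc _ ≤ B' * wordLength (params (secParam r n)) n ^ d' := h3
      _ ≤ B' * (B * secParam r n ^ d) ^ d' := by gcongr
      _ = B' * B ^ d' * 1 * secParam r n ^ (d * d') := by rw [mul_pow, ← pow_mul]; ring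
      _ ≤ _ := by
        gcongr
        exact Nat.one_le_two_pow
  · have hx := clog_le_two_mul_logb hn
    calc (f (wordLength (params (secParam r n)) n) : ℝ)
        ≤ ((B' * (B * Nat.clog 2 n ^ d) ^ d' : ℕ) : ℝ) := by
          exact_mod_cast h3.trans (by gcongr)
      _ = B' * (B * (Nat.clog 2 n : ℝ) ^ d) ^ d' := by push_cast; rfl
      _ ≤ B' * (B * (2 * Real.logb 2 n) ^ d) ^ d' := by gcongr
      _ = _ := by
        push_cast
        simp only [mul_pow, ← pow_mul]
        ring

end Regime

end GSWStream

/-! ### The three claims for the family of parameters. -/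

namespace GSWStream

variable {params : ℕ → Params} {r : ℝ} {K C : ℕ}

/-! ### Decoding of linear combinations -/

/-- The Gaussian factor has `m ^ 2` in the exponent. It pays for `2 ^ (-m)` and for a further `exp
(-m)`, which absorbs the polynomial. -/
theorem eventually_mul_exp_le (B d : ℕ) : ∀ᶠ m : ℕ in atTop,
    (B * m ^ d : ℝ) * (Real.sqrt 2 * Real.exp (-Real.pi * m ^ 2 / 2)) ≤ 2 ^ (-(m : ℝ)) := by
  have h := ((Real.tendsto_pow_mul_exp_neg_atTop_nhds_zero d).const_mul
    (B * Real.sqrt 2)).comp (tendsto_natCast_atTop_atTop (R := ℝ))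
  rw [mul_zero] at h
  filter_upwards [h.eventually (gt_mem_nhds zero_lt_one), eventually_ge_atTop 2] with m h1 hm
  have hm' : (2 : ℝ) ≤ m := by exact_mod_cast hm
  simp only [Function.comp] at h1
  have h2 : Real.exp (-Real.pi * m ^ 2 / 2) ≤ Real.exp (-m) * 2 ^ (-(m : ℝ)) := by
    rw [Real.rpow_def_of_pos two_pos, ← Real.exp_add]
    refine Real.exp_le_exp.2 ?_
    nlinarith [Real.pi_gt_three, Real.log_two_lt_d9]
  calc (B * m ^ d : ℝ) * (Real.sqrt 2 * Real.exp (-Real.pi * m ^ 2 / 2))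
      ≤ (B * m ^ d : ℝ) * (Real.sqrt 2 * (Real.exp (-m) * 2 ^ (-(m : ℝ)))) := by gcongr
    _ = (B * Real.sqrt 2 * (m ^ d * Real.exp (-m))) * 2 ^ (-(m : ℝ)) := by ring
    _ ≤ 1 * 2 ^ (-(m : ℝ)) := by gcongr
    _ = _ := one_mul _

theorem Regime.linearHomomorphism (hR : Regime params r K C) : LinearHomomorphism params r := by
  obtain ⟨B, d, hB⟩ := hR.exists_polyBdd_le
    -- The square of the word length is added to cover the bit length of a ciphertext and the factor
    -- `h` of the union bound.
    (decodeCmd.polyBdd_bnd.add (PolyBdd.id.mul PolyBdd.id))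
  refine ⟨decodeCmd, B, d, fun n hn k κ X _ => ⟨?_, fun M HM => ?_⟩, ?_⟩
  · have R := hR.roomFor hn
    refine le_trans ?_ (hB n hn).1
    rw [length_bitsMat, ← mul_assoc]
    exact (Nat.mul_le_mul R.size_le R.len_le).trans (Nat.le_add_left _ _)
  · have h := (decodeCmd_safe (hR.roomFor hn) HM Unit noSub ()).2.2
    exact (h.trans (Nat.le_add_right _ _)).trans (hB n hn).1
  · obtain ⟨n₀, hn₀⟩ := eventually_atTop.1 (((tendsto_secParam hR.r_pos).eventually
      (eventually_mul_exp_le B d)).and (eventually_ge_atTop 2))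
    refine ⟨n₀, fun n hn => ?_⟩
    obtain ⟨h1, hn2⟩ := hn₀ n hn.le
    have R := hR.roomFor hn2
    set m := secParam r n with hm
    set P := params m with hP
    have hhle : (P.h : ℝ) ≤ B * m ^ d := by
      have h2 := (hB n hn2).1
      have h3 := R.h_le
      have h4 := R.one_le
      rw [← hm, ← hP] at h2
      exact_mod_cast h3.trans ((Nat.le_mul_of_pos_left _ h4).trans
        ((Nat.le_add_left _ _).trans h2))
    have hsmall : (P.h : ENNReal) * ENNReal.ofReal
        (Real.sqrt 2 * Real.exp (-Real.pi * (m : ℝ) ^ 2 / 2)) ≤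
          ENNReal.ofReal (2 ^ (-(m : ℝ))) := by
      rw [← ENNReal.ofReal_natCast, ← ENNReal.ofReal_mul (by positivity)]
      refine ENNReal.ofReal_le_ofReal (le_trans ?_ h1)
      gcongr
    calc ENNReal.ofReal (1 - 2 ^ (-(m : ℝ)))
        = 1 - ENNReal.ofReal (2 ^ (-(m : ℝ))) := by
          rw [ENNReal.ofReal_sub _ (by positivity), ENNReal.ofReal_one]
      _ ≤ _ := tsub_le_tsub_left hsmall 1
      -- The tail bound with `t = m`, hence noise at most `σ m`, as in the condition on `q`.
      _ ≤ _ := keyGen_noise_small P (Nat.cast_nonneg m)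
      _ ≤ _ := by
          refine (keyGen P).toOuterMeasure.mono ?_
          rintro κ ⟨hs, hpk⟩ K Xmax x μ ct hct hx hq k M HM
          rw [(decodeCmd_safe R HM Unit noSub ()).1]
          exact decode_correct R hn2 (mul_nonneg P.σ_pos.le (Nat.cast_nonneg m)) hs hpk hct hx hq

/-! ### Complexity of the streaming algorithm -/

theorem ofFn_flatten_injective {α β : Type*} {l N : ℕ} {f : α → List β}
    (hf : Function.Injective f) (hN : ∀ a, (f a).length = N) {x y : Fin l → α}
    (h : (List.ofFn fun j => f (x j)).flatten = (List.ofFn fun j => f (y j)).flatten) : x = y := by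
  have h1 := List.eq_iff_flatten_eq.2 ⟨h, by simp [List.map_ofFn, Function.comp_def, hN]⟩
  have h2 := List.ofFn_injective h1
  funext j
  exact hf (congrFun h2 j)

theorem length_flatten_ofFn {α : Type*} {l N : ℕ} {f : Fin l → List α}
    (hN : ∀ j, (f j).length = N) : (List.ofFn f).flatten.length = l * N := by
  simp [List.length_flatten, List.map_ofFn, Function.comp_def, hN]

variable {P : Params}

theorem Stored.bits_injective {l : ℕ} :
    Function.Injective (Stored.bits : Stored P l → List Bool) := by
  rintro ⟨pk, cts, sk⟩ ⟨pk', cts', sk'⟩ h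
  simp only [Stored.bits, List.append_assoc] at h
  obtain ⟨h1, h2⟩ := List.append_inj h (by rw [length_bitsMat, length_bitsMat])
  obtain ⟨h3, h4⟩ := List.append_inj h2 (by
    rw [length_flatten_ofFn fun j => length_bitsMat _, length_flatten_ofFn fun j => length_bitsMat _])
  rw [bitsMat_injective h1, bitsMat_injective h4,
    ofFn_flatten_injective bitsMat_injective (fun A => length_bitsMat A) h3]

theorem Stored.length_bits {l : ℕ} (D : Stored P l) :
    D.bits.length = (l + 2) * ((P.g + 1) * (P.h * P.len)) := by
  rw [Stored.bits, List.length_append, List.length_append, length_bitsMat, length_bitsMat,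
    length_flatten_ofFn fun j => length_bitsMat _]
  ring

theorem inner_streamAfter {n : ℕ} {A : RecoveryAlg n} (s₀ : StreamState A P)
    (u : List (Fin n × ℤ)) :
    (streamAfter s₀ u).inner = u.foldl (fun s p => A.update s p.1 p.2) s₀.inner := by
  induction u generalizing s₀ with
  | nil => rfl
  | cons p u ih => exact ih _

theorem inner_of_mem_support {n : ℕ} {A : RecoveryAlg n} {s₀ : StreamState A P}
    (h : s₀ ∈ (streamSetup A P).support) : s₀.inner = A.setup := by
  simp only [streamSetup, PMF.mem_support_bind_iff, PMF.mem_support_map_iff] at h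
  obtain ⟨pk, -, cts, -, rfl⟩ := h
  rfl

/-- The coordinate is bounded by `N` both before and after the update, which is their difference. -/
theorem BoundedStream.abs_update_le {n N : ℕ} {u : List (Fin n × ℤ)} {i : Fin n} {Δ : ℤ}
    (h : BoundedStream N (u ++ [(i, Δ)])) : |Δ| ≤ 2 * N := by
  have h1 := h _ (List.prefix_append u _) i
  have h2 := h _ (List.prefix_refl _) i
  have h3 : accumulate (u ++ [(i, Δ)]) i = accumulate u i + Δ := by simp [accumulate]
  rw [h3] at h2
  rw [abs_le] at *
  constructor <;> linarith [h1.1, h1.2, h2.1, h2.2]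

theorem Regime.streamComplexity (hR : Regime params r K C) {N : ℕ → ℕ}
    (hN : ∀ n ≥ 2, N n < (params (secParam r n)).q) : StreamComplexity params N r := by
  -- Update time, report time per list entry and storage are summed, so that one pair of constants
  -- serves all three.
  obtain ⟨B, d, hB⟩ := hR.exists_polyBdd_le (((sketchCmd.polyBdd_bnd.add (.const 1)).add
    (verifyCmd.polyBdd_bnd.add (.const 1))).add ((PolyBdd.const 2).mul (PolyBdd.id.mul PolyBdd.id)))
  refine ⟨updateCmd, reportCmd, B, d, fun n hn => ⟨⟨Stored.bits_injective, fun D => ?_⟩, ?_⟩⟩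
  · have R := hR.roomFor hn
    refine le_trans (Nat.cast_le.2 ?_) (hB n hn).2
    rw [D.length_bits]
    refine le_trans ?_ (Nat.le_add_left _ _)
    have h1 := Nat.mul_le_mul R.cells R.len_le
    refine le_trans ?_ (Nat.mul_le_mul_left 2 h1)
    rw [← mul_assoc, ← mul_assoc, ← mul_assoc, ← mul_assoc]
    refine Nat.mul_le_mul_right _ ?_
    rw [← mul_assoc]
    exact Nat.mul_le_mul_right _ (Nat.mul_le_mul_right _ (by omega))
  · intro k A hk1 hkn hA s₀ hs₀ u hu M HM
    have R := hR.roomFor hn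
    have hNq := hN n hn
    have hq := R.two_mul_q_le
    obtain ⟨hb, hb'⟩ := hB n hn
    generalize wordLength (params (secParam r n)) n = L at *
    have h2N : (2 * N n : ℤ) ≤ 2 ^ L := by exact_mod_cast (by omega : 2 * N n ≤ 2 ^ L)
    push_cast at hb'
    have hv : (0 : ℝ) ≤ verifyCmd.bnd L := Nat.cast_nonneg _
    have hs : (0 : ℝ) ≤ sketchCmd.bnd L := Nat.cast_nonneg _
    have hL : (0 : ℝ) ≤ L * L := by positivity
    constructor
    · intro i Δ hΔ hi hMΔ
      obtain ⟨h1, h2, h3⟩ := updateCmd_run R HM hi hMΔ (hΔ.abs_update_le.trans h2N)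
      refine ⟨h1, h2, ?_⟩
      have h4 : ((updateCmd.run (updateSub A) (M, (streamAfter s₀ u).inner)).2 : ℝ) ≤
          sketchCmd.bnd L + 1 + A.updateTime (streamAfter s₀ u).inner i Δ := by exact_mod_cast h3
      linarith
    · have hin : (streamAfter s₀ u).inner = A.after u := by
        rw [inner_streamAfter, inner_of_mem_support hs₀]
        rfl
      obtain ⟨h1, h2, h3, h4⟩ := reportCmd_run R HM hk1 hkn fun i => by
        rw [hin]
        have := (hA u hu).2 i
        linarith
      refine ⟨h1, h2, h3, ?_⟩
      have h5 : ((reportCmd.run (reportSub A) (M, (streamAfter s₀ u).inner)).2 : ℝ) ≤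
          k * verifyCmd.bnd L + 1 + A.reportTime (streamAfter s₀ u).inner := by exact_mod_cast h4
      have hk : (1 : ℝ) ≤ k := by exact_mod_cast hk1
      have h6 : (k : ℝ) * (verifyCmd.bnd L + 1) ≤ k * (B * Real.logb 2 n ^ d) := by
        gcongr
        linarith
      linarith

/-! ### Pseudorandomness -/

theorem eventually_rpow_add_rpow_le {a b s δ : ℝ} (ha : a < s) (hb : b < s) (hδ : 0 < δ) (D : ℝ) :
    ∀ᶠ x : ℝ in atTop, x ^ a + D * x ^ b ≤ δ * x ^ s := by
  have key : ∀ {t : ℝ}, t < s → ∀ E : ℝ, ∀ᶠ x : ℝ in atTop, E * x ^ t ≤ δ / 2 * x ^ s := by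
    intro t hts E
    filter_upwards [((tendsto_rpow_atTop (sub_pos.2 hts)).const_mul_atTop
      (half_pos hδ)).eventually_ge_atTop E, eventually_gt_atTop 0] with x hE hx
    calc E * x ^ t ≤ δ / 2 * x ^ (s - t) * x ^ t := by gcongr
      _ = δ / 2 * x ^ s := by rw [mul_assoc, ← Real.rpow_add hx, sub_add_cancel]
  filter_upwards [key ha 1, key hb D] with x h1 h2
  linarith

theorem eventually_pow_le_two_rpow (B : ℝ) (d : ℕ) :
    ∀ᶠ x : ℝ in atTop, B * x ^ d ≤ 2 ^ x := by
  have h := (isLittleO_pow_exp_pos_mul_atTop d (Real.log_pos one_lt_two)).const_mul_left B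
  filter_upwards [h.def one_pos] with x hx
  rw [one_mul, Real.norm_eq_abs, Real.norm_eq_abs, abs_of_pos (Real.exp_pos _)] at hx
  rw [Real.rpow_def_of_pos two_pos]
  exact (le_abs_self _).trans hx

/-- From `q ≤ 2 ^ len` and `h ≥ 2 (g + 1) len`, the quotient under the root is at most `2 ^ (-(g +
1) len)`: half of the columns compensate the range of the hash, the other half give the error. -/
theorem hashError_le (hw : 2 * (P.g + 1) * P.len ≤ P.h) :
    hashError P ≤ P.h * 2 ^ (-((P.g + 1) * P.len : ℝ) / 2) := by
  unfold hashError
  gcongr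
  rw [Real.sqrt_le_left (by positivity), ← Real.rpow_natCast (2 ^ (_ : ℝ)) 2,
    ← Real.rpow_mul two_pos.le, div_le_iff₀ (by positivity), ← Real.rpow_natCast 2 P.h,
    ← Real.rpow_add two_pos]
  have hq : (P.q : ℝ) ≤ 2 ^ (P.len : ℝ) := by
    rw [Real.rpow_natCast]
    exact_mod_cast P.q_le
  have hw' : (2 * (P.g + 1) * P.len : ℝ) ≤ P.h := by exact_mod_cast hw
  calc (P.q : ℝ) ^ (P.g + 1) ≤ (2 ^ (P.len : ℝ)) ^ (P.g + 1) := by gcongr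
    _ = 2 ^ ((P.len : ℝ) * (P.g + 1)) := by
      rw [← Real.rpow_natCast, ← Real.rpow_mul two_pos.le]
      push_cast
      rfl
    _ ≤ _ := by
      refine Real.rpow_le_rpow_of_exponent_le one_le_two ?_
      push_cast
      linarith

/-- The circuit has `2 ^ O(log n)` gates. As `r b > 1`, the exponent is eventually below `(log n) ^
(r b)`, which is at most the `b`-th power of the security parameter. -/
theorem Regime.eventually_encSize_le (hR : Regime params r K C) {b : ℝ} (hb : 1 / r < b) :
    ∀ᶠ n in atTop, (encSize (params (secParam r n)) + 1 : ℝ) ≤ 2 ^ ((secParam r n : ℝ) ^ b) := by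
  obtain ⟨B, d, hB⟩ := hR.exists_polyBdd_le ((PolyBdd.const 8).mul
    (PolyBdd.id.mul (PolyBdd.id.mul PolyBdd.id)) |>.add (.const 1))
  have hr := hR.r_pos
  have hrb : 1 < r * b := by rwa [div_lt_iff₀' hr] at hb
  have hb0 : 0 < b := (by positivity : (0 : ℝ) < 1 / r).trans hb
  filter_upwards [tendsto_logb.eventually (eventually_pow_le_two_rpow B d),
    -- The constant `4 C` bounds `2 len / log n`; the first summand absorbs the polylogarithmic
    -- factor.
    tendsto_logb.eventually (eventually_rpow_add_rpow_le hrb hrb one_pos (4 * C)),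
    eventually_ge_atTop 2] with n h1 h2 hn
  have R := hR.roomFor hn
  have hlen := hR.len_le n hn
  have hx1 := one_le_logb hn
  have hm := rpow_logb_le_secParam r n
  have hcl := clog_le_two_mul_logb hn
  have h3 := (hB n hn).2
  generalize wordLength (params (secParam r n)) n = L at *
  generalize params (secParam r n) = P at *
  generalize Real.logb 2 n = x at *
  have henc : encSize P + 1 ≤ (8 * (L * (L * L)) + 1) * 2 ^ (P.len + P.len) := by
    have : encSize P ≤ L * ((L + L) * (L * (4 * 2 ^ (P.len + P.len)))) := by
      unfold encSize opSize
      gcongr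
      · exact R.size_le
      · exact R.h_le
      · exact R.one_le
      · exact R.len_le
    nlinarith [Nat.one_le_two_pow (n := P.len + P.len)]
  have hlen' : (P.len : ℝ) ≤ C * (2 * x) :=
    le_trans (by exact_mod_cast hlen) (mul_le_mul_of_nonneg_left hcl (Nat.cast_nonneg C))
  rw [Real.rpow_one, one_mul] at h2
  calc (encSize P + 1 : ℝ) ≤ ((8 * (L * (L * L)) + 1 : ℕ) : ℝ) * 2 ^ (P.len + P.len) := by
        exact_mod_cast henc
    _ ≤ 2 ^ x * 2 ^ (4 * C * x) := by
        refine mul_le_mul (h3.trans h1) ?_ (by positivity) (by positivity)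
        rw [← Real.rpow_natCast]
        refine Real.rpow_le_rpow_of_exponent_le one_le_two ?_
        push_cast
        linarith
    _ = 2 ^ (x + 4 * C * x) := (Real.rpow_add two_pos _ _).symm
    _ ≤ 2 ^ ((secParam r n : ℝ) ^ b) := by
        refine Real.rpow_le_rpow_of_exponent_le one_le_two (h2.trans ?_)
        rw [Real.rpow_mul (by linarith)]
        gcongr

/-- Here `len ≥ log n ≥ (m / 2) ^ (1 / r)`, so the exponent `(m + 1) len / 2` has order at least `m
^ (1 + 1 / r)` and exceeds `m ^ b + m`. The additional `m` absorbs the factor `2 h`. -/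
theorem Regime.eventually_hashError_le (hR : Regime params r K C) {b : ℝ} (hb : b < 1 + 1 / r) :
    ∀ᶠ n in atTop, 2 * hashError (params (secParam r n)) ≤ 2 ^ (-(secParam r n : ℝ) ^ b) := by
  obtain ⟨B, d, hB⟩ := hR.exists_polyBdd_le PolyBdd.id
  have hr := hR.r_pos
  -- This constant is the coefficient of `m ^ (1 + 1 / r)` in the lower bound `m (m / 2) ^ (1 / r) /
  -- 2` for the exponent.
  have hδ : (0 : ℝ) < (1 / 2) ^ (1 / r) / 2 := by positivity
  have h1r : 1 < 1 + 1 / r := by linarith [(by positivity : (0 : ℝ) < 1 / r)]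
  have ht := (tendsto_natCast_atTop_atTop (R := ℝ)).comp (tendsto_secParam hr)
  filter_upwards [ht.eventually (eventually_pow_le_two_rpow (2 * B) d),
    ht.eventually (eventually_rpow_add_rpow_le hb h1r hδ 1),
    eventually_ge_atTop 2] with n h1 h2 hn
  have R := hR.roomFor hn
  have hx1 := one_le_logb hn
  have hm := secParam_le hr hn
  have hm1 := one_le_secParam hr hn
  have hlog := logb_le_clog n
  have h3 := (hB n hn).1
  have hw := hR.le_h _ hm1
  have hg := hR.dim (secParam r n)
  have hh := R.h_le
  have hcl : (Nat.clog 2 n : ℝ) ≤ (params (secParam r n)).len := by exact_mod_cast R.clog_le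
  simp only [Function.comp] at h1 h2
  generalize secParam r n = m at *
  have hhe := hashError_le (P := params m) (by rwa [hg])
  rw [hg] at hhe
  have hm1' : (1 : ℝ) ≤ m := by exact_mod_cast hm1
  have hx : ((m : ℝ) / 2) ^ (1 / r) ≤ Real.logb 2 n := by
    calc ((m : ℝ) / 2) ^ (1 / r) ≤ (Real.logb 2 n ^ r) ^ (1 / r) := by
          gcongr
          linarith
      _ = Real.logb 2 n := by
          rw [← Real.rpow_mul (by linarith), mul_one_div_cancel hr.ne', Real.rpow_one]
  have hexp : (m : ℝ) ^ b + m ≤ (m + 1) * (params m).len / 2 := by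
    rw [Real.rpow_one, one_mul, Real.rpow_add (by linarith), Real.rpow_one] at h2
    have h4 : (m : ℝ) * ((m : ℝ) / 2) ^ (1 / r) ≤ (m + 1) * (params m).len := by
      gcongr
      · linarith
      · linarith
    have h5 : ((m : ℝ) / 2) ^ (1 / r) = (1 / 2) ^ (1 / r) * (m : ℝ) ^ (1 / r) := by
      rw [← Real.mul_rpow (by norm_num) (by linarith)]
      ring_nf
    rw [h5] at h4
    linarith
  have hhle : 2 * ((params m).h : ℝ) ≤ 2 ^ (m : ℝ) := by
    refine le_trans ?_ h1
    have : ((params m).h : ℝ) ≤ B * (m : ℝ) ^ d := by exact_mod_cast hh.trans h3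
    linarith
  calc 2 * hashError (params m) ≤ 2 * ((params m).h : ℝ) * 2 ^ (-((m + 1) * (params m).len : ℝ) / 2) := by
        linarith
    _ ≤ 2 ^ (m : ℝ) * 2 ^ (-((m + 1) * (params m).len : ℝ) / 2) := by gcongr
    _ = 2 ^ ((m : ℝ) + -((m + 1) * (params m).len : ℝ) / 2) := (Real.rpow_add two_pos _ _).symm
    _ ≤ 2 ^ (-(m : ℝ) ^ b) := by
        refine Real.rpow_le_rpow_of_exponent_le one_le_two ?_
        linarith

theorem eventually_rpow_add_one_le {a s : ℝ} (h0 : 0 < a) (h : a < s) :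
    ∀ᶠ x : ℝ in atTop, x ^ a + 1 ≤ x ^ s := by
  filter_upwards [eventually_rpow_add_rpow_le h (h0.trans h) one_pos 1] with x hx
  simpa using hx

theorem Regime.pseudorandom (hR : Regime params r K C) {β c : ℝ} (hβ : 1 / r < β) (hc : 1 / r < c)
    (hLWE : SubexpLWE params β c) : PseudorandomKeysAndCiphertexts params β c r := by
  obtain ⟨m₀, hm₀⟩ := hLWE
  have hr := hR.r_pos
  have hr0 : 0 < 1 / r := by positivity
  refine ⟨⟨m₀, fun m hm => indist_publicKey (hm₀ m hm)⟩, ?_⟩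
  -- The time exponent drops below `β` to pay for the encryption circuit. The advantage exponent
  -- drops below `c` and below `1 + 1 / r`, so that the LWE advantage and the hash error each take
  -- at most half of the new advantage.
  obtain ⟨b, hb, hbβ⟩ := exists_between hβ
  obtain ⟨e, he, hec⟩ := exists_between (lt_min hc (by linarith : 1 / r < 1 + 1 / r))
  obtain ⟨hec, he1⟩ := lt_min_iff.1 hec
  have ht := (tendsto_natCast_atTop_atTop (R := ℝ)).comp (tendsto_secParam hr)
  have hev : ∀ᶠ n in atTop, ∀ μ : Bool,
      Indist (2 ^ ((secParam r n : ℝ) ^ b)) (2 ^ (-(secParam r n : ℝ) ^ e))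
        (realKeyCt (params (secParam r n)) μ) (uniformKeyCt (params (secParam r n))) := by
    filter_upwards [hR.eventually_encSize_le hb, hR.eventually_hashError_le he1,
      ht.eventually (eventually_rpow_add_one_le (hr0.trans hb) hbβ),
      ht.eventually (eventually_rpow_add_one_le (hr0.trans he) hec),
      (tendsto_secParam hr).eventually (eventually_gt_atTop m₀),
      eventually_ge_atTop 2] with n h1 h2 h3 h4 h5 hn μ
    have hh := (hR.roomFor hn).h_pos
    simp only [Function.comp] at h3 h4
    refine indist_keyCt hh (hm₀ _ h5) ?_ ?_ μ
    · have := Real.rpow_le_rpow_of_exponent_le one_le_two h3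
      rw [Real.rpow_add two_pos, Real.rpow_one] at this
      linarith
    · have := Real.rpow_le_rpow_of_exponent_le one_le_two
        (by linarith : -(secParam r n : ℝ) ^ c + 1 ≤ -(secParam r n : ℝ) ^ e)
      rw [Real.rpow_add two_pos, Real.rpow_one] at this
      linarith
  obtain ⟨n₀, h⟩ := eventually_atTop.1 hev
  exact ⟨b, e, hb, he, n₀, fun n hn => h n hn.le⟩

end GSWStream

theorem proposition4p5
    (params : ℕ → GSWStream.Params) (N : ℕ → ℕ) (β c r : ℝ)
    (hβ : 0 < β) (hc : 0 < c) (hrβ : 1 / β < r) (hrc : 1 / c < r)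
    (hg : ∀ m, (params m).g = m)
    (hh : ∃ K : ℕ, ∀ m ≥ 1, 2 * (m + 1) * (params m).len ≤ (params m).h ∧
      (params m).h ≤ K * (m * (params m).len))
    (hN : ∃ K a : ℕ, ∀ n ≥ 2, 1 ≤ N n ∧ N n ≤ K * n ^ a)
    (hq : ∃ K a : ℕ, ∀ n ≥ 2, n * N n < (params (GSWStream.secParam r n)).q ∧
      (params (GSWStream.secParam r n)).q ≤ K * n ^ a)
    (hLWE : GSWStream.SubexpLWE params β c) :
    GSWStream.PseudorandomKeysAndCiphertexts params β c r ∧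
      GSWStream.LinearHomomorphism params r ∧
      GSWStream.StreamComplexity params N r := by
  obtain ⟨K, hK⟩ := hh
  obtain ⟨_, _, hN⟩ := hN
  obtain ⟨Q, a, hQ⟩ := hq
  have hr : 0 < r := (one_div_pos.2 hβ).trans hrβ
  have hR : GSWStream.Regime params r K (Nat.clog 2 Q + a) :=
    { r_pos := hr
      dim := hg
      le_h := fun m hm => (hK m hm).1
      h_le := fun m hm => (hK m hm).2
      -- Both `n` and `N n` are at most `n * N n < q`; this is the only use of the lower bounds on
      -- the two factors.
      lt_q := fun n hn => (Nat.le_mul_of_pos_right n (hN n hn).1).trans_lt (hQ n hn).1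
      len_le := fun n hn => GSWStream.clog_le_mul_clog hn (hQ n hn).2 }
  exact ⟨hR.pseudorandom ((one_div_lt hβ hr).1 hrβ) ((one_div_lt hc hr).1 hrc) hLWE,
    hR.linearHomomorphism, hR.streamComplexity fun n hn =>
      (Nat.le_mul_of_pos_left (N n) (by omega)).trans_lt (hQ n hn).1⟩
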